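/- Let $L,T,a_0,a_1,\kappa>0$, let $w\in AC([0,T];H^1(\mathbb R))$ with time derivative $\dot w$, and write $[w(t)]_0^L=w(t)(L)-w(t)(0)$. **Brittle damage evolutions.** For $\varepsilon>0$ with $\varepsilon a_0<a_1$, a quasi-static evolution of the homogenized brittle damage model with toughness $\kappa/\varepsilon$, stiffnesses $\varepsilon a_0$ (damaged) and $a_1$ (sound) and boundary datum $w$ is a family of weakly-* measurable maps $u_\varepsilon:[0,T]\to H^1((0,L))$, $\Theta_\varepsilon:[0,T]\to L^\infty((0,L);[0,1])$, $a_\varepsilon=\bigl(\frac{1-\Theta_\varepsilon}{\varepsilon a_0}+\frac{\Theta_\varepsilon}{a_1}\bigr)^{-1}$ such that, with $\mathcal E_\varepsilon(t)=\frac12\int_0^L a_\varepsilon(t)|u_\varepsilon'(t)|^2dx+\frac\kappa\varepsilon\int_0^L(1-\Theta_\varepsilon(t))\,dx$: * $u_\varepsilon(t)\in w(t)+H^1_0((0,L))$ for all $t\in[0,T]$; * $\mathcal E_\varepsilon(0)\le\int_0^L\bigl(\frac12\frac{\varepsilon a_0a_1}{\theta a_1+(1-\theta)\varepsilon a_0}|v'|^2+\frac\kappa\varepsilon\theta\bigr)dx$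 for all $v\in w(0)+H^1_0((0,L))$ and $\theta\in L^\infty((0,L);[0,1])$; * $a_\varepsilon(t)\le a_\varepsilon(s)$ and $\Theta_\varepsilon(t)\le\Theta_\varepsilon(s)$ a.e. in $(0,L)$ for $0\le s\le t\le T$; * $\frac12\int_0^L a_\varepsilon(t)|u_\varepsilon'(t)|^2dx\le\frac12\int_0^L\frac{\varepsilon a_0a_\varepsilon(t)}{\theta a_\varepsilon(t)+(1-\theta)\varepsilon a_0}|v'|^2dx+\frac\kappa\varepsilon\int_0^L\theta\,\Theta_\varepsilon(t)\,dx$ for all $t\in[0,T]$, $v\in w(t)+H^1_0((0,L))$ and $\theta\in L^\infty((0,L);[0,1])$; * $\mathcal E_\varepsilon(t)=\mathcal E_\varepsilon(0)+\int_0^t\int_0^L a_\varepsilon(s)u_\varepsilon'(s)\dot w'(s)\,dx\,ds$ for all $t\in[0,T]$. The stress $\sigma_\varepsilon(t)=a_\varepsilon(t)u_\varepsilon'(t)$ is then constant in space. **Limit evolutions.** Consider such evolutions along a sequence $\varepsilon\to0$, and let $(u,e,p,\sigma,\mu)$ be their limit, in the sense that for every $t\in[0,T]$: $u_\varepsilon(t)\rightharpoonup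 u(t)$ weakly-* in $BV((0,L))$; $\mu_\varepsilon(t)=\frac{1-\Theta_\varepsilon(t)}{\varepsilon}\mathcal L^1\llcorner(0,L)\rightharpoonup\mu(t)$ weakly-* in $\mathcal M([0,L])$; $\sigma_\varepsilon(t)\to\sigma(t)$ in $\mathbb R$; $\frac{\sigma_\varepsilon(t)}{a_1}\Theta_\varepsilon(t)\rightharpoonup e(t)$ weakly in $L^2((0,L))$; $\frac{\sigma_\varepsilon(t)}{a_0}\mu_\varepsilon(t)\rightharpoonup p(t)$ weakly-* in $\mathcal M([0,L])$. **Perfect plasticity.** A triple $(u,e,p):[0,T]\to BV((0,L))\times L^2((0,L))\times\mathcal M([0,L])$ is a quasi-static evolution of perfect plasticity if, for all $t\in[0,T]$: $Du(t)=e(t)\mathcal L^1\llcorner(0,L)+p(t)\llcorner(0,L)$; $p(t)\llcorner\{0,L\}=(w(t)-u(t))(\delta_L-\delta_0)$, where $u(t)$ stands for its inner traces at $0$ and $L$; the stress $a_1e(t)$ satisfies $(a_1e(t))'=0$ in $H^{-1}((0,L))$ and $|a_1e(t)|\le\sqrt{2\kappa a_0}$ a.e. in $(0,L)$; $p$ has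 bounded variation on $[0,T]$ with values in $\mathcal M([0,L])$; and $$\frac12\int_0^L a_1e(t)^2dx+\sqrt{2\kappa a_0}\,\mathcal V(p;0,t)=\frac12\int_0^L a_1e(0)^2dx+\int_0^t\int_0^L a_1e(s)\,\dot w'(s)\,dx\,ds,$$ where $\mathcal V(p;0,t)=\sup\sum_{i=1}^n|p(s_i)-p(s_{i-1})|([0,L])$ over all $n\in\mathbb N$ and $0=s_0\le s_1\le\dots\le s_n=t$. **Theorem 1.2.** Let $(u,e,p,\sigma,\mu)$ be a limit evolution as above. Then the following are equivalent: 1. $(u,e,p)$ is a quasi-static evolution of perfect plasticity. 2. For all $0\le s<t\le T$: if $\bigl|[w(t)]_0^L\bigr|<\bigl|[w(s)]_0^L\bigr|$, then $\bigl|[w(t)]_0^L\bigr|\le\sqrt{2\kappa a_0}\,\frac L{a_1}$. 3. The stress saturates the constraint from the onset of damage onward: either $\mu(T)([0,L])=0$ (no damage ever occurs), or $|\sigma(t)|=\sqrt{2\kappa a_0}$ for all $t\in[t_0,T]$, where $t_0=\sup\{t\in[0,T]:\mu(t)([0,L])=0\}$, with $t_0=0$ if this set is empty. -/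

import Mathlib

open Set Filter Topology MeasureTheory
open scoped ENNReal ContDiff

noncomputable section

namespace BrittleDamage

/-! ### Sobolev spaces in dimension one -/

/-- `φ ∈ C_c^∞(U)`. -/
def IsTestFun (U : Set ℝ) (φ : ℝ → ℝ) : Prop :=
  ContDiff ℝ ∞ φ ∧ HasCompactSupport φ ∧ tsupport φ ⊆ U

/-- `g` is the weak derivative of `v` in the open set `U`. -/
def IsWeakDeriv (U : Set ℝ) (v g : ℝ → ℝ) : Prop :=
  ∀ φ : ℝ → ℝ, IsTestFun U φ → ∫ x in U, v x * deriv φ x = - ∫ x in U, g x * φ x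

/-- The Lebesgue space `L²(U)`. -/
abbrev L2 (U : Set ℝ) : Type := Lp ℝ 2 (volume.restrict U)

theorem IsTestFun.memLp {U V : Set ℝ} {φ : ℝ → ℝ} (h : IsTestFun U φ) :
    MemLp φ 2 (volume.restrict V) :=
  (h.1.continuous.memLp_of_hasCompactSupport h.2.1).restrict V

theorem IsTestFun.memLp_deriv {U V : Set ℝ} {φ : ℝ → ℝ} (h : IsTestFun U φ) :
    MemLp (deriv φ) 2 (volume.restrict V) :=
  ((h.1.continuous_deriv (by simp)).memLp_of_hasCompactSupport h.2.1.deriv).restrict V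

/-- The Sobolev space `H¹(U)`: the pairs `(v, v')` of functions of `L²(U)` such that `v'` is the
weak derivative of `v`, with the norm `(‖v‖² + ‖v'‖²)^{1/2}` inherited from `L²(U) × L²(U)`. -/
def H1 (U : Set ℝ) : Submodule ℝ (WithLp 2 (L2 U × L2 U)) where
  carrier := {z | IsWeakDeriv U z.fst z.snd}
  zero_mem' := by
    intro φ _
    have h0 : ((0 : L2 U) : ℝ → ℝ) =ᵐ[volume.restrict U] 0 := Lp.coeFn_zero _ _ _
    have h1 : ∫ x in U, ((0 : L2 U) : ℝ → ℝ) x * deriv φ x = 0 :=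
      integral_eq_zero_of_ae (by filter_upwards [h0] with x hx; rw [hx]; simp)
    have h2 : ∫ x in U, ((0 : L2 U) : ℝ → ℝ) x * φ x = 0 :=
      integral_eq_zero_of_ae (by filter_upwards [h0] with x hx; rw [hx]; simp)
    exact h1.trans (by rw [← neg_zero, ← h2]; rfl)
  add_mem' := by
    intro y z hy hz φ hφ
    have hd := hφ.memLp_deriv (V := U)
    have hm := hφ.memLp (V := U)
    have h1 : ∫ x in U, ((y + z).fst : ℝ → ℝ) x * deriv φ x
        = (∫ x in U, (y.fst : ℝ → ℝ) x * deriv φ x) + ∫ x in U, (z.fst : ℝ → ℝ) x * deriv φ x := by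
      refine Eq.trans ?_ (integral_add ((Lp.memLp y.fst).integrable_mul hd)
        ((Lp.memLp z.fst).integrable_mul hd))
      refine integral_congr_ae ?_
      filter_upwards [Lp.coeFn_add y.fst z.fst] with x hx
      simp only [WithLp.add_fst, hx, Pi.add_apply, add_mul]
    have h2 : ∫ x in U, ((y + z).snd : ℝ → ℝ) x * φ x
        = (∫ x in U, (y.snd : ℝ → ℝ) x * φ x) + ∫ x in U, (z.snd : ℝ → ℝ) x * φ x := by
      refine Eq.trans ?_ (integral_add ((Lp.memLp y.snd).integrable_mul hm)
        ((Lp.memLp z.snd).integrable_mul hm))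
      refine integral_congr_ae ?_
      filter_upwards [Lp.coeFn_add y.snd z.snd] with x hx
      simp only [WithLp.add_snd, hx, Pi.add_apply, add_mul]
    rw [h1, h2, hy φ hφ, hz φ hφ]
    ring
  smul_mem' := by
    intro c z hz φ hφ
    have h1 : ∫ x in U, ((c • z).fst : ℝ → ℝ) x * deriv φ x
        = c * ∫ x in U, (z.fst : ℝ → ℝ) x * deriv φ x := by
      rw [← integral_const_mul]
      refine integral_congr_ae ?_
      filter_upwards [Lp.coeFn_smul c z.fst] with x hx
      simp only [WithLp.smul_fst, hx, Pi.smul_apply, smul_eq_mul, mul_assoc]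
    have h2 : ∫ x in U, ((c • z).snd : ℝ → ℝ) x * φ x
        = c * ∫ x in U, (z.snd : ℝ → ℝ) x * φ x := by
      rw [← integral_const_mul]
      refine integral_congr_ae ?_
      filter_upwards [Lp.coeFn_smul c z.snd] with x hx
      simp only [WithLp.smul_snd, hx, Pi.smul_apply, smul_eq_mul, mul_assoc]
    rw [h1, h2, hz φ hφ]
    ring

/-- The function underlying an element of `H¹(U)` (defined almost everywhere in `U`). -/
def fn {U : Set ℝ} (v : H1 U) : ℝ → ℝ := (v : WithLp 2 (L2 U × L2 U)).fst

/-- The weak derivative of an element of `H¹(U)` (defined almost everywhere in `U`). -/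
def grad {U : Set ℝ} (v : H1 U) : ℝ → ℝ := (v : WithLp 2 (L2 U × L2 U)).snd

/-- `v ∈ H¹₀(U)`, for a function `v` with weak derivative `g`: the pair `(v, g)` is the limit in
`L²(U) × L²(U)` of pairs `(φ n, (φ n)')` with `φ n ∈ C_c^∞(U)`. -/
def MemH10 (U : Set ℝ) (v g : ℝ → ℝ) : Prop :=
  MemLp v 2 (volume.restrict U) ∧ MemLp g 2 (volume.restrict U) ∧
    ∃ φ : ℕ → ℝ → ℝ, (∀ n, IsTestFun U (φ n)) ∧
      Tendsto (fun n => eLpNorm (fun x => φ n x - v x) 2 (volume.restrict U)) atTop (𝓝 0) ∧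
      Tendsto (fun n => eLpNorm (fun x => deriv (φ n) x - g x) 2 (volume.restrict U)) atTop (𝓝 0)

/-- `v ∈ w + H¹₀(U)`, for `v ∈ H¹(U)` and `w ∈ H¹(ℝ)`. -/
def SameBoundaryValues {U : Set ℝ} (v : H1 U) (w : H1 univ) : Prop :=
  MemH10 U (fun x => fn v x - fn w x) (fun x => grad v x - grad w x)

open Classical in
/-- The continuous representative of an element of `H¹(ℝ)`. -/
def contRep (w : H1 univ) : ℝ → ℝ :=
  if h : ∃ f : ℝ → ℝ, Continuous f ∧ f =ᵐ[volume] fn w then h.choose else fn w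

/-- `[w]₀ᴸ = w(L) - w(0)` for `w ∈ H¹(ℝ)`. -/
def jump (L : ℝ) (w : H1 univ) : ℝ := contRep w L - contRep w 0

open Classical in
/-- The time derivative of `w : [0,T] → H¹(ℝ)` at `t`: the weak limit in the Hilbert space `H¹(ℝ)`
of the difference quotients (and `0` where there is none; for an absolutely continuous `w` it
exists at almost every time). -/
def timeDeriv (w : ℝ → H1 univ) (t : ℝ) : H1 univ :=
  if h : ∃ d : H1 univ, ∀ l : H1 univ →L[ℝ] ℝ,
      Tendsto (fun s => l ((s - t)⁻¹ • (w s - w t))) (𝓝[≠] t) (𝓝 (l d))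
  then h.choose else 0

/-! ### Quasi-static evolutions of brittle damage at a fixed scale -/

/-- The stiffness of the mixture of two materials of stiffness `α` and `β`,
`θ` being the volume fraction of `α`: the only element of the `G`-closure set in dimension one. -/
def mixture (α β θ : ℝ) : ℝ := α * β / (θ * β + (1 - θ) * α)

/-- The stiffness `a_ε = ((1 - Θ) / (ε a₀) + Θ / a₁)⁻¹`, where `Θ` is the volume fraction of the
sound material. -/
def stiffness (a₀ a₁ ε Θ : ℝ) : ℝ := ((1 - Θ) / (ε * a₀) + Θ / a₁)⁻¹

/-- The total energy of a displacement of gradient `g`, with volume fraction `Θ` of sound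
material. -/
def totalEnergy (L a₀ a₁ κ ε : ℝ) (g Θ : ℝ → ℝ) : ℝ :=
  1 / 2 * (∫ x in Ioo 0 L, stiffness a₀ a₁ ε (Θ x) * g x ^ 2)
    + κ / ε * ∫ x in Ioo 0 L, (1 - Θ x)

/-- `θ ∈ L^∞((0,L); [0,1])`. -/
def IsFraction (L : ℝ) (θ : ℝ → ℝ) : Prop :=
  AEStronglyMeasurable θ (volume.restrict (Ioo 0 L)) ∧
    ∀ᵐ x ∂volume.restrict (Ioo 0 L), θ x ∈ Icc (0 : ℝ) 1

/-- `(u, Θ)`, with the stiffness `a(t) = stiffness a₀ a₁ ε (Θ t)`, is a quasi-static evolution of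
the homogenized brittle damage model on the time interval `[0,T]`, with toughness `κ / ε`,
stiffness `ε a₀` (damaged) and `a₁` (sound), and boundary datum `w`. -/
structure IsBrittleEvolution (L T a₀ a₁ κ ε : ℝ) (w : ℝ → H1 univ)
    (u : ℝ → H1 (Ioo 0 L)) (Θ : ℝ → ℝ → ℝ) : Prop where
  fraction : ∀ t ∈ Icc 0 T, IsFraction L (Θ t)
  measurable_fraction : ∀ φ : ℝ → ℝ, IntegrableOn φ (Ioo 0 L) →
    AEMeasurable (fun t => ∫ x in Ioo 0 L, φ x * Θ t x) (volume.restrict (Icc 0 T))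
  measurable_stiffness : ∀ φ : ℝ → ℝ, IntegrableOn φ (Ioo 0 L) →
    AEMeasurable (fun t => ∫ x in Ioo 0 L, φ x * stiffness a₀ a₁ ε (Θ t x))
      (volume.restrict (Icc 0 T))
  measurable_displacement : ∀ l : H1 (Ioo 0 L) →L[ℝ] ℝ,
    AEMeasurable (fun t => l (u t)) (volume.restrict (Icc 0 T))
  /-- Dirichlet boundary condition -/
  dirichlet : ∀ t ∈ Icc 0 T, SameBoundaryValues (u t) (w t)
  /-- Initial minimality -/
  initial : ∀ v : H1 (Ioo 0 L), SameBoundaryValues v (w 0) → ∀ θ : ℝ → ℝ, IsFraction L θ →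
    totalEnergy L a₀ a₁ κ ε (grad (u 0)) (Θ 0) ≤
      ∫ x in Ioo 0 L, (1 / 2 * mixture (ε * a₀) a₁ (θ x) * grad v x ^ 2 + κ / ε * θ x)
  /-- Monotonicity -/
  mono : ∀ s ∈ Icc 0 T, ∀ t ∈ Icc 0 T, s ≤ t → ∀ᵐ x ∂volume.restrict (Ioo 0 L),
    stiffness a₀ a₁ ε (Θ t x) ≤ stiffness a₀ a₁ ε (Θ s x) ∧ Θ t x ≤ Θ s x
  /-- One-sided minimality -/
  oneSided : ∀ t ∈ Icc 0 T, ∀ v : H1 (Ioo 0 L), SameBoundaryValues v (w t) →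
    ∀ θ : ℝ → ℝ, IsFraction L θ →
    1 / 2 * (∫ x in Ioo 0 L, stiffness a₀ a₁ ε (Θ t x) * grad (u t) x ^ 2) ≤
      1 / 2 * (∫ x in Ioo 0 L,
        mixture (ε * a₀) (stiffness a₀ a₁ ε (Θ t x)) (θ x) * grad v x ^ 2)
      + κ / ε * ∫ x in Ioo 0 L, θ x * Θ t x
  /-- Energy balance -/
  energyBalance : ∀ t ∈ Icc 0 T,
    totalEnergy L a₀ a₁ κ ε (grad (u t)) (Θ t) = totalEnergy L a₀ a₁ κ ε (grad (u 0)) (Θ 0)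
      + ∫ s in (0 : ℝ)..t, ∫ x in Ioo 0 L,
          stiffness a₀ a₁ ε (Θ s x) * grad (u s) x * grad (timeDeriv w s) x

/-! ### Measures and functions of bounded variation

Bounded Radon measures in a Borel set `X ⊆ ℝ` are the signed measures on `ℝ` carried by `X`. -/

/-- `ν` is carried by `X`. -/
def CarriedBy (ν : SignedMeasure ℝ) (X : Set ℝ) : Prop := ν.restrict X = ν

/-- The distributional derivative of `v` in the open set `U` is the bounded measure `D`. -/
def HasDistribDeriv (U : Set ℝ) (v : ℝ → ℝ) (D : SignedMeasure ℝ) : Prop :=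
  CarriedBy D U ∧
    ∀ φ : ℝ → ℝ, IsTestFun U φ → ∫ x in U, v x * deriv φ x = - ∫ᵛ x, φ x ∂•D

/-- `v ∈ BV(U)`. -/
def MemBV (U : Set ℝ) (v : ℝ → ℝ) : Prop :=
  IntegrableOn v U ∧ ∃ D, HasDistribDeriv U v D

/-- `c` is the inner trace of `v` at the boundary point `x` of `U`. -/
def IsTrace (U : Set ℝ) (v : ℝ → ℝ) (x c : ℝ) : Prop :=
  Tendsto (fun r : ℝ => r⁻¹ * ∫ y in U ∩ Metric.ball x r, |v y - c|) (𝓝[>] 0) (𝓝 0)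

/-- The total variation `𝒱(q; s, t)` in the time interval `[s,t]` of a time-dependent measure `q`,
for the total variation norm of the measures in `[0,L]`. -/
def timeVariation (L : ℝ) (q : ℝ → SignedMeasure ℝ) (s t : ℝ) : ℝ≥0∞ :=
  ⨆ (n : ℕ) (r : ℕ → ℝ) (_ : Monotone r ∧ r 0 = s ∧ r n = t),
    ∑ i ∈ Finset.range n, (q (r (i + 1)) - q (r i)).variation (Icc 0 L)

/-- The densities `f n` on `(0,L)` converge weakly-* to `ν` in the bounded measures in `[0,L]`,
the dual of `C([0,L])`. -/
def WeakStarClosed (L : ℝ) (f : ℕ → ℝ → ℝ) (ν : SignedMeasure ℝ) : Prop :=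
  ∀ φ : ℝ → ℝ, Continuous φ →
    Tendsto (fun n => ∫ x in Ioo 0 L, φ x * f n x) atTop (𝓝 (∫ᵛ x, φ x ∂•ν))

/-- The densities `f n` on `(0,L)` converge weakly-* to `ν` in the bounded measures in `(0,L)`,
the dual of `C₀((0,L))`. -/
def WeakStarOpen (L : ℝ) (f : ℕ → ℝ → ℝ) (ν : SignedMeasure ℝ) : Prop :=
  ∀ φ : ℝ → ℝ, Continuous φ → (∀ x ∉ Ioo 0 L, φ x = 0) →
    Tendsto (fun n => ∫ x in Ioo 0 L, φ x * f n x) atTop (𝓝 (∫ᵛ x, φ x ∂•ν))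

/-- The functions `v n ∈ H¹((0,L))` converge weakly-* to `u` in `BV((0,L))`: strongly in `L¹`, and
their derivatives weakly-* as measures in `(0,L)`. -/
def WeakStarBV (L : ℝ) (v : ℕ → H1 (Ioo 0 L)) (u : ℝ → ℝ) : Prop :=
  IntegrableOn u (Ioo 0 L) ∧
    Tendsto (fun n => eLpNorm (fun x => fn (v n) x - u x) 1 (volume.restrict (Ioo 0 L)))
      atTop (𝓝 0) ∧
    ∃ D, HasDistribDeriv (Ioo 0 L) u D ∧ WeakStarOpen L (fun n => grad (v n)) D

/-! ### The limit evolution -/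

/-- The stress `σ_ε = a_ε u_ε'`. -/
def stress {L : ℝ} (a₀ a₁ ε : ℝ) (v : H1 (Ioo 0 L)) (Θ : ℝ → ℝ) (x : ℝ) : ℝ :=
  stiffness a₀ a₁ ε (Θ x) * grad v x

/-- `(u, e, p, σ, μ)` is the limit, at every time of `[0,T]`, of the brittle damage evolutions
`(uε n, Θε n)` at the scales `ε n`. The stresses, which are constant in space, converge to the real
number `σ t`. -/
structure IsLimitEvolution (L T a₀ a₁ : ℝ) (ε : ℕ → ℝ)
    (uε : ℕ → ℝ → H1 (Ioo 0 L)) (Θε : ℕ → ℝ → ℝ → ℝ)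
    (u e : ℝ → ℝ → ℝ) (p : ℝ → SignedMeasure ℝ) (σ : ℝ → ℝ) (μ : ℝ → SignedMeasure ℝ) :
    Prop where
  /-- `u_ε(t) ⇀ u(t)` weakly-* in `BV((0,L))` -/
  displacement : ∀ t ∈ Icc 0 T, WeakStarBV L (fun n => uε n t) (u t)
  /-- `μ_ε(t) = (1 - Θ_ε(t)) / ε ⇀ μ(t)` weakly-* in the measures in `[0,L]` -/
  damage : ∀ t ∈ Icc 0 T, CarriedBy (μ t) (Icc 0 L) ∧
    WeakStarClosed L (fun n x => (1 - Θε n t x) / ε n) (μ t)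
  /-- `σ_ε(t) → σ(t)` -/
  stress_limit : ∀ t ∈ Icc 0 T,
    Tendsto (fun n => eLpNorm (fun x => stress a₀ a₁ (ε n) (uε n t) (Θε n t) x - σ t) 2
      (volume.restrict (Ioo 0 L))) atTop (𝓝 0)
  /-- `e_ε(t) = σ_ε(t) Θ_ε(t) / a₁ ⇀ e(t)` weakly in `L²((0,L))` -/
  elastic : ∀ t ∈ Icc 0 T, MemLp (e t) 2 (volume.restrict (Ioo 0 L)) ∧
    ∀ φ : ℝ → ℝ, MemLp φ 2 (volume.restrict (Ioo 0 L)) →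
      Tendsto (fun n => ∫ x in Ioo 0 L,
          φ x * (stress a₀ a₁ (ε n) (uε n t) (Θε n t) x / a₁ * Θε n t x))
        atTop (𝓝 (∫ x in Ioo 0 L, φ x * e t x))
  /-- `p_ε(t) = σ_ε(t) μ_ε(t) / a₀ ⇀ p(t)` weakly-* in the measures in `[0,L]` -/
  plastic : ∀ t ∈ Icc 0 T, CarriedBy (p t) (Icc 0 L) ∧
    WeakStarClosed L (fun n x => stress a₀ a₁ (ε n) (uε n t) (Θε n t) x / a₀
      * ((1 - Θε n t x) / ε n)) (p t)

/-! ### Perfect plasticity -/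

/-- `(u, e, p) : [0,T] → BV((0,L)) × L²((0,L)) × ℳ([0,L])` is a quasi-static evolution of perfect
plasticity with stiffness `a₁`, elasticity domain `K = [-√(2κa₀), √(2κa₀)]` and boundary
datum `w`. The stress is `a₁ e(t)`. -/
structure IsPerfectPlasticEvolution (L T a₀ a₁ κ : ℝ) (w : ℝ → H1 univ)
    (u e : ℝ → ℝ → ℝ) (p : ℝ → SignedMeasure ℝ) : Prop where
  memBV : ∀ t ∈ Icc 0 T, MemBV (Ioo 0 L) (u t)
  memL2 : ∀ t ∈ Icc 0 T, MemLp (e t) 2 (volume.restrict (Ioo 0 L))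
  carried : ∀ t ∈ Icc 0 T, CarriedBy (p t) (Icc 0 L)
  /-- Additive decomposition `Du(t) = e(t) ℒ¹ + p(t)` in `(0,L)` -/
  additive : ∀ t ∈ Icc 0 T, HasDistribDeriv (Ioo 0 L) (u t)
    ((volume.restrict (Ioo 0 L)).withDensityᵥ (e t) + (p t).restrict (Ioo 0 L))
  /-- Relaxed boundary condition `p(t) = (w(t) - u(t)) (δ_L - δ_0)` on `{0, L}` -/
  boundary : ∀ t ∈ Icc 0 T, ∃ c₀ c₁ : ℝ,
    IsTrace (Ioo 0 L) (u t) 0 c₀ ∧ IsTrace (Ioo 0 L) (u t) L c₁ ∧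
    (p t).restrict {0, L} =
      VectorMeasure.dirac L (contRep (w t) L - c₁) - VectorMeasure.dirac 0 (contRep (w t) 0 - c₀)
  /-- Equilibrium `σ(t)' = 0` in `H⁻¹((0,L))`, the dual of `H¹₀((0,L))` -/
  equilibrium : ∀ t ∈ Icc 0 T, ∀ v g : ℝ → ℝ, MemH10 (Ioo 0 L) v g →
    ∫ x in Ioo 0 L, a₁ * e t x * g x = 0
  /-- Stress constraint `σ(t) ∈ K` -/
  stressConstraint : ∀ t ∈ Icc 0 T, ∀ᵐ x ∂volume.restrict (Ioo 0 L),
    a₁ * e t x ∈ Icc (-√(2 * κ * a₀)) √(2 * κ * a₀)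
  /-- `p` has bounded variation in time -/
  boundedVariation : timeVariation L p 0 T ≠ ⊤
  /-- The power of the external loads is integrable in time -/
  integrable_power : IntervalIntegrable
    (fun s => ∫ x in Ioo 0 L, a₁ * e s x * grad (timeDeriv w s) x) volume 0 T
  /-- Energy balance, with the dissipation `√(2κa₀) 𝒱(p; 0, t)` -/
  energyBalance : ∀ t ∈ Icc 0 T,
    1 / 2 * (∫ x in Ioo 0 L, a₁ * e t x ^ 2)
        + √(2 * κ * a₀) * (timeVariation L p 0 t).toReal =
      1 / 2 * (∫ x in Ioo 0 L, a₁ * e 0 x ^ 2)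
        + ∫ s in (0 : ℝ)..t, ∫ x in Ioo 0 L, a₁ * e s x * grad (timeDeriv w s) x

/-- The onset of damage `t₀ = sup {t ∈ [0,T] : μ(t)([0,L]) = 0}`, with `t₀ = 0` if the set is
empty. -/
def onset (L T : ℝ) (μ : ℝ → SignedMeasure ℝ) : ℝ :=
  sSup {t : ℝ | t ∈ Icc 0 T ∧ μ t (Icc 0 L) = 0}

end BrittleDamage

end

open BrittleDamage

noncomputable section

namespace BrittleDamage

/-! ### Primitives and test functions on the line -/

/-! In one dimension the problem collapses to two scalar functions of time: the jump J of the
boundary datum and the compliance A of the bar. At scale ε, one-sided minimality with no added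
damage makes the displacement a minimizer of the elastic energy. The bar is then a set of springs in
series: its stress is the constant J / A_ε, where A_ε is the integral of 1 / a_ε, an affine function
of the total rescaled damage (`stress_ae_eq`, `integral_inv_stiffness`). The position of the damage
plays no role.

Let k = √(2κa₀), ℓ = L / a₁, and let M be the total mass of μ. In the limit A = ℓ + M / a₀, σ = J /
A, e = σ / a₁ and p = (σ / a₀) μ (`stress_eq`, `elastic_ae_eq`, `plastic_eq`). One-sided minimality
becomes |J| ≤ k A, initial minimality becomes A(0) = ℓ or |J(0)| = k A(0), and the energy balance
passes to the limit (`isComplianceEvolution`). Formally, differentiating that balance gives (k² -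
σ²) A' = 0, so the compliance grows only at saturation. Since A is merely monotone at first, the
rigorous form comes from finite increments. `compliance_increment` bounds the yield deficit on an
interval where A grows by the variation of J there. Hence A is continuous, and `exists_saturated`
says that any compliance above ℓ was first reached at a saturated time.

All the conditions are compared with the pivot "at each time, either there is no damage or |σ| = k".
For the datum, a damaged unsaturated time t comes with an earlier saturated time s of the same
compliance, and the intermediate value theorem yields a forbidden decrease of |J| above k ℓ
(`saturated_iff_datum`). The condition on the onset is the same statement, up to a limit at the
onset itself (`saturated_iff_onset`).

For plasticity, the pivot freezes σ once damage starts, because a continuous function of modulus k >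
0 cannot change sign. Then p moves along the increasing μ with a fixed factor, its variation is k /
a₀ times the increase of M, and the limit balance is the plastic one. Conversely, if t is damaged
and unsaturated and s is as above, subtracting the two balances between s and t gives a negative
multiple of A - ℓ equal to a nonnegative dissipation (`saturated_of_isPerfectPlasticEvolution`). -/

theorem integral_primitive_mul_deriv {G φ : ℝ → ℝ} {a b : ℝ}
    (hG : IntervalIntegrable G volume a b) (hφ : ContDiff ℝ 1 φ) (c : ℝ) :
    ∫ x in a..b, (c + ∫ y in a..x, G y) * deriv φ x
      = (c + ∫ y in a..b, G y) * φ b - c * φ a - ∫ x in a..b, G x * φ x := by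
  have hac : AbsolutelyContinuousOnInterval (fun x => c + ∫ y in a..x, G y) a b :=
    (contDiff_const (n := 1)).contDiffOn.absolutelyContinuousOnInterval.add
      (hG.absolutelyContinuousOnInterval_intervalIntegral left_mem_uIcc)
  have hφac : AbsolutelyContinuousOnInterval φ a b :=
    hφ.contDiffOn.absolutelyContinuousOnInterval
  rw [hac.integral_mul_deriv_eq_deriv_mul hφac]
  congr 1
  · simp
  refine intervalIntegral.integral_congr_ae ?_
  filter_upwards [hG.ae_hasDerivAt_integral] with x hx hxab
  rw [((hx (uIoc_subset_uIcc hxab) a left_mem_uIcc).const_add c).deriv]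

/-- The primitive started at the leftmost point of the support vanishes again to the right of the
support because the integral is zero. Order-connectedness keeps the interval spanned by the support
inside U. -/
theorem exists_isTestFun_deriv_eq {U : Set ℝ} (hU : U.OrdConnected) {χ : ℝ → ℝ}
    (hχ : IsTestFun U χ) (h0 : ∫ x, χ x = 0) : ∃ φ, IsTestFun U φ ∧ deriv φ = χ := by
  rcases (tsupport χ).eq_empty_or_nonempty with he | hne
  · have : χ = 0 := tsupport_eq_empty_iff.1 he
    exact ⟨0, ⟨contDiff_const, HasCompactSupport.zero, by simp⟩, by rw [this]; simp⟩
  obtain ⟨c, hc⟩ := hχ.2.1.isCompact.exists_isLeast hne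
  obtain ⟨d, hd⟩ := hχ.2.1.isCompact.exists_isGreatest hne
  have hsub : tsupport χ ⊆ Icc c d := fun x hx => ⟨hc.2 hx, hd.2 hx⟩
  have hz : ∀ x, x ∉ Icc c d → χ x = 0 := fun x hx => image_eq_zero_of_notMem_tsupport
    (fun h => hx (hsub h))
  have hcont := hχ.1.continuous
  have hder : ∀ x, HasDerivAt (fun x => ∫ y in c..x, χ y) (χ x) x := fun x =>
    intervalIntegral.integral_hasDerivAt_right (hcont.intervalIntegrable _ _)
      hcont.stronglyMeasurable.stronglyMeasurableAtFilter hcont.continuousAt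
  have hderiv : deriv (fun x => ∫ y in c..x, χ y) = χ := funext fun x => (hder x).deriv
  have hsupp : Function.support (fun x => ∫ y in c..x, χ y) ⊆ Icc c d := by
    intro x hx
    by_contra hxm
    refine hx ?_
    rcases lt_or_ge x c with h | h
    · refine intervalIntegral.integral_zero_ae ?_
      filter_upwards [show ∀ᵐ y : ℝ, y ≠ c by simp [ae_iff]] with y hyc hy
      rw [uIoc_of_ge h.le] at hy
      exact hz y fun hy' => hyc (le_antisymm hy.2 hy'.1)
    · have hdx : d < x := by
        by_contra hdx
        exact hxm ⟨h, not_lt.1 hdx⟩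
      change ∫ y in c..x, χ y = 0
      rw [intervalIntegral.integral_of_le h, ← integral_Icc_eq_integral_Ioc,
        setIntegral_eq_integral_of_forall_compl_eq_zero, h0]
      intro y hy
      exact hz y fun hy' => hy ⟨hy'.1, hy'.2.trans hdx.le⟩
  refine ⟨fun x => ∫ y in c..x, χ y, ⟨?_, ?_, ?_⟩, hderiv⟩
  · rw [contDiff_infty_iff_deriv, hderiv]
    exact ⟨fun x => (hder x).differentiableAt, hχ.1⟩
  · exact HasCompactSupport.of_support_subset_isCompact isCompact_Icc hsupp
  · exact (closure_minimal hsupp isClosed_Icc).trans (hU.out (hχ.2.2 hc.1) (hχ.2.2 hd.1))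

theorem IsTestFun.add_const_mul {U : Set ℝ} {φ ψ : ℝ → ℝ} (hφ : IsTestFun U φ)
    (hψ : IsTestFun U ψ) (c : ℝ) : IsTestFun U (fun x => φ x + c * ψ x) := by
  have h : HasCompactSupport (fun x => c * ψ x) := hψ.2.1.mul_left
  refine ⟨hφ.1.add (contDiff_const.mul hψ.1), hφ.2.1.add h, ?_⟩
  refine (tsupport_add φ fun x => c * ψ x).trans (union_subset hφ.2.2 ?_)
  exact (tsupport_mul_subset_right (f := fun _ => c) (g := ψ)).trans hψ.2.2

theorem exists_isTestFun_integral_eq_one {U : Set ℝ} (hU : IsOpen U) (hne : U.Nonempty) :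
    ∃ ρ, IsTestFun U ρ ∧ ∫ x, ρ x = 1 := by
  obtain ⟨x, hx⟩ := hne
  obtain ⟨f, hf1, hf2, hf3, hf4, hf5⟩ :=
    exists_contDiff_tsupport_subset (n := ⊤) (hU.mem_nhds hx)
  have hpos : 0 < ∫ x, f x :=
    hf3.continuous.integral_pos_of_hasCompactSupport_nonneg_nonzero hf2
      (fun y => (hf4 ⟨y, rfl⟩).1) (x := x) (by simp [hf5])
  refine ⟨fun x => (∫ y, f y)⁻¹ * f x, ⟨contDiff_const.mul hf3, hf2.mul_left, ?_⟩, ?_⟩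
  · exact (tsupport_mul_subset_right (f := fun _ => (∫ y, f y)⁻¹) (g := f)).trans hf1
  · rw [integral_const_mul, inv_mul_cancel₀ hpos.ne']

theorem integrable_mul_isTestFun {U : Set ℝ} {h φ : ℝ → ℝ}
    (hh : LocallyIntegrableOn h U) (hφ : IsTestFun U φ) : Integrable (fun x => h x * φ x) := by
  have h1 : IntegrableOn h (tsupport φ) := hh.integrableOn_compact_subset hφ.2.2 hφ.2.1.isCompact
  have h2 : IntegrableOn (fun x => h x * φ x) (tsupport φ) :=
    h1.mul_continuousOn hφ.1.continuous.continuousOn hφ.2.1.isCompact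
  refine (integrableOn_iff_integrable_of_support_subset ?_).1 h2
  intro x hx
  exact subset_tsupport _ (right_ne_zero_of_mul hx)

theorem setIntegral_mul_isTestFun {U : Set ℝ} {φ : ℝ → ℝ} (h : ℝ → ℝ) (hφ : IsTestFun U φ) :
    ∫ x in U, h x * φ x = ∫ x, h x * φ x := by
  refine setIntegral_eq_integral_of_forall_compl_eq_zero fun x hx => ?_
  rw [image_eq_zero_of_notMem_tsupport (fun h => hx (hφ.2.2 h)), mul_zero]

/-- The lemma of du Bois-Reymond. -/
theorem exists_ae_eq_const_of_integral_mul_deriv_eq_zero {U : Set ℝ} (hUo : IsOpen U)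
    (hUc : U.OrdConnected) {h : ℝ → ℝ} (hh : LocallyIntegrableOn h U)
    (hz : ∀ φ, IsTestFun U φ → ∫ x in U, h x * deriv φ x = 0) :
    ∃ c, ∀ᵐ x ∂volume.restrict U, h x = c := by
  rcases U.eq_empty_or_nonempty with rfl | hne
  · exact ⟨0, by simp⟩
  obtain ⟨ρ, hρ, hρ1⟩ := exists_isTestFun_integral_eq_one hUo hne
  set c := ∫ x, h x * ρ x with hc
  refine ⟨c, ?_⟩
  have hhc : LocallyIntegrableOn (fun x => h x - c) U :=
    hh.sub ((locallyIntegrable_const c).locallyIntegrableOn U)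
  have key := hUo.ae_eq_zero_of_integral_contDiff_smul_eq_zero (μ := volume) hhc ?_
  · rw [ae_restrict_iff' hUo.measurableSet]
    filter_upwards [key] with x hx hxU using sub_eq_zero.1 (hx hxU)
  intro g hg1 hg2 hg3
  have hg : IsTestFun U g := ⟨hg1, hg2, hg3⟩
  have hint : Integrable g := hg1.continuous.integrable_of_hasCompactSupport hg2
  have hintρ : Integrable ρ := hρ.1.continuous.integrable_of_hasCompactSupport hρ.2.1
  -- Subtracting the multiple of ρ with the same integral turns g into the derivative of a test
  -- function. The correction is what produces the constant c.
  obtain ⟨φ, hφ, hφd⟩ := exists_isTestFun_deriv_eq hUc (hg.add_const_mul hρ (-∫ x, g x)) (by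
    rw [integral_add hint (hintρ.const_mul _), integral_const_mul, hρ1]; ring)
  have h1 := hz φ hφ
  rw [hφd, setIntegral_mul_isTestFun h (hg.add_const_mul hρ _)] at h1
  have h2 : ∫ x, h x * (g x + (-∫ y, g y) * ρ x)
      = (∫ x, h x * g x) + (-∫ y, g y) * c := by
    rw [hc, ← integral_const_mul, ← integral_add (integrable_mul_isTestFun hh hg)
      ((integrable_mul_isTestFun hh hρ).const_mul _)]
    congr 1 with x
    ring
  calc ∫ x, g x • (h x - c) = ∫ x, (h x * g x - c * g x) := by
        congr 1 with x; rw [smul_eq_mul]; ring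
    _ = (∫ x, h x * g x) - c * ∫ x, g x := by
        rw [integral_sub (integrable_mul_isTestFun hh hg) (hint.const_mul _), integral_const_mul]
    _ = 0 := by linarith

/-! ### The continuous representative of a function of `H¹(ℝ)` -/

theorem memLp_fn {U : Set ℝ} (v : H1 U) : MemLp (fn v) 2 (volume.restrict U) := Lp.memLp _

theorem memLp_grad {U : Set ℝ} (v : H1 U) : MemLp (grad v) 2 (volume.restrict U) := Lp.memLp _

theorem isWeakDeriv_grad {U : Set ℝ} (v : H1 U) : IsWeakDeriv U (fn v) (grad v) := v.2

theorem locallyIntegrable_fn (w : H1 univ) : LocallyIntegrable (fn w) := by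
  have := memLp_fn w
  rw [Measure.restrict_univ] at this
  exact this.locallyIntegrable (by norm_num)

theorem memLp_grad_univ (w : H1 univ) : MemLp (grad w) 2 volume := by
  have := memLp_grad w
  rwa [Measure.restrict_univ] at this

theorem locallyIntegrable_grad (w : H1 univ) : LocallyIntegrable (grad w) :=
  (memLp_grad_univ w).locallyIntegrable (by norm_num)

theorem intervalIntegrable_grad (w : H1 univ) (a b : ℝ) :
    IntervalIntegrable (grad w) volume a b :=
  intervalIntegrable_iff.2 (((locallyIntegrable_grad w).integrableOn_isCompact isCompact_uIcc).mono_set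
    uIoc_subset_uIcc)

theorem continuous_primitive_grad (w : H1 univ) :
    Continuous fun x => ∫ y in (0 : ℝ)..x, grad w y :=
  intervalIntegral.continuous_primitive (intervalIntegrable_grad w) 0

/-- The difference between w and a primitive of its weak derivative has zero weak derivative, so du
Bois-Reymond applies. -/
theorem exists_fn_ae_eq (w : H1 univ) :
    ∃ c, fn w =ᵐ[volume] fun x => c + ∫ y in (0 : ℝ)..x, grad w y := by
  have hloc : LocallyIntegrable fun x => fn w x - ∫ y in (0 : ℝ)..x, grad w y :=
    (locallyIntegrable_fn w).sub (continuous_primitive_grad w).locallyIntegrable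
  obtain ⟨c, hc⟩ := exists_ae_eq_const_of_integral_mul_deriv_eq_zero isOpen_univ ordConnected_univ
    (hloc.locallyIntegrableOn _) (by
      intro φ hφ
      have hd : IsTestFun univ (deriv φ) := ⟨(contDiff_infty_iff_deriv.1 hφ.1).2, hφ.2.1.deriv,
        subset_univ _⟩
      have e1 := isWeakDeriv_grad w φ hφ
      rw [setIntegral_univ, setIntegral_univ] at e1
      have e2 : ∫ x, (∫ y in (0 : ℝ)..x, grad w y) * deriv φ x = -∫ x, grad w x * φ x := by
        -- Integration by parts is done on a bounded interval containing the support of φ, where the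
        -- boundary terms vanish.
        obtain ⟨R, hR⟩ := hφ.2.1.isCompact.isBounded.subset_ball 0
        have hzero : ∀ x, x ∉ Ioo (-R) R → φ x = 0 := fun x hx =>
          image_eq_zero_of_notMem_tsupport fun h => hx (by
            have := hR h
            rw [Real.ball_eq_Ioo] at this
            simpa using this)
        have hzero' : ∀ x, x ∉ Ioo (-R) R → deriv φ x = 0 := fun x hx =>
          image_eq_zero_of_notMem_tsupport fun h => hx (by
            have := hR (tsupport_deriv_subset h)
            rw [Real.ball_eq_Ioo] at this
            simpa using this)
        rcases le_or_gt R 0 with h | h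
        · have he : Ioo (-R) R = ∅ := Ioo_eq_empty (by linarith)
          simp [he] at hzero hzero'
          simp [hzero, hzero']
        have e3 := integral_primitive_mul_deriv (intervalIntegrable_grad w (-R) R)
          (hφ.1.of_le (by simp)) (∫ y in (0 : ℝ)..(-R), grad w y)
        rw [hzero R (by simp), hzero (-R) (by simp)] at e3
        have e4 : ∀ x, (∫ y in (0 : ℝ)..(-R), grad w y) + ∫ y in (-R)..x, grad w y
            = ∫ y in (0 : ℝ)..x, grad w y := fun x =>
          intervalIntegral.integral_add_adjacent_intervals (intervalIntegrable_grad w _ _)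
            (intervalIntegrable_grad w _ _)
        simp only [e4] at e3
        have e5 : ∀ f ψ : ℝ → ℝ, (∀ x, x ∉ Ioo (-R) R → ψ x = 0) →
            ∫ x in (-R)..R, f x * ψ x = ∫ x, f x * ψ x := fun f ψ hψ =>
          intervalIntegral.integral_eq_integral_of_support_subset fun x hx => by
            by_contra hx'
            exact right_ne_zero_of_mul hx (hψ x fun h => hx' (Ioo_subset_Ioc_self h))
        rw [e5 _ _ hzero, e5 _ _ hzero'] at e3
        rw [e3]; ring
      rw [setIntegral_univ]
      simp only [sub_mul]
      rw [integral_sub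
        (integrable_mul_isTestFun ((locallyIntegrable_fn w).locallyIntegrableOn _) hd)
        (integrable_mul_isTestFun
          ((continuous_primitive_grad w).locallyIntegrable.locallyIntegrableOn _) hd),
        e1, e2, sub_self])
  rw [Measure.restrict_univ] at hc
  exact ⟨c, hc.mono fun x hx => sub_eq_iff_eq_add.1 hx⟩

theorem continuous_contRep (w : H1 univ) : Continuous (contRep w) ∧ contRep w =ᵐ[volume] fn w := by
  obtain ⟨c, hc⟩ := exists_fn_ae_eq w
  have h : ∃ f : ℝ → ℝ, Continuous f ∧ f =ᵐ[volume] fn w :=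
    ⟨_, continuous_const.add (continuous_primitive_grad w), hc.symm⟩
  rw [contRep, dif_pos h]
  exact h.choose_spec

theorem contRep_eq (w : H1 univ) (x : ℝ) :
    contRep w x = contRep w 0 + ∫ y in (0 : ℝ)..x, grad w y := by
  obtain ⟨c, hc⟩ := exists_fn_ae_eq w
  have h := (Continuous.ae_eq_iff_eq volume (continuous_contRep w).1
    (continuous_const.add (continuous_primitive_grad w))).1 ((continuous_contRep w).2.trans hc)
  simp [h]

theorem jump_eq {L : ℝ} (hL : 0 ≤ L) (w : H1 univ) : jump L w = ∫ x in Ioo 0 L, grad w x := by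
  rw [jump, contRep_eq w L, add_sub_cancel_left, intervalIntegral.integral_of_le hL,
    integral_Ioc_eq_integral_Ioo]

/-! ### Functions of `H¹((0,L))` with prescribed boundary values -/

theorem tendsto_integral_mul_of_tendsto_eLpNorm {m : Measure ℝ} {f : ℕ → ℝ → ℝ} {g ψ : ℝ → ℝ}
    (hf : ∀ n, MemLp (f n) 2 m) (hg : MemLp g 2 m) (hψ : MemLp ψ 2 m)
    (h : Tendsto (fun n => eLpNorm (fun x => f n x - g x) 2 m) atTop (𝓝 0)) :
    Tendsto (fun n => ∫ x, f n x * ψ x ∂m) atTop (𝓝 (∫ x, g x * ψ x ∂m)) := by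
  have h1 : Tendsto (fun n => (hf n).toLp) atTop (𝓝 hg.toLp) := by
    rw [Lp.tendsto_Lp_iff_tendsto_eLpNorm']
    refine h.congr fun n => eLpNorm_congr_ae ?_
    filter_upwards [(hf n).coeFn_toLp, hg.coeFn_toLp] with x h1 h2
    simp [h1, h2]
  have h2 : ∀ {f : ℝ → ℝ} (hf : MemLp f 2 m),
      inner ℝ hψ.toLp hf.toLp = ∫ x, f x * ψ x ∂m := by
    intro f hf
    rw [L2.inner_def]
    refine integral_congr_ae ?_
    filter_upwards [hψ.coeFn_toLp, hf.coeFn_toLp] with x h1 h2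
    simp [h1, h2]
  simpa only [h2] using (tendsto_const_nhds (x := hψ.toLp)).inner (𝕜 := ℝ) h1

theorem continuous_memLp_Ioo {φ : ℝ → ℝ} (hφ : Continuous φ) (L : ℝ) :
    MemLp φ 2 (volume.restrict (Ioo 0 L)) := by
  obtain ⟨C, hC⟩ := (isCompact_Icc (a := (0 : ℝ)) (b := L)).exists_bound_of_continuousOn
    hφ.continuousOn
  refine MemLp.of_bound hφ.aestronglyMeasurable C ?_
  filter_upwards [ae_restrict_mem measurableSet_Ioo] with x hx using hC x (Ioo_subset_Icc_self hx)

theorem integral_Ioo_mul_deriv {L : ℝ} (hL : 0 ≤ L) {φ ψ : ℝ → ℝ} (hφ : ContDiff ℝ 1 φ)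
    (hψ : ContDiff ℝ 1 ψ) :
    ∫ x in Ioo 0 L, φ x * deriv ψ x
      = φ L * ψ L - φ 0 * ψ 0 - ∫ x in Ioo 0 L, deriv φ x * ψ x := by
  have := hφ.contDiffOn.absolutelyContinuousOnInterval (a := 0) (b := L)
    |>.integral_mul_deriv_eq_deriv_mul hψ.contDiffOn.absolutelyContinuousOnInterval
  simpa only [intervalIntegral.integral_of_le hL, integral_Ioc_eq_integral_Ioo] using this

/-- The approximating test functions vanish at both ends, so no boundary term appears even though ψ
is arbitrary there. This is the form in which zero boundary values are used. -/
theorem MemH10.integral_mul_deriv {L : ℝ} (hL : 0 ≤ L) {v g ψ : ℝ → ℝ}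
    (h : MemH10 (Ioo 0 L) v g) (hψ : ContDiff ℝ 1 ψ) :
    ∫ x in Ioo 0 L, v x * deriv ψ x = -∫ x in Ioo 0 L, g x * ψ x := by
  obtain ⟨hv, hg, φ, hφ, h1, h2⟩ := h
  have l1 := tendsto_integral_mul_of_tendsto_eLpNorm (fun n => (hφ n).memLp) hv
    (continuous_memLp_Ioo (hψ.continuous_deriv le_rfl) L) h1
  have l2 := tendsto_integral_mul_of_tendsto_eLpNorm (fun n => (hφ n).memLp_deriv) hg
    (continuous_memLp_Ioo hψ.continuous L) h2
  refine tendsto_nhds_unique l1 (l2.neg.congr fun n => ?_)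
  have hz : ∀ x ∉ Ioo 0 L, φ n x = 0 := fun x hx =>
    image_eq_zero_of_notMem_tsupport fun h => hx ((hφ n).2.2 h)
  rw [integral_Ioo_mul_deriv hL ((hφ n).1.of_le (by simp)) hψ, hz 0 (by simp), hz L (by simp)]
  ring

theorem MemH10.integral_eq_zero {L : ℝ} (hL : 0 ≤ L) {v g : ℝ → ℝ}
    (h : MemH10 (Ioo 0 L) v g) : ∫ x in Ioo 0 L, g x = 0 := by
  simpa using h.integral_mul_deriv hL (contDiff_const (c := (1 : ℝ)))

theorem MemH10.congr_ae {U : Set ℝ} {v g v' g' : ℝ → ℝ} (h : MemH10 U v g)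
    (hv : v =ᵐ[volume.restrict U] v') (hg : g =ᵐ[volume.restrict U] g') : MemH10 U v' g' := by
  obtain ⟨h1, h2, φ, hφ, h3, h4⟩ := h
  refine ⟨(memLp_congr_ae hv).1 h1, (memLp_congr_ae hg).1 h2, φ, hφ, ?_, ?_⟩
  · refine h3.congr fun n => eLpNorm_congr_ae ?_
    filter_upwards [hv] with x hx
    rw [hx]
  · refine h4.congr fun n => eLpNorm_congr_ae ?_
    filter_upwards [hg] with x hx
    rw [hx]

/-- The derivatives of the test functions, as a subspace of `L²(U)`. -/
def testDerivs (U : Set ℝ) : Submodule ℝ (L2 U) where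
  carrier := {f | ∃ φ, IsTestFun U φ ∧ f =ᵐ[volume.restrict U] deriv φ}
  zero_mem' := ⟨fun _ => 0, ⟨contDiff_const, HasCompactSupport.zero, by
    rw [show (fun _ : ℝ => (0 : ℝ)) = 0 from rfl, tsupport_zero]; exact empty_subset _⟩, by
    filter_upwards [Lp.coeFn_zero ℝ 2 (volume.restrict U)] with x hx
    exact hx.trans (by simp)⟩
  add_mem' := by
    rintro f g ⟨φ, hφ, hf⟩ ⟨ψ, hψ, hg⟩
    refine ⟨_, hφ.add_const_mul hψ 1, ?_⟩
    filter_upwards [Lp.coeFn_add f g, hf, hg] with x h1 h2 h3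
    rw [h1, Pi.add_apply, h2, h3]
    rw [(((hφ.1.differentiable (by simp) x).hasDerivAt).fun_add
      ((hψ.1.differentiable (by simp) x).hasDerivAt.const_mul 1)).deriv, one_mul]
  smul_mem' := by
    rintro c f ⟨φ, hφ, hf⟩
    refine ⟨_, hφ.add_const_mul hφ (c - 1), ?_⟩
    filter_upwards [Lp.coeFn_smul c f, hf] with x h1 h2
    rw [h1, Pi.smul_apply, h2, smul_eq_mul]
    rw [(((hφ.1.differentiable (by simp) x).hasDerivAt).fun_add
      ((hφ.1.differentiable (by simp) x).hasDerivAt.const_mul (c - 1))).deriv]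
    ring

theorem integrable_of_memLp_Ioo {L : ℝ} {g : ℝ → ℝ} (hg : MemLp g 2 (volume.restrict (Ioo 0 L))) :
    IntegrableOn g (Ioo 0 L) := hg.integrable (by norm_num)

/-- The closure is the double orthogonal complement. By du Bois-Reymond, anything orthogonal to all
derivatives of test functions is constant, and constants are orthogonal to functions of zero mean.
-/
theorem mem_closure_testDerivs {L : ℝ} {g : ℝ → ℝ} (hg : MemLp g 2 (volume.restrict (Ioo 0 L)))
    (h0 : ∫ x in Ioo 0 L, g x = 0) :
    hg.toLp ∈ (testDerivs (Ioo 0 L)).topologicalClosure := by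
  rw [← Submodule.orthogonal_orthogonal_eq_closure, Submodule.mem_orthogonal]
  intro h hh
  rw [Submodule.mem_orthogonal] at hh
  have hhm : MemLp h 2 (volume.restrict (Ioo 0 L)) := Lp.memLp h
  obtain ⟨c, hc⟩ := exists_ae_eq_const_of_integral_mul_deriv_eq_zero (isOpen_Ioo (a := 0) (b := L))
    ordConnected_Ioo (h := h) (integrable_of_memLp_Ioo hhm).locallyIntegrableOn (by
      intro φ hφ
      have := hh _ ⟨φ, hφ, (hφ.memLp_deriv (V := Ioo 0 L)).coeFn_toLp⟩
      rw [L2.inner_def] at this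
      refine Eq.trans ?_ this
      refine integral_congr_ae ?_
      filter_upwards [(hφ.memLp_deriv (V := Ioo 0 L)).coeFn_toLp] with x hx
      rw [hx]
      rfl)
  rw [L2.inner_def]
  have : ∫ x in Ioo 0 L, c * g x = 0 := by rw [integral_const_mul, h0, mul_zero]
  refine Eq.trans ?_ this
  refine integral_congr_ae ?_
  filter_upwards [hg.coeFn_toLp, hc] with x h1 h2
  simp [h1, h2, mul_comm]

theorem intervalIntegrable_of_memLp_Ioo {L x : ℝ} (hx : x ∈ Icc 0 L) {g : ℝ → ℝ}
    (hg : MemLp g 2 (volume.restrict (Ioo 0 L))) : IntervalIntegrable g volume 0 x := by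
  rw [intervalIntegrable_iff_integrableOn_Ioo_of_le hx.1]
  exact (integrable_of_memLp_Ioo hg).mono_set (Ioo_subset_Ioo_right hx.2)

theorem memLp_primitive {L : ℝ} (hL : 0 ≤ L) {g : ℝ → ℝ}
    (hg : MemLp g 2 (volume.restrict (Ioo 0 L))) :
    MemLp (fun x => ∫ y in (0 : ℝ)..x, g y) 2 (volume.restrict (Ioo 0 L)) := by
  have hc : ContinuousOn (fun x => ∫ y in (0 : ℝ)..x, g y) (Icc 0 L) := by
    have := (intervalIntegrable_of_memLp_Ioo (right_mem_Icc.2 hL) hg)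
      |>.absolutelyContinuousOnInterval_intervalIntegral (left_mem_uIcc) |>.continuousOn
    rwa [uIcc_of_le hL] at this
  obtain ⟨C, hC⟩ := (isCompact_Icc (a := (0 : ℝ)) (b := L)).exists_bound_of_continuousOn hc
  refine MemLp.of_bound ((hc.mono Ioo_subset_Icc_self).aestronglyMeasurable measurableSet_Ioo) C ?_
  filter_upwards [ae_restrict_mem measurableSet_Ioo] with x hx using hC x (Ioo_subset_Icc_self hx)

/-- The primitives of the functions of `L²((0,L))` with mean value zero are in `H¹₀((0,L))`. -/
theorem memH10_primitive {L : ℝ} (hL : 0 ≤ L) {g : ℝ → ℝ}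
    (hg : MemLp g 2 (volume.restrict (Ioo 0 L))) (h0 : ∫ x in Ioo 0 L, g x = 0) :
    MemH10 (Ioo 0 L) (fun x => ∫ y in (0 : ℝ)..x, g y) g := by
  obtain ⟨f, hf, hlim⟩ := mem_closure_iff_seq_limit.1 (mem_closure_testDerivs hg h0)
  choose φ hφ hfφ using hf
  have hconv : Tendsto (fun n => eLpNorm (fun x => deriv (φ n) x - g x) 2
      (volume.restrict (Ioo 0 L))) atTop (𝓝 0) := by
    rw [Lp.tendsto_Lp_iff_tendsto_eLpNorm'] at hlim
    refine hlim.congr fun n => eLpNorm_congr_ae ?_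
    filter_upwards [hfφ n, hg.coeFn_toLp] with x h1 h2
    simp [h1, h2]
  refine ⟨memLp_primitive hL hg, hg, φ, hφ, ?_, hconv⟩
  -- A Poincaré inequality: both functions vanish at 0, so their difference is bounded pointwise by
  -- the L¹ norm of the difference of the derivatives. The two powers of L come from L² ⊂ L¹ and L^∞
  -- ⊂ L².
  have hbound : ∀ n, eLpNorm (fun x => φ n x - ∫ y in (0 : ℝ)..x, g y) 2
      (volume.restrict (Ioo 0 L)) ≤ (eLpNorm (fun x => deriv (φ n) x - g x) 2
      (volume.restrict (Ioo 0 L)) * ENNReal.ofReal L ^ (1 / (1 : ℝ≥0∞).toReal - 1 / (2 : ℝ≥0∞).toReal))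
        * ENNReal.ofReal L ^ (2 : ℝ≥0∞).toReal⁻¹ := by
    intro n
    have hvol : (volume.restrict (Ioo 0 L)) univ = ENNReal.ofReal L := by simp
    have hd := (hφ n).memLp_deriv (V := Ioo 0 L)
    have h1 := eLpNorm_le_eLpNorm_mul_rpow_measure_univ (p := 1) (q := 2)
      (μ := volume.restrict (Ioo 0 L)) (by norm_num) (hd.sub hg).1
    rw [hvol] at h1
    have h2 := eLpNorm_le_of_ae_enorm_bound (p := 2) (μ := volume.restrict (Ioo 0 L))
      (f := fun x => φ n x - ∫ y in (0 : ℝ)..x, g y)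
      (C := eLpNorm (deriv (φ n) - g) 1 (volume.restrict (Ioo 0 L))) (by
        filter_upwards [ae_restrict_mem measurableSet_Ioo] with x hx
        have hdc : Continuous (deriv (φ n)) := (hφ n).1.continuous_deriv (by simp)
        have e1 : φ n x = ∫ y in (0 : ℝ)..x, deriv (φ n) y := by
          rw [intervalIntegral.integral_deriv_eq_sub
            (fun y _ => ((hφ n).1.differentiable (by simp)) y) (hdc.intervalIntegrable _ _),
            show φ n 0 = 0 from image_eq_zero_of_notMem_tsupport
              fun h => by simpa using (hφ n).2.2 h, sub_zero]
        rw [e1, ← intervalIntegral.integral_sub (hdc.intervalIntegrable _ _)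
          (intervalIntegrable_of_memLp_Ioo (Ioo_subset_Icc_self hx) hg),
          intervalIntegral.integral_of_le hx.1.le, integral_Ioc_eq_integral_Ioo,
          eLpNorm_one_eq_lintegral_enorm]
        refine (enorm_integral_le_lintegral_enorm _).trans ?_
        exact lintegral_mono_set (Ioo_subset_Ioo_right hx.2.le))
    rw [hvol, smul_eq_mul] at h2
    exact h2.trans (mul_le_mul_left h1 _)
  refine tendsto_of_tendsto_of_tendsto_of_le_of_le tendsto_const_nhds ?_ (fun _ => zero_le) hbound
  have t1 := ENNReal.Tendsto.mul_const hconv (b := ENNReal.ofReal L ^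
    (1 / (1 : ℝ≥0∞).toReal - 1 / (2 : ℝ≥0∞).toReal))
    (Or.inr (ENNReal.rpow_ne_top_of_nonneg (by norm_num) ENNReal.ofReal_ne_top))
  have t2 := ENNReal.Tendsto.mul_const t1 (b := ENNReal.ofReal L ^ (2 : ℝ≥0∞).toReal⁻¹)
    (Or.inr (ENNReal.rpow_ne_top_of_nonneg (by norm_num) ENNReal.ofReal_ne_top))
  simpa using t2

theorem ae_fn_eq_contRep {L : ℝ} (w : H1 univ) :
    fn w =ᵐ[volume.restrict (Ioo 0 L)] contRep w :=
  ae_restrict_of_ae (continuous_contRep w).2.symm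

theorem memLp_grad_Ioo (w : H1 univ) (L : ℝ) : MemLp (grad w) 2 (volume.restrict (Ioo 0 L)) :=
  (memLp_grad_univ w).restrict _

theorem SameBoundaryValues.integral_grad {L : ℝ} (hL : 0 ≤ L) {v : H1 (Ioo 0 L)} {w : H1 univ}
    (h : SameBoundaryValues v w) : ∫ x in Ioo 0 L, grad v x = jump L w := by
  have h1 := MemH10.integral_eq_zero hL h
  rw [integral_sub (integrable_of_memLp_Ioo (memLp_grad v))
    (integrable_of_memLp_Ioo (memLp_grad_Ioo w L)), ← jump_eq hL] at h1
  linarith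

theorem integral_contRep_mul_deriv {L : ℝ} (hL : 0 ≤ L) (w : H1 univ) {ψ : ℝ → ℝ}
    (hψ : ContDiff ℝ 1 ψ) :
    ∫ x in Ioo 0 L, contRep w x * deriv ψ x
      = contRep w L * ψ L - contRep w 0 * ψ 0 - ∫ x in Ioo 0 L, grad w x * ψ x := by
  have := integral_primitive_mul_deriv (intervalIntegrable_grad w 0 L) hψ (contRep w 0)
  simp only [← contRep_eq] at this
  simpa only [intervalIntegral.integral_of_le hL, integral_Ioc_eq_integral_Ioo] using this

/-- The test function may be nonzero at the ends, so the boundary datum survives as explicit terms.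
In the limit these terms detect the part of p concentrated on the boundary. -/
theorem SameBoundaryValues.integral_mul_deriv {L : ℝ} (hL : 0 ≤ L) {v : H1 (Ioo 0 L)}
    {w : H1 univ} (h : SameBoundaryValues v w) {ψ : ℝ → ℝ} (hψ : ContDiff ℝ 1 ψ) :
    ∫ x in Ioo 0 L, fn v x * deriv ψ x
      = contRep w L * ψ L - contRep w 0 * ψ 0 - ∫ x in Ioo 0 L, grad v x * ψ x := by
  have h1 := MemH10.integral_mul_deriv hL h hψ
  have hψ0 := continuous_memLp_Ioo hψ.continuous L
  have hψ1 := continuous_memLp_Ioo (hψ.continuous_deriv le_rfl) L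
  have hw : MemLp (fn w) 2 (volume.restrict (Ioo 0 L)) :=
    (memLp_congr_ae (ae_fn_eq_contRep w)).2 (continuous_memLp_Ioo (continuous_contRep w).1 L)
  have hmul : ∀ {f g : ℝ → ℝ}, MemLp f 2 (volume.restrict (Ioo 0 L)) →
      MemLp g 2 (volume.restrict (Ioo 0 L)) →
      Integrable (fun x => f x * g x) (volume.restrict (Ioo 0 L)) :=
    fun hf hg => hf.integrable_mul hg
  simp only [sub_mul] at h1
  rw [integral_sub (hmul (memLp_fn v) hψ1) (hmul hw hψ1),
    integral_sub (hmul (memLp_grad v) hψ0) (hmul (memLp_grad_Ioo w L) hψ0)] at h1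
  have h2 : ∫ x in Ioo 0 L, fn w x * deriv ψ x = ∫ x in Ioo 0 L, contRep w x * deriv ψ x := by
    refine integral_congr_ae ?_
    filter_upwards [ae_fn_eq_contRep w] with x hx
    rw [hx]
  rw [h2, integral_contRep_mul_deriv hL w hψ] at h1
  linarith

theorem isWeakDeriv_primitive {L : ℝ} (hL : 0 ≤ L) {G V g : ℝ → ℝ}
    (hG : MemLp G 2 (volume.restrict (Ioo 0 L))) (c : ℝ)
    (hV : V =ᵐ[volume.restrict (Ioo 0 L)] fun x => c + ∫ y in (0 : ℝ)..x, G y)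
    (hg : g =ᵐ[volume.restrict (Ioo 0 L)] G) : IsWeakDeriv (Ioo 0 L) V g := by
  intro φ hφ
  have hz : ∀ x ∉ Ioo 0 L, φ x = 0 := fun x hx =>
    image_eq_zero_of_notMem_tsupport fun h => hx (hφ.2.2 h)
  have h1 := integral_primitive_mul_deriv (φ := φ)
    (intervalIntegrable_of_memLp_Ioo (right_mem_Icc.2 hL) hG) (hφ.1.of_le (by simp)) c
  simp only [hz 0 (by simp), hz L (by simp), mul_zero, sub_zero, zero_sub,
    intervalIntegral.integral_of_le hL, integral_Ioc_eq_integral_Ioo] at h1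
  have h2 : ∫ x in Ioo 0 L, V x * deriv φ x
      = ∫ x in Ioo 0 L, (c + ∫ y in (0 : ℝ)..x, G y) * deriv φ x := by
    refine integral_congr_ae ?_
    filter_upwards [hV] with x hx
    rw [hx]
  have h3 : ∫ x in Ioo 0 L, g x * φ x = ∫ x in Ioo 0 L, G x * φ x := by
    refine integral_congr_ae ?_
    filter_upwards [hg] with x hx
    rw [hx]
  rw [h2, h3, h1]

/-- Every function of `L²((0,L))` with the right mean value is the derivative of a function with
the boundary values of `w`. -/
theorem exists_sameBoundaryValues {L : ℝ} (hL : 0 ≤ L) (w : H1 univ) {G : ℝ → ℝ}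
    (hG : MemLp G 2 (volume.restrict (Ioo 0 L))) (hGw : ∫ x in Ioo 0 L, G x = jump L w) :
    ∃ v : H1 (Ioo 0 L), SameBoundaryValues v w ∧ grad v =ᵐ[volume.restrict (Ioo 0 L)] G := by
  have hV : MemLp (fun x => contRep w 0 + ∫ y in (0 : ℝ)..x, G y) 2 (volume.restrict (Ioo 0 L)) :=
    MemLp.add (f := fun _ => contRep w 0) (memLp_const _) (memLp_primitive hL hG)
  have hweak : IsWeakDeriv (Ioo 0 L) (hV.toLp _ : ℝ → ℝ) (hG.toLp _ : ℝ → ℝ) :=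
    isWeakDeriv_primitive hL hG _ hV.coeFn_toLp hG.coeFn_toLp
  refine ⟨⟨WithLp.toLp 2 (hV.toLp, hG.toLp), hweak⟩, ?_, hG.coeFn_toLp⟩
  have hgw := memLp_grad_Ioo w L
  -- With v equal to w(0) plus the primitive of G, the difference v - w is a primitive of G - w',
  -- which has mean zero.
  refine (memH10_primitive hL (hG.sub hgw) ?_).congr_ae ?_ ?_
  · simp only [Pi.sub_apply]
    rw [integral_sub (integrable_of_memLp_Ioo hG) (integrable_of_memLp_Ioo hgw), hGw, jump_eq hL,
      sub_self]
  · filter_upwards [hV.coeFn_toLp, ae_fn_eq_contRep w, ae_restrict_mem measurableSet_Ioo]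
      with x h1 h2 hx
    have h3 : fn (U := Ioo 0 L) ⟨WithLp.toLp 2 (hV.toLp, hG.toLp), hweak⟩ x
        = (hV.toLp _ : ℝ → ℝ) x := rfl
    rw [h3, h1, h2, contRep_eq w x]
    simp only [Pi.sub_apply]
    rw [intervalIntegral.integral_sub
      (intervalIntegrable_of_memLp_Ioo (Ioo_subset_Icc_self hx) hG) (intervalIntegrable_grad w _ _)]
    ring
  · filter_upwards [hG.coeFn_toLp] with x h1
    have h3 : grad (U := Ioo 0 L) ⟨WithLp.toLp 2 (hV.toLp, hG.toLp), hweak⟩ x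
        = (hG.toLp _ : ℝ → ℝ) x := rfl
    rw [h3, h1]
    rfl

/-! ### Weak differentiability in time of absolutely continuous maps -/

theorem absolutelyContinuous_of_dist_le {X Y : Type*} [PseudoMetricSpace X] [PseudoMetricSpace Y]
    {f : ℝ → X} {g : ℝ → Y} {a b C : ℝ} (hf : AbsolutelyContinuousOnInterval f a b)
    (h : ∀ s t, dist (g s) (g t) ≤ C * dist (f s) (f t)) :
    AbsolutelyContinuousOnInterval g a b := by
  have hlim := Tendsto.const_mul C (show Tendsto _ _ _ from hf)
  rw [mul_zero] at hlim
  refine squeeze_zero (fun E => Finset.sum_nonneg fun i _ => dist_nonneg) (fun E => ?_) hlim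
  rw [Finset.mul_sum]
  exact Finset.sum_le_sum fun i _ => h _ _

theorem dist_le_abs_variationOnFromTo_sub {E : Type*} [PseudoMetricSpace E] {w : ℝ → E} {K : Set ℝ} (hw : BoundedVariationOn w K)
    {a s t : ℝ} (ha : a ∈ K) (hs : s ∈ K) (ht : t ∈ K) :
    dist (w s) (w t) ≤ |variationOnFromTo w K a s - variationOnFromTo w K a t| := by
  wlog hst : t ≤ s generalizing s t
  · rw [dist_comm, abs_sub_comm]
    exact this ht hs (le_of_not_ge hst)
  rw [variationOnFromTo.sub_right hw.locallyBoundedVariationOn ha hs ht,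
    variationOnFromTo.eq_of_le _ _ hst, abs_of_nonneg ENNReal.toReal_nonneg, dist_edist]
  refine ENNReal.toReal_mono (hw.locallyBoundedVariationOn t s ht hs) ?_
  exact eVariationOn.edist_le _ ⟨hs, hst, le_rfl⟩ ⟨ht, le_rfl, hst⟩

section Hilbert

variable {H : Type*} [NormedAddCommGroup H] [InnerProductSpace ℝ H]

/-- A bounded family that converges weakly against a dense set converges weakly. -/
theorem exists_tendsto_inner_of_dense [CompleteSpace H] {ι : Type*} {l : Filter ι} [l.NeBot]
    {D : ι → H} {C : ℝ} (hC : ∀ᶠ i in l, ‖D i‖ ≤ C) {S : Set H} (hS : Dense S)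
    (hD : ∀ h ∈ S, ∃ c : ℝ, Tendsto (fun i => inner ℝ h (D i)) l (𝓝 c)) :
    ∃ d : H, ∀ h, Tendsto (fun i => inner ℝ h (D i)) l (𝓝 (inner ℝ h d)) := by
  have hC0 : 0 ≤ C := by
    obtain ⟨i, hi⟩ := hC.exists
    exact (norm_nonneg _).trans hi
  have key : ∀ h : H, ∃ c : ℝ, Tendsto (fun i => inner ℝ h (D i)) l (𝓝 c) := by
    intro h
    rw [← cauchy_map_iff_exists_tendsto, Metric.cauchy_iff]
    refine ⟨inferInstance, fun ε hε => ?_⟩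
    -- C + 1 instead of C keeps the radius positive when C = 0.
    obtain ⟨g, hgS, hg⟩ := hS.exists_dist_lt h (ε := ε / (4 * (C + 1))) (by positivity)
    obtain ⟨c, hc⟩ := hD g hgS
    have h1 : ∀ᶠ i in l, dist (inner ℝ h (D i)) c < ε / 2 := by
      filter_upwards [hC, Metric.tendsto_nhds.1 hc (ε / 4) (by positivity)] with i h1 h2
      have h3 : |inner ℝ h (D i) - inner ℝ g (D i)| ≤ ε / 4 := by
        rw [← inner_sub_left]
        refine (abs_real_inner_le_norm _ _).trans ?_
        rw [dist_eq_norm] at hg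
        calc ‖h - g‖ * ‖D i‖ ≤ ε / (4 * (C + 1)) * (C + 1) := by
              gcongr
              linarith
          _ = ε / 4 := by field_simp
      rw [Real.dist_eq] at h2 ⊢
      calc _ = |(inner ℝ h (D i) - inner ℝ g (D i)) + (inner ℝ g (D i) - c)| := by ring_nf
        _ ≤ _ := abs_add_le _ _
        _ < ε / 2 := by linarith
    refine ⟨_, image_mem_map h1, ?_⟩
    rintro _ ⟨i, hi, rfl⟩ _ ⟨j, hj, rfl⟩
    calc _ ≤ dist (inner ℝ h (D i)) c + dist (inner ℝ h (D j)) c := dist_triangle_right _ _ _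
      _ < ε := by
        have hi : dist (inner ℝ h (D i)) c < ε / 2 := hi
        have hj : dist (inner ℝ h (D j)) c < ε / 2 := hj
        linarith
  choose f hf using key
  let F : H →ₗ[ℝ] ℝ := linearMapOfTendsto (l := l) f
    (fun i => ((innerSL ℝ (D i) : H →L[ℝ] ℝ) : H →ₗ[ℝ] ℝ)) (by
      rw [tendsto_pi_nhds]
      intro h
      refine (hf h).congr fun i => ?_
      rw [real_inner_comm]
      rfl)
  let F' : H →L[ℝ] ℝ := F.mkContinuous C fun h => by
    refine le_of_tendsto (hf h).norm ?_
    filter_upwards [hC] with i hi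
    refine (norm_inner_le_norm _ _).trans ?_
    rw [mul_comm]
    gcongr
  refine ⟨(InnerProductSpace.toDual ℝ H).symm F', fun h => ?_⟩
  have : inner ℝ h ((InnerProductSpace.toDual ℝ H).symm F') = f h := by
    rw [real_inner_comm, InnerProductSpace.toDual_symm_apply]
    rfl
  rw [this]
  exact hf h

/-- An absolutely continuous map with values in a separable Hilbert space is weakly differentiable
at almost every time. -/
theorem ae_exists_weak_deriv [CompleteSpace H] [TopologicalSpace.SeparableSpace H] {w : ℝ → H}
    {a b : ℝ} (hw : AbsolutelyContinuousOnInterval w a b) :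
    ∀ᵐ t, t ∈ uIcc a b → ∃ d : H, ∀ l : H →L[ℝ] ℝ,
      Tendsto (fun s => l ((s - t)⁻¹ • (w s - w t))) (𝓝[≠] t) (𝓝 (l d)) := by
  have hbv := hw.boundedVariationOn
  have hinner : ∀ h : H, AbsolutelyContinuousOnInterval (fun t => inner ℝ h (w t)) a b := by
    intro h
    refine absolutelyContinuous_of_dist_le (C := ‖h‖) hw fun s t => ?_
    rw [Real.dist_eq, ← inner_sub_right, dist_eq_norm]
    exact abs_real_inner_le_norm _ _
  -- Separability leaves only countably many scalar functions to differentiate, hence one common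
  -- null set.
  have h1 : ∀ᵐ t, ∀ n, t ∈ uIcc a b →
      DifferentiableAt ℝ (fun s => inner ℝ (TopologicalSpace.denseSeq H n) (w s)) t :=
    ae_all_iff.2 fun n => (hinner _).ae_differentiableAt
  -- The accumulated variation is monotone, hence differentiable almost everywhere, and it dominates
  -- the increments of w. This bounds the difference quotients in norm.
  have h2 := (variationOnFromTo.monotoneOn hbv.locallyBoundedVariationOn
    left_mem_uIcc).ae_differentiableWithinAt_of_mem
  have h3 : ∀ᵐ t : ℝ, t ≠ min a b := by simp [ae_iff]
  have h4 : ∀ᵐ t : ℝ, t ≠ max a b := by simp [ae_iff]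
  filter_upwards [h1, h2, h3, h4] with t h1 h2 h3 h4 ht
  have hnhds : uIcc a b ∈ 𝓝 t := Icc_mem_nhds (lt_of_le_of_ne ht.1 h3.symm)
    (lt_of_le_of_ne ht.2 h4)
  have hV := ((h2 ht).differentiableAt hnhds).hasDerivAt
  rw [hasDerivAt_iff_tendsto_slope] at hV
  set c := deriv (variationOnFromTo w (uIcc a b) a) t
  have hbound : ∀ᶠ s in 𝓝[≠] t, ‖(s - t)⁻¹ • (w s - w t)‖ ≤ |c| + 1 := by
    filter_upwards [hV.abs.eventually_lt_const (lt_add_one |c|), nhdsWithin_le_nhds hnhds]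
      with s hs hsm
    refine le_trans ?_ hs.le
    rw [norm_smul, slope_def_field, abs_div, norm_inv, Real.norm_eq_abs, ← dist_eq_norm,
      div_eq_inv_mul]
    gcongr
    exact dist_le_abs_variationOnFromTo_sub hbv left_mem_uIcc hsm ht
  obtain ⟨d, hd⟩ := exists_tendsto_inner_of_dense hbound (TopologicalSpace.denseRange_denseSeq H) (by
    rintro _ ⟨n, rfl⟩
    have := (h1 n ht).hasDerivAt
    rw [hasDerivAt_iff_tendsto_slope] at this
    refine ⟨_, this.congr fun s => ?_⟩
    rw [slope_def_field, inner_smul_right, inner_sub_right, div_eq_inv_mul])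
  refine ⟨d, fun l => ?_⟩
  have := hd ((InnerProductSpace.toDual ℝ H).symm l)
  simpa only [InnerProductSpace.toDual_symm_apply] using this

end Hilbert

/-! ### The boundary datum -/

/-- Each test function imposes one closed linear condition. Closedness makes H¹ a Hilbert space, as
the weak differentiation in time requires. -/
theorem isClosed_H1 (U : Set ℝ) : IsClosed (H1 U : Set (WithLp 2 (L2 U × L2 U))) := by
  have h : (H1 U : Set (WithLp 2 (L2 U × L2 U))) = ⋂ (φ : ℝ → ℝ) (hφ : IsTestFun U φ),
      {z | inner ℝ (hφ.memLp_deriv (V := U)).toLp z.fst + inner ℝ (hφ.memLp (V := U)).toLp z.snd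
        = (0 : ℝ)} := by
    ext z
    simp only [mem_iInter]
    refine forall₂_congr fun φ hφ => ?_
    have h1 : inner ℝ (hφ.memLp_deriv (V := U)).toLp z.fst = ∫ x in U, z.fst x * deriv φ x := by
      rw [L2.inner_def]
      refine integral_congr_ae ?_
      filter_upwards [(hφ.memLp_deriv (V := U)).coeFn_toLp] with x hx
      rw [hx]
      rfl
    have h2 : inner ℝ (hφ.memLp (V := U)).toLp z.snd = ∫ x in U, z.snd x * φ x := by
      rw [L2.inner_def]
      refine integral_congr_ae ?_
      filter_upwards [(hφ.memLp (V := U)).coeFn_toLp] with x hx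
      rw [hx]
      rfl
    rw [mem_ofPred_eq, h1, h2]
    exact eq_neg_iff_add_eq_zero
  rw [h]
  refine isClosed_iInter fun φ => isClosed_iInter fun hφ => isClosed_eq ?_ continuous_const
  exact (continuous_const.inner (WithLp.continuous_fst _ _ _)).add
    (continuous_const.inner (WithLp.continuous_snd _ _ _))

instance (U : Set ℝ) : CompleteSpace (H1 U) := (isClosed_H1 U).completeSpace_coe

instance (U : Set ℝ) : SecondCountableTopology (H1 U) := by
  have : Fact ((2 : ℝ≥0∞) ≠ ⊤) := ⟨by norm_num⟩
  infer_instance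

/-- `w ↦ [w]₀ᴸ` as a continuous linear form on `H¹(ℝ)`. -/
def jumpCLM (L : ℝ) : H1 univ →L[ℝ] ℝ :=
  (innerSL ℝ (indicatorConstLp 2 (measurableSet_Ioo (a := 0) (b := L))
    (μ := volume.restrict univ) (by simp) (1 : ℝ))) ∘L (WithLp.sndL 2 ℝ (L2 univ) (L2 univ)) ∘L
      (H1 univ).subtypeL

theorem jumpCLM_apply {L : ℝ} (hL : 0 ≤ L) (w : H1 univ) : jumpCLM L w = jump L w := by
  rw [jump_eq hL]
  have : jumpCLM L w = ∫ x in Ioo 0 L, grad w x ∂volume.restrict univ :=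
    L2.inner_indicatorConstLp_one (𝕜 := ℝ) _ _ _
  rw [this, Measure.restrict_univ]

theorem absolutelyContinuous_jump {L T : ℝ} (hL : 0 ≤ L) {w : ℝ → H1 univ}
    (hw : AbsolutelyContinuousOnInterval w 0 T) :
    AbsolutelyContinuousOnInterval (fun t => jump L (w t)) 0 T := by
  refine absolutelyContinuous_of_dist_le (C := ‖jumpCLM L‖) hw fun s t => ?_
  rw [← jumpCLM_apply hL, ← jumpCLM_apply hL]
  exact (jumpCLM L).dist_le_opNorm _ _

/-- The jump is a continuous linear form, so it commutes with the weak limit that defines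
`timeDeriv`. -/
theorem ae_deriv_jump {L T : ℝ} (hL : 0 ≤ L) {w : ℝ → H1 univ}
    (hw : AbsolutelyContinuousOnInterval w 0 T) :
    ∀ᵐ t, t ∈ uIcc 0 T →
      ∫ x in Ioo 0 L, grad (timeDeriv w t) x = deriv (fun s => jump L (w s)) t := by
  filter_upwards [ae_exists_weak_deriv hw] with t h ht
  have hd := h ht
  have hspec : ∀ l : H1 univ →L[ℝ] ℝ,
      Tendsto (fun s => l ((s - t)⁻¹ • (w s - w t))) (𝓝[≠] t) (𝓝 (l (timeDeriv w t))) := by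
    rw [timeDeriv, dif_pos hd]
    exact hd.choose_spec
  have h1 : HasDerivAt (fun s => jump L (w s)) (jump L (timeDeriv w t)) t := by
    rw [hasDerivAt_iff_tendsto_slope, ← jumpCLM_apply hL]
    refine (hspec (jumpCLM L)).congr fun s => ?_
    rw [slope_def_field, map_smul, map_sub, jumpCLM_apply hL, jumpCLM_apply hL, smul_eq_mul,
      div_eq_inv_mul]
  rw [h1.deriv, jump_eq hL]

/-! ### The scalar evolution law -/

/-- The evolution law that relates the jump `J` of the boundary datum to the compliance `A` of the
bar: the compliance is nondecreasing, the stress `J / A` does not exceed `k` in absolute value, and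
the energy is balanced. -/
structure IsComplianceEvolution (T k ℓ : ℝ) (J A : ℝ → ℝ) : Prop where
  time_pos : 0 < T
  yield_pos : 0 < k
  sound_pos : 0 < ℓ
  ac : AbsolutelyContinuousOnInterval J 0 T
  le_compliance : ∀ t ∈ Icc 0 T, ℓ ≤ A t
  mono : MonotoneOn A (Icc 0 T)
  yield : ∀ t ∈ Icc 0 T, |J t| ≤ k * A t
  initial : A 0 = ℓ ∨ |J 0| = k * A 0
  balance : ∀ t ∈ Icc 0 T, J t ^ 2 / (2 * A t) + k ^ 2 / 2 * A t
    = J 0 ^ 2 / (2 * A 0) + k ^ 2 / 2 * A 0 + ∫ s in (0 : ℝ)..t, J s / A s * deriv J s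

namespace IsComplianceEvolution

variable {T k ℓ : ℝ} {J A : ℝ → ℝ}

theorem compliance_pos (h : IsComplianceEvolution T k ℓ J A) {t : ℝ} (ht : t ∈ Icc 0 T) :
    0 < A t := h.sound_pos.trans_le (h.le_compliance t ht)

theorem continuousOn_datum (h : IsComplianceEvolution T k ℓ J A) : ContinuousOn J (Icc 0 T) := by
  simpa [uIcc_of_le h.time_pos.le] using h.ac.continuousOn

theorem uIcc_subset {r s : ℝ} (hr : r ∈ Icc 0 T) (hs : s ∈ Icc 0 T) : uIcc r s ⊆ Icc 0 T :=
  ordConnected_Icc.uIcc_subset hr hs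

theorem ac_datum (h : IsComplianceEvolution T k ℓ J A) {r s : ℝ} (hr : r ∈ Icc 0 T)
    (hs : s ∈ Icc 0 T) : AbsolutelyContinuousOnInterval J r s :=
  h.ac.mono (by rw [uIcc_of_le h.time_pos.le]; exact uIcc_subset hr hs)

theorem intervalIntegrable_deriv (h : IsComplianceEvolution T k ℓ J A) {r s : ℝ}
    (hr : r ∈ Icc 0 T) (hs : s ∈ Icc 0 T) : IntervalIntegrable (deriv J) volume r s :=
  (h.ac_datum hr hs).intervalIntegrable_deriv

theorem abs_stress_le (h : IsComplianceEvolution T k ℓ J A) {t : ℝ} (ht : t ∈ Icc 0 T) :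
    |J t / A t| ≤ k := by
  rw [abs_div, abs_of_pos (h.compliance_pos ht), div_le_iff₀ (h.compliance_pos ht)]
  exact h.yield t ht

theorem intervalIntegrable_power (h : IsComplianceEvolution T k ℓ J A) {r s : ℝ}
    (hr : r ∈ Icc 0 T) (hs : s ∈ Icc 0 T) :
    IntervalIntegrable (fun τ => J τ / A τ * deriv J τ) volume r s := by
  have hsub : uIoc r s ⊆ Icc 0 T := uIoc_subset_uIcc.trans (uIcc_subset hr hs)
  have hi := h.intervalIntegrable_deriv hr hs
  rw [intervalIntegrable_iff] at hi ⊢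
  refine Integrable.bdd_mul (c := k) hi ?_ ?_
  · have h1 : AEMeasurable A (volume.restrict (uIoc r s)) :=
      (aemeasurable_restrict_of_monotoneOn measurableSet_Icc h.mono).mono_measure
        (Measure.restrict_mono hsub le_rfl)
    have h2 : AEMeasurable J (volume.restrict (uIoc r s)) :=
      (h.continuousOn_datum.mono hsub).aemeasurable measurableSet_uIoc
    exact (h2.div h1).aestronglyMeasurable
  · filter_upwards [ae_restrict_mem measurableSet_uIoc] with τ hτ
    exact h.abs_stress_le (hsub hτ)

/-- A finite-increment version of (k² - σ²) A' = 0. The balance on [r, s] is compared with the chain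
rule for J² / (2 A r), where the compliance is frozen. The error carries the factor A τ - A r ≤ A s
- A r, which is kept on both sides so that it can be cancelled. -/
theorem compliance_increment (h : IsComplianceEvolution T k ℓ J A) {r s : ℝ} (hr : r ∈ Icc 0 T)
    (hs : s ∈ Icc 0 T) (hrs : r ≤ s) :
    (A s - A r) * (k ^ 2 - J s ^ 2 / (A r * A s))
      ≤ (A s - A r) * (2 * k / ℓ * ∫ τ in r..s, |deriv J τ|) := by
  have h0 : (0 : ℝ) ∈ Icc 0 T := left_mem_Icc.2 h.time_pos.le
  have hAr := h.compliance_pos hr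
  have hAs := h.compliance_pos hs
  have hbal : J s ^ 2 / (2 * A s) + k ^ 2 / 2 * A s - (J r ^ 2 / (2 * A r) + k ^ 2 / 2 * A r)
      = ∫ τ in r..s, J τ / A τ * deriv J τ := by
    rw [h.balance s hs, h.balance r hr, ← intervalIntegral.integral_interval_sub_left
      (h.intervalIntegrable_power h0 hs) (h.intervalIntegrable_power h0 hr)]
    ring
  have hJ : ∫ τ in r..s, J τ * deriv J τ = (J s ^ 2 - J r ^ 2) / 2 := by
    have := (h.ac_datum hr hs).integral_mul_deriv_eq_deriv_mul (h.ac_datum hr hs)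
    have h2 : ∫ τ in r..s, deriv J τ * J τ = ∫ τ in r..s, J τ * deriv J τ := by
      congr 1 with τ
      ring
    rw [h2] at this
    linarith
  have hJi : IntervalIntegrable (fun τ => J τ * deriv J τ) volume r s :=
    (h.intervalIntegrable_deriv hr hs).continuousOn_mul
      (h.continuousOn_datum.mono (uIcc_subset hr hs))
  have hdiff : (A s - A r) * (k ^ 2 - J s ^ 2 / (A r * A s))
      = 2 * ∫ τ in r..s, (J τ / A τ * deriv J τ - 1 / A r * (J τ * deriv J τ)) := by
    rw [intervalIntegral.integral_sub (h.intervalIntegrable_power hr hs) (hJi.const_mul _),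
      intervalIntegral.integral_const_mul, hJ, ← hbal]
    field_simp
    ring
  rw [hdiff]
  have hle : ∫ τ in r..s, (J τ / A τ * deriv J τ - 1 / A r * (J τ * deriv J τ))
      ≤ ∫ τ in r..s, (A s - A r) * (k / ℓ) * |deriv J τ| := by
    refine intervalIntegral.integral_mono_on hrs
      ((h.intervalIntegrable_power hr hs).sub (hJi.const_mul _))
      ((h.intervalIntegrable_deriv hr hs).abs.const_mul _) fun τ hτ => ?_
    have hτ' : τ ∈ Icc 0 T := ⟨hr.1.trans hτ.1, hτ.2.trans hs.2⟩
    have hAτ := h.compliance_pos hτ'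
    have e : J τ / A τ * deriv J τ - 1 / A r * (J τ * deriv J τ)
        = (J τ / A τ) * ((A r - A τ) / A r) * deriv J τ := by
      field_simp
    rw [e]
    refine (le_abs_self _).trans ?_
    rw [abs_mul, abs_mul]
    refine mul_le_mul_of_nonneg_right ?_ (abs_nonneg _)
    have e2 : |(A r - A τ) / A r| ≤ (A s - A r) / ℓ := by
      have m1 := h.mono hr hτ' hτ.1
      have m2 := h.mono hτ' hs hτ.2
      rw [abs_div, abs_of_pos hAr, abs_sub_comm, abs_of_nonneg (sub_nonneg.2 m1)]
      exact div_le_div₀ (by linarith) (by linarith) h.sound_pos (h.le_compliance r hr)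
    calc |J τ / A τ| * |(A r - A τ) / A r| ≤ k * ((A s - A r) / ℓ) :=
          mul_le_mul (h.abs_stress_le hτ') e2 (abs_nonneg _) h.yield_pos.le
      _ = (A s - A r) * (k / ℓ) := by ring
  rw [intervalIntegral.integral_const_mul] at hle
  calc _ ≤ 2 * ((A s - A r) * (k / ℓ) * ∫ τ in r..s, |deriv J τ|) := by linarith
    _ = _ := by ring

/-- On short intervals where the compliance really grows, the right-hand side is small. This is what
forces saturation. -/
theorem yield_deficit_le (h : IsComplianceEvolution T k ℓ J A) {r s : ℝ} (hr : r ∈ Icc 0 T)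
    (hs : s ∈ Icc 0 T) (hrs : r ≤ s) (hA : A r < A s) :
    k ^ 2 - J s ^ 2 / (A r * A s) ≤ 2 * k / ℓ * ∫ τ in r..s, |deriv J τ| :=
  le_of_mul_le_mul_left (h.compliance_increment hr hs hrs) (sub_pos.2 hA)

theorem continuousOn_variation (h : IsComplianceEvolution T k ℓ J A) :
    ContinuousOn (fun t => ∫ τ in (0 : ℝ)..t, |deriv J τ|) (Icc 0 T) := by
  have := ((h.intervalIntegrable_deriv (left_mem_Icc.2 h.time_pos.le)
    (right_mem_Icc.2 h.time_pos.le)).abs.absolutelyContinuousOnInterval_intervalIntegral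
    left_mem_uIcc).continuousOn
  rwa [uIcc_of_le h.time_pos.le] at this

theorem variation_sub (h : IsComplianceEvolution T k ℓ J A) {r s : ℝ} (hr : r ∈ Icc 0 T)
    (hs : s ∈ Icc 0 T) : ∫ τ in r..s, |deriv J τ|
      = (∫ τ in (0 : ℝ)..s, |deriv J τ|) - ∫ τ in (0 : ℝ)..r, |deriv J τ| := by
  have h0 : (0 : ℝ) ∈ Icc 0 T := left_mem_Icc.2 h.time_pos.le
  rw [intervalIntegral.integral_interval_sub_left (h.intervalIntegrable_deriv h0 hs).abs
    (h.intervalIntegrable_deriv h0 hr).abs]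

/-- The increments of the compliance are controlled by the variation of the datum. -/
theorem exists_compliance_sub_le (h : IsComplianceEvolution T k ℓ J A) :
    ∃ K, ∀ r ∈ Icc 0 T, ∀ s ∈ Icc 0 T, r ≤ s →
      A s - A r ≤ K * ∫ τ in r..s, |deriv J τ| := by
  have h0 : (0 : ℝ) ∈ Icc 0 T := left_mem_Icc.2 h.time_pos.le
  have h1 : T ∈ Icc 0 T := right_mem_Icc.2 h.time_pos.le
  set I := ∫ τ in (0 : ℝ)..T, |deriv J τ|
  refine ⟨(2 * k / ℓ * A T + 2 * k + I / ℓ) / k ^ 2, fun r hr s hs hrs => ?_⟩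
  have hk := h.yield_pos
  have hℓ := h.sound_pos
  have hAr := h.compliance_pos hr
  have hAs := h.compliance_pos hs
  set i := ∫ τ in r..s, |deriv J τ| with hi
  have hi0 : 0 ≤ i := intervalIntegral.integral_nonneg hrs fun _ _ => abs_nonneg _
  have hiI : i ≤ I := by
    have e1 : 0 ≤ ∫ τ in (0 : ℝ)..r, |deriv J τ| :=
      intervalIntegral.integral_nonneg hr.1 fun _ _ => abs_nonneg _
    have e2 : 0 ≤ ∫ τ in s..T, |deriv J τ| :=
      intervalIntegral.integral_nonneg hs.2 fun _ _ => abs_nonneg _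
    rw [h.variation_sub hs h1] at e2
    rw [hi, h.variation_sub hr hs]
    linarith
  have hI0 : 0 ≤ I := hi0.trans hiI
  have hAT : 0 < A T := h.compliance_pos h1
  rw [div_mul_eq_mul_div, le_div_iff₀ (by positivity)]
  rcases (h.mono hr hs hrs).eq_or_lt with heq | hlt
  · rw [heq, sub_self, zero_mul]
    positivity
  have hdef := h.yield_deficit_le hr hs hrs hlt
  rw [← hi] at hdef
  -- The yield bound is used at r, not at s: k A s would give nothing, whereas k A r leaves the
  -- increment A s - A r to be estimated.
  have hJs : |J s| ≤ k * A r + i := by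
    have e1 : J s - J r = ∫ τ in r..s, deriv J τ := (h.ac_datum hr hs).integral_deriv_eq_sub.symm
    have e2 : |J s - J r| ≤ i := by
      rw [e1, hi]
      exact intervalIntegral.abs_integral_le_integral_abs hrs
    have e3 := h.yield r hr
    have e4 := abs_sub_abs_le_abs_sub (J s) (J r)
    linarith
  have hJs2 : J s ^ 2 ≤ (k * A r + i) ^ 2 := sq_le_sq' (neg_le_of_abs_le hJs) (le_of_abs_le hJs)
  have hmul : k ^ 2 * (A r * A s) - J s ^ 2 ≤ 2 * k / ℓ * i * (A r * A s) := by
    have := mul_le_mul_of_nonneg_right hdef (mul_pos hAr hAs).le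
    rwa [sub_mul, div_mul_cancel₀ _ (mul_pos hAr hAs).ne'] at this
  have hAsT : A s ≤ A T := h.mono hs h1 hs.2
  -- The three terms of the constant come from the yield deficit, from the cross term of (k A r +
  -- i)², and from i², which is absorbed by i ≤ I and ℓ ≤ A r.
  have hfin : A r * ((A s - A r) * k ^ 2) ≤ A r * ((2 * k / ℓ * A T + 2 * k + I / ℓ) * i) := by
    have e1 : i ^ 2 ≤ A r * (I / ℓ * i) := by
      have : 1 ≤ A r / ℓ := (one_le_div hℓ).2 (h.le_compliance r hr)
      calc i ^ 2 ≤ I * i := by nlinarith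
        _ = 1 * (I * i) := by ring
        _ ≤ A r / ℓ * (I * i) := by gcongr
        _ = _ := by ring
    have e2 : 2 * k / ℓ * i * (A r * A s) ≤ 2 * k / ℓ * i * (A r * A T) := by gcongr
    nlinarith
  exact le_of_mul_le_mul_left hfin hAr

/-- Increments of A are dominated by those of the primitive of |J'|, so the balance excludes jumps
of the compliance. -/
theorem continuousOn_compliance (h : IsComplianceEvolution T k ℓ J A) :
    ContinuousOn A (Icc 0 T) := by
  obtain ⟨K, hK⟩ := h.exists_compliance_sub_le
  set Φ := fun t => ∫ τ in (0 : ℝ)..t, |deriv J τ|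
  have hΦ := h.continuousOn_variation
  have key : ∀ r ∈ Icc 0 T, ∀ s ∈ Icc 0 T, |A s - A r| ≤ |K| * |Φ s - Φ r| := by
    intro r hr s hs
    wlog hrs : r ≤ s generalizing r s
    · rw [abs_sub_comm, abs_sub_comm (Φ s)]
      exact this s hs r hr (le_of_not_ge hrs)
    rw [abs_of_nonneg (sub_nonneg.2 (h.mono hr hs hrs)), ← abs_mul, ← h.variation_sub hr hs]
    exact (hK r hr s hs hrs).trans (le_abs_self _)
  intro t ht
  have h1 : Tendsto (fun s => |K| * |Φ s - Φ t|) (𝓝[Icc 0 T] t) (𝓝 0) := by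
    have : Tendsto (fun s => |K| * |Φ s - Φ t|) (𝓝[Icc 0 T] t) (𝓝 (|K| * |Φ t - Φ t|)) :=
      (Tendsto.sub_const (hΦ t ht) (Φ t)).abs.const_mul |K|
    simpa only [sub_self, abs_zero, mul_zero] using this
  rw [ContinuousWithinAt, tendsto_iff_dist_tendsto_zero]
  refine squeeze_zero' (Eventually.of_forall fun _ => dist_nonneg) ?_ h1
  filter_upwards [self_mem_nhdsWithin] with s hs using key t ht s hs

/-- The present compliance has been produced at a time of saturation. -/
theorem exists_saturated (h : IsComplianceEvolution T k ℓ J A) {t : ℝ} (ht : t ∈ Icc 0 T)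
    (hA : ℓ < A t) : ∃ s ∈ Icc 0 t, A s = A t ∧ |J s| = k * A s := by
  have hsub : Icc 0 t ⊆ Icc 0 T := Icc_subset_Icc_right ht.2
  have hclosed : IsClosed (Icc 0 t ∩ A ⁻¹' {A t}) :=
    (h.continuousOn_compliance.mono hsub).preimage_isClosed_of_isClosed isClosed_Icc
      isClosed_singleton
  -- The first time at which the compliance takes its value at t; it exists because A is continuous.
  obtain ⟨s, ⟨hs, hsA⟩, hmin⟩ := (isCompact_Icc.of_isClosed_subset hclosed
    inter_subset_left).exists_isLeast ⟨t, right_mem_Icc.2 ht.1, rfl⟩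
  have hsA : A s = A t := hsA
  refine ⟨s, hs, hsA, ?_⟩
  rcases hs.1.eq_or_lt with rfl | hs0
  -- If the value is already present at time 0, saturation is supplied by the initial condition.
  · exact h.initial.resolve_left (by rw [hsA]; exact hA.ne')
  have hsT := hsub hs
  have hlt : ∀ r ∈ Ico 0 s, A r < A s := fun r hr => by
    have hrT : r ∈ Icc 0 T := ⟨hr.1, hr.2.le.trans hsT.2⟩
    refine lt_of_le_of_ne (h.mono hrT hsT hr.2.le) fun heq => ?_
    exact hr.2.not_ge (hmin ⟨⟨hr.1, hr.2.le.trans hs.2⟩, heq.trans hsA⟩)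
  have hAs := h.compliance_pos hsT
  have hIco : Ico 0 s ⊆ Icc 0 T := fun r hr => ⟨hr.1, hr.2.le.trans hsT.2⟩
  have hne : (𝓝[Ico 0 s] s).NeBot := by
    rw [← mem_closure_iff_nhdsWithin_neBot, closure_Ico hs0.ne]
    exact right_mem_Icc.2 hs0.le
  have hlimA : Tendsto A (𝓝[Ico 0 s] s) (𝓝 (A s)) :=
    (h.continuousOn_compliance s hsT).mono_left (nhdsWithin_mono _ hIco)
  have hlimΦ := (h.continuousOn_variation s hsT).mono_left (nhdsWithin_mono _ hIco)
  -- Before s the compliance is strictly smaller, so `yield_deficit_le` applies on [r, s]. Letting r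
  -- increase to s makes the variation vanish.
  have hlim : k ^ 2 - J s ^ 2 / (A s * A s) ≤ 2 * k / ℓ *
      ((∫ τ in (0 : ℝ)..s, |deriv J τ|) - ∫ τ in (0 : ℝ)..s, |deriv J τ|) := by
    refine le_of_tendsto_of_tendsto
      (tendsto_const_nhds.sub (tendsto_const_nhds.div (hlimA.mul_const _) (by positivity)))
      ((tendsto_const_nhds.sub hlimΦ).const_mul _) ?_
    filter_upwards [self_mem_nhdsWithin] with r hr
    rw [← h.variation_sub (hIco hr) hsT]
    exact h.yield_deficit_le (hIco hr) hsT hr.2.le (hlt r hr)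
  rw [sub_self, mul_zero, sub_nonpos, le_div_iff₀ (by positivity)] at hlim
  refine le_antisymm (h.yield s hsT) ?_
  rw [← abs_of_pos (mul_pos h.yield_pos hAs), ← sq_le_sq]
  nlinarith

/-- The absolute values of the datum never decrease above the threshold `k ℓ` if and only if the
stress is saturated whenever there is damage. -/
theorem saturated_iff_datum (h : IsComplianceEvolution T k ℓ J A) :
    (∀ t ∈ Icc 0 T, A t = ℓ ∨ |J t| = k * A t) ↔
      ∀ s t : ℝ, 0 ≤ s → s < t → t ≤ T → |J t| < |J s| → |J t| ≤ k * ℓ := by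
  constructor
  · intro hsat s t hs hst ht hlt
    have htT : t ∈ Icc 0 T := ⟨hs.trans hst.le, ht⟩
    have hsT : s ∈ Icc 0 T := ⟨hs, hst.le.trans ht⟩
    rcases hsat t htT with h1 | h1
    · rw [← h1]
      exact h.yield t htT
    -- Saturation at t would give |J t| = k A t ≥ k A s ≥ |J s|, against the assumed decrease.
    · have h2 := mul_le_mul_of_nonneg_left (h.mono hsT htT hst.le) h.yield_pos.le
      linarith [h.yield s hsT]
  · intro hdat t ht
    by_contra! hcon
    have hA : ℓ < A t := lt_of_le_of_ne (h.le_compliance t ht) hcon.1.symm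
    obtain ⟨s, hs, hsA, hsJ⟩ := h.exists_saturated ht hA
    have hJt : |J t| < |J s| := by
      rw [hsJ, hsA]
      exact lt_of_le_of_ne (h.yield t ht) hcon.2
    have hst : s < t := lt_of_le_of_ne hs.2 fun heq => by rw [heq] at hJt; exact hJt.false
    have hkl : k * ℓ < |J s| := by
      rw [hsJ, hsA]
      exact mul_lt_mul_of_pos_left hA h.yield_pos
    -- The hypothesis at t alone gives only |J t| ≤ k ℓ, which is no contradiction. A level strictly
    -- between max(|J t|, k ℓ) and |J s| is attained in between and violates the hypothesis there.
    obtain ⟨c, hc1, hc2⟩ := exists_between (max_lt hJt hkl)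
    have hcont : ContinuousOn (fun τ => |J τ|) (Icc s t) :=
      (h.continuousOn_datum.mono (Icc_subset_Icc hs.1 ht.2)).abs
    obtain ⟨τ, hτ, hτc⟩ := intermediate_value_Ioo' hst.le hcont
      ⟨(le_max_left _ _).trans_lt hc1, hc2⟩
    have hτc : |J τ| = c := hτc
    have := hdat s τ hs.1 hτ.1 (hτ.2.le.trans ht.2) (by rw [hτc]; exact hc2)
    rw [hτc] at this
    exact absurd ((le_max_right _ _).trans_lt hc1) this.not_gt

/-- The stress is saturated whenever there is damage if and only if it is saturated from the onset
of damage onward. -/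
theorem saturated_iff_onset (h : IsComplianceEvolution T k ℓ J A) :
    (∀ t ∈ Icc 0 T, A t = ℓ ∨ |J t| = k * A t) ↔
      (A T ≠ ℓ → ∀ t ∈ Icc (sSup {t | t ∈ Icc 0 T ∧ A t = ℓ}) T, |J t| = k * A t) := by
  have hTT : T ∈ Icc 0 T := right_mem_Icc.2 h.time_pos.le
  set S := {t | t ∈ Icc 0 T ∧ A t = ℓ} with hS
  have hbdd : BddAbove S := ⟨T, fun t ht => ht.1.2⟩
  have hsup0 : 0 ≤ sSup S := Real.sSup_nonneg fun t ht => ht.1.1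
  have hsupT : sSup S ≤ T := Real.sSup_le (fun t ht => ht.1.2) h.time_pos.le
  constructor
  · intro hsat hAT t ht
    have htT : t ∈ Icc 0 T := ⟨hsup0.trans ht.1, ht.2⟩
    have hgt : ∀ s ∈ Ioc (sSup S) T, |J s| = k * A s := fun s hs => by
      have hsT : s ∈ Icc 0 T := ⟨hsup0.trans hs.1.le, hs.2⟩
      exact (hsat s hsT).resolve_left fun hA => hs.1.not_ge (le_csSup hbdd ⟨hsT, hA⟩)
    rcases ht.1.lt_or_eq with hlt | heq
    · exact hgt t ⟨hlt, ht.2⟩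
    rcases (hsat t htT).symm with h1 | h1
    · exact h1
    -- At the onset itself there may be no damage. Saturation is then inherited from later times by
    -- continuity.
    have htT' : t < T := lt_of_le_of_ne ht.2 fun h2 => hAT (h2 ▸ h1)
    have hne : (𝓝[Ioc t T] t).NeBot := by
      rw [← mem_closure_iff_nhdsWithin_neBot, closure_Ioc htT'.ne]
      exact left_mem_Icc.2 htT'.le
    have hsub : Ioc t T ⊆ Icc 0 T := fun s hs => ⟨htT.1.trans hs.1.le, hs.2⟩
    have l1 := ((h.continuousOn_datum t htT).mono_left (nhdsWithin_mono _ hsub)).abs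
    have l2 := ((h.continuousOn_compliance t htT).mono_left (nhdsWithin_mono _ hsub)).const_mul k
    refine tendsto_nhds_unique l1 (l2.congr' ?_)
    filter_upwards [self_mem_nhdsWithin] with s hs
    exact (hgt s ⟨heq ▸ hs.1, hs.2⟩).symm
  · intro hons t ht
    by_cases hA : A t = ℓ
    · exact Or.inl hA
    have hlt : ℓ < A t := lt_of_le_of_ne (h.le_compliance t ht) (Ne.symm hA)
    have hAT : A T ≠ ℓ := (hlt.trans_le (h.mono ht hTT ht.2)).ne'
    -- A damaged time lies beyond every undamaged one by monotonicity, hence beyond their supremum;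
    -- this includes the empty set, with supremum 0.
    refine Or.inr (hons hAT t ⟨Real.sSup_le (fun s hs => ?_) ht.1, ht.2⟩)
    by_contra! hts
    have := h.mono ht hs.1 hts.le
    rw [hs.2] at this
    exact this.not_gt hlt

/-- Once there is damage, a saturated stress is constant. -/
theorem stress_eq_of_saturated (h : IsComplianceEvolution T k ℓ J A)
    (hsat : ∀ t ∈ Icc 0 T, A t = ℓ ∨ |J t| = k * A t) {r s : ℝ} (hr : r ∈ Icc 0 T)
    (hs : s ∈ Icc 0 T) (hrs : r ≤ s) (hA : A r ≠ ℓ) : J r / A r = J s / A s := by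
  have hsub : Icc r s ⊆ Icc 0 T := Icc_subset_Icc hr.1 hs.2
  have habs : ∀ t ∈ Icc r s, |J t / A t| = k := fun t ht => by
    have htT := hsub ht
    have hlt : ℓ < A t := (lt_of_le_of_ne (h.le_compliance r hr) hA.symm).trans_le
      (h.mono hr htT ht.1)
    rw [abs_div, (hsat t htT).resolve_left hlt.ne', abs_of_pos (h.compliance_pos htT),
      mul_div_cancel_right₀ _ (h.compliance_pos htT).ne']
  have hcont : ContinuousOn (fun t => J t / A t) (Icc r s) :=
    (h.continuousOn_datum.mono hsub).div (h.continuousOn_compliance.mono hsub)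
      fun t ht => (h.compliance_pos (hsub ht)).ne'
  by_contra hne
  have hneg : J s / A s = -(J r / A r) := by
    rcases abs_eq_abs.1 ((habs r (left_mem_Icc.2 hrs)).trans
      (habs s (right_mem_Icc.2 hrs)).symm) with h1 | h1
    · exact absurd h1 hne
    · rw [h1, neg_neg]
  -- A change of sign of the continuous stress would make it vanish somewhere, while its modulus is
  -- k throughout.
  have hzero : (0 : ℝ) ∈ (fun t => J t / A t) '' uIcc r s := by
    refine intermediate_value_uIcc (by rwa [uIcc_of_le hrs]) ?_
    simp only [hneg]
    rw [mem_uIcc]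
    rcases le_total 0 (J r / A r) with h1 | h1
    · exact Or.inr ⟨by linarith, h1⟩
    · exact Or.inl ⟨h1, by linarith⟩
  obtain ⟨t, ht, ht0⟩ := hzero
  rw [uIcc_of_le hrs] at ht
  have := habs t ht
  rw [show J t / A t = 0 from ht0, abs_zero] at this
  exact h.yield_pos.ne this

end IsComplianceEvolution

/-! ### Minimization of the elastic energy -/

section Minimization

variable {L r₀ r₁ : ℝ} {r : ℝ → ℝ}

theorem memLp_of_mem_Icc (hr : AEStronglyMeasurable r (volume.restrict (Ioo 0 L)))
    (hb : ∀ᵐ x ∂volume.restrict (Ioo 0 L), r x ∈ Icc r₀ r₁) :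
    MemLp r 2 (volume.restrict (Ioo 0 L)) := by
  refine MemLp.of_bound hr (max |r₀| |r₁|) ?_
  filter_upwards [hb] with x hx
  rw [Real.norm_eq_abs]
  exact abs_le_max_abs_abs hx.1 hx.2

theorem integral_pos_of_mem_Icc (hL : 0 < L) (h₀ : 0 < r₀)
    (hr : AEStronglyMeasurable r (volume.restrict (Ioo 0 L)))
    (hb : ∀ᵐ x ∂volume.restrict (Ioo 0 L), r x ∈ Icc r₀ r₁) : 0 < ∫ x in Ioo 0 L, r x := by
  have h1 : ∫ x in Ioo 0 L, r₀ ≤ ∫ x in Ioo 0 L, r x :=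
    integral_mono_ae (integrable_const _) (integrable_of_memLp_Ioo (memLp_of_mem_Icc hr hb))
      (hb.mono fun x hx => hx.1)
  refine lt_of_lt_of_le ?_ h1
  simp only [integral_const, measureReal_restrict_apply_univ, Real.volume_real_Ioo_of_le hL.le,
    sub_zero, smul_eq_mul]
  positivity

/-- There is a competitor whose elastic energy is that of the whole bar in series. -/
theorem exists_integral_inv_mul_grad_sq_eq (hL : 0 < L) (h₀ : 0 < r₀)
    (hr : AEStronglyMeasurable r (volume.restrict (Ioo 0 L)))
    (hb : ∀ᵐ x ∂volume.restrict (Ioo 0 L), r x ∈ Icc r₀ r₁) (w : H1 univ) :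
    ∃ v : H1 (Ioo 0 L), SameBoundaryValues v w ∧
      (∀ᵐ x ∂volume.restrict (Ioo 0 L),
        (r x)⁻¹ * grad v x ^ 2 = (jump L w / ∫ y in Ioo 0 L, r y) ^ 2 * r x) ∧
      ∫ x in Ioo 0 L, (r x)⁻¹ * grad v x ^ 2 = jump L w ^ 2 / ∫ x in Ioo 0 L, r x := by
  have hR := integral_pos_of_mem_Icc hL h₀ hr hb
  set R := ∫ x in Ioo 0 L, r x
  -- The gradient proportional to the compliance density r is the one of constant stress.
  obtain ⟨v, hv, hgv⟩ := exists_sameBoundaryValues hL.le w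
    ((memLp_of_mem_Icc hr hb).const_mul (jump L w / R)) (by
      rw [integral_const_mul, div_mul_cancel₀ _ hR.ne'])
  have hae : ∀ᵐ x ∂volume.restrict (Ioo 0 L),
      (r x)⁻¹ * grad v x ^ 2 = (jump L w / R) ^ 2 * r x := by
    filter_upwards [hgv, hb] with x h1 h2
    have : r x ≠ 0 := (h₀.trans_le h2.1).ne'
    rw [h1]
    field_simp
  refine ⟨v, hv, hae, ?_⟩
  rw [integral_congr_ae hae, integral_const_mul]
  change (jump L w / R) ^ 2 * R = _
  field_simp

/-- A function whose elastic energy is minimal has a constant stress. -/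
theorem inv_mul_grad_ae_eq_of_le (hL : 0 < L) (h₀ : 0 < r₀)
    (hr : AEStronglyMeasurable r (volume.restrict (Ioo 0 L)))
    (hb : ∀ᵐ x ∂volume.restrict (Ioo 0 L), r x ∈ Icc r₀ r₁) {w : H1 univ} {v : H1 (Ioo 0 L)}
    (hv : SameBoundaryValues v w)
    (hle : ∫ x in Ioo 0 L, (r x)⁻¹ * grad v x ^ 2 ≤ jump L w ^ 2 / ∫ x in Ioo 0 L, r x) :
    ∀ᵐ x ∂volume.restrict (Ioo 0 L), (r x)⁻¹ * grad v x = jump L w / ∫ y in Ioo 0 L, r y := by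
  have hR := integral_pos_of_mem_Icc hL h₀ hr hb
  set R := ∫ x in Ioo 0 L, r x with hRdef
  set c := jump L w / R with hc
  have hri : Integrable r (volume.restrict (Ioo 0 L)) :=
    integrable_of_memLp_Ioo (memLp_of_mem_Icc hr hb)
  have hgi : Integrable (grad v) (volume.restrict (Ioo 0 L)) :=
    integrable_of_memLp_Ioo (memLp_grad v)
  have hinv : AEStronglyMeasurable (fun x => (r x)⁻¹) (volume.restrict (Ioo 0 L)) :=
    hr.aemeasurable.inv.aestronglyMeasurable
  have hqi : Integrable (fun x => (r x)⁻¹ * grad v x ^ 2) (volume.restrict (Ioo 0 L)) := by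
    refine Integrable.bdd_mul (c := r₀⁻¹) (memLp_grad v).integrable_sq hinv ?_
    filter_upwards [hb] with x hx
    have : 0 < r x := h₀.trans_le hx.1
    rw [norm_inv, Real.norm_eq_abs, abs_of_pos this]
    exact inv_anti₀ h₀ hx.1
  -- Completing the square: the integral of the left side is the excess of the elastic energy over
  -- (jump)² / R, so minimality forces it to vanish.
  have hae : (fun x => (r x)⁻¹ * (grad v x - c * r x) ^ 2) =ᵐ[volume.restrict (Ioo 0 L)]
      fun x => (r x)⁻¹ * grad v x ^ 2 - 2 * c * grad v x + c ^ 2 * r x := by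
    filter_upwards [hb] with x hx
    have : r x ≠ 0 := (h₀.trans_le hx.1).ne'
    field_simp
    ring
  have hi1 : Integrable (fun x => (r x)⁻¹ * grad v x ^ 2 - 2 * c * grad v x)
      (volume.restrict (Ioo 0 L)) := hqi.sub (hgi.const_mul _)
  have hint : Integrable (fun x => (r x)⁻¹ * (grad v x - c * r x) ^ 2)
      (volume.restrict (Ioo 0 L)) := (hi1.add (hri.const_mul _)).congr hae.symm
  have hnonneg : 0 ≤ᵐ[volume.restrict (Ioo 0 L)] fun x => (r x)⁻¹ * (grad v x - c * r x) ^ 2 := by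
    filter_upwards [hb] with x hx
    have : 0 < r x := h₀.trans_le hx.1
    simp only [Pi.zero_apply]
    positivity
  have hzero : ∫ x in Ioo 0 L, (r x)⁻¹ * (grad v x - c * r x) ^ 2 = 0 := by
    refine le_antisymm ?_ (integral_nonneg_of_ae hnonneg)
    rw [integral_congr_ae hae, integral_add hi1 (hri.const_mul _),
      integral_sub hqi (hgi.const_mul _), integral_const_mul, integral_const_mul,
      hv.integral_grad hL.le, ← hRdef]
    have e1 : 2 * c * jump L w = 2 * (jump L w ^ 2 / R) := by
      rw [hc]
      ring
    have e2 : c ^ 2 * R = jump L w ^ 2 / R := by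
      rw [hc]
      field_simp
    rw [e1, e2]
    linarith
  filter_upwards [(integral_eq_zero_iff_of_nonneg_ae hnonneg hint).1 hzero, hb] with x h1 h2
  have hpos : 0 < r x := h₀.trans_le h2.1
  have h3 : grad v x - c * r x = 0 := by
    have h1 : (r x)⁻¹ * (grad v x - c * r x) ^ 2 = 0 := h1
    rcases mul_eq_zero.1 h1 with h4 | h4
    · exact absurd h4 (inv_ne_zero hpos.ne')
    · exact pow_eq_zero_iff two_ne_zero |>.1 h4
  rw [sub_eq_zero.1 h3]
  field_simp

end Minimization

/-! ### The brittle damage evolutions at a fixed scale -/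

/-- The rescaled volume `μ_ε((0,L))` of the damaged zone. -/
def damageMass (L ε : ℝ) (Θ : ℝ → ℝ) : ℝ := ∫ x in Ioo 0 L, (1 - Θ x) / ε

/-- The compliance of a bar with rescaled volume `M` of damage. -/
def compliance (L a₀ a₁ ε M : ℝ) : ℝ := L / a₁ + (1 / a₀ - ε / a₁) * M

section Fixed

variable {L T a₀ a₁ κ ε : ℝ} {w : ℝ → H1 univ} {u : ℝ → H1 (Ioo 0 L)} {Θ : ℝ → ℝ → ℝ}

theorem IsFraction.integrable {θ : ℝ → ℝ} (h : IsFraction L θ) :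
    Integrable θ (volume.restrict (Ioo 0 L)) :=
  integrable_of_memLp_Ioo (memLp_of_mem_Icc h.1 h.2)

theorem isFraction_const {c : ℝ} (hc : c ∈ Icc (0 : ℝ) 1) : IsFraction L fun _ => c :=
  ⟨aestronglyMeasurable_const, Eventually.of_forall fun _ => hc⟩

theorem inv_stiffness (Θ : ℝ) :
    (stiffness a₀ a₁ ε Θ)⁻¹ = (1 - Θ) / (ε * a₀) + Θ / a₁ := by rw [stiffness, inv_inv]

/-- The local compliance is affine in the rescaled damage density, so only the total damage enters
the compliance of the bar. -/
theorem inv_stiffness_eq (ha₀ : 0 < a₀) (hε : 0 < ε) (Θ : ℝ) :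
    (stiffness a₀ a₁ ε Θ)⁻¹ = 1 / a₁ + (1 / a₀ - ε / a₁) * ((1 - Θ) / ε) := by
  rw [inv_stiffness]
  field_simp
  ring

theorem coeff_pos (ha₀ : 0 < a₀) (ha₁ : 0 < a₁) (hεa : ε * a₀ < a₁) : 0 < 1 / a₀ - ε / a₁ := by
  rw [sub_pos, div_lt_div_iff₀ ha₁ ha₀]
  linarith

theorem inv_stiffness_mem (ha₀ : 0 < a₀) (hε : 0 < ε) (hεa : ε * a₀ < a₁)
    {Θ : ℝ} (hΘ : Θ ∈ Icc (0 : ℝ) 1) :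
    (stiffness a₀ a₁ ε Θ)⁻¹ ∈ Icc (1 / a₁) (1 / (ε * a₀)) := by
  have hb : 1 / a₁ ≤ 1 / (ε * a₀) := one_div_le_one_div_of_le (by positivity) hεa.le
  rw [inv_stiffness, div_eq_mul_one_div (1 - Θ), div_eq_mul_one_div Θ]
  constructor <;> nlinarith [hΘ.1, hΘ.2]

theorem aestronglyMeasurable_inv_stiffness {θ : ℝ → ℝ} (h : IsFraction L θ) :
    AEStronglyMeasurable (fun x => (stiffness a₀ a₁ ε (θ x))⁻¹) (volume.restrict (Ioo 0 L)) := by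
  simp only [inv_stiffness]
  have := h.1.aemeasurable
  exact AEMeasurable.aestronglyMeasurable (by fun_prop)

theorem IsFraction.integrable_damage {θ : ℝ → ℝ} (h : IsFraction L θ) :
    Integrable (fun x => (1 - θ x) / ε) (volume.restrict (Ioo 0 L)) :=
  ((integrable_const 1).sub h.integrable).div_const ε

theorem integral_inv_stiffness (hL : 0 ≤ L) (ha₀ : 0 < a₀) (hε : 0 < ε) {θ : ℝ → ℝ}
    (h : IsFraction L θ) : ∫ x in Ioo 0 L, (stiffness a₀ a₁ ε (θ x))⁻¹
      = compliance L a₀ a₁ ε (damageMass L ε θ) := by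
  simp only [inv_stiffness_eq ha₀ hε]
  rw [integral_add (integrable_const _) (h.integrable_damage.const_mul _), integral_const_mul,
    compliance, damageMass]
  simp [hL]
  ring

theorem damageMass_nonneg (hε : 0 < ε) {θ : ℝ → ℝ} (h : IsFraction L θ) :
    0 ≤ damageMass L ε θ := by
  refine integral_nonneg_of_ae ?_
  filter_upwards [h.2] with x hx
  exact div_nonneg (sub_nonneg.2 hx.2) hε.le

theorem integral_fraction (hL : 0 ≤ L) (hε : 0 < ε) {θ : ℝ → ℝ} (h : IsFraction L θ) :
    ∫ x in Ioo 0 L, θ x = ε * (L / ε - damageMass L ε θ) := by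
  rw [damageMass, integral_div, integral_sub (integrable_const _) h.integrable]
  simp [hL]
  field_simp
  ring

/-- Compliances average arithmetically, which makes further damaging an affine operation on them. -/
theorem mixture_inv {α β θ : ℝ} (hα : 0 < α) (hβ : 0 < β) :
    (mixture α β θ) = (θ / α + (1 - θ) * β⁻¹)⁻¹ := by
  rw [mixture, ← one_div_div]
  field_simp

theorem stiffness_pos (ha₀ : 0 < a₀) (ha₁ : 0 < a₁) (hε : 0 < ε) (hεa : ε * a₀ < a₁)
    {Θ : ℝ} (hΘ : Θ ∈ Icc (0 : ℝ) 1) : 0 < stiffness a₀ a₁ ε Θ :=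
  inv_pos.1 ((one_div_pos.2 ha₁).trans_le (inv_stiffness_mem ha₀ hε hεa hΘ).1)

namespace IsBrittleEvolution

/-- The energy of the bar with a constant additional volume fraction of damage bounds the elastic
energy from above. -/
theorem elastic_le (h : IsBrittleEvolution L T a₀ a₁ κ ε w u Θ) (hL : 0 < L) (ha₀ : 0 < a₀)
    (ha₁ : 0 < a₁) (hε : 0 < ε) (hεa : ε * a₀ < a₁) {t : ℝ} (ht : t ∈ Icc 0 T) {θ : ℝ}
    (hθ : θ ∈ Icc (0 : ℝ) 1) :
    1 / 2 * (∫ x in Ioo 0 L, stiffness a₀ a₁ ε (Θ t x) * grad (u t) x ^ 2)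
      ≤ 1 / 2 * (jump L (w t) ^ 2 / (compliance L a₀ a₁ ε (damageMass L ε (Θ t))
          + (1 / a₀ - ε / a₁) * (θ * (L / ε - damageMass L ε (Θ t)))))
        + κ * (θ * (L / ε - damageMass L ε (Θ t))) := by
  have hf := h.fraction t ht
  -- The compliance density after damaging a further fraction θ of the present material.
  set r : ℝ → ℝ := fun x => θ / (ε * a₀) + (1 - θ) * (stiffness a₀ a₁ ε (Θ t x))⁻¹ with hr
  have hb : ∀ᵐ x ∂volume.restrict (Ioo 0 L), r x ∈ Icc (1 / a₁) (1 / (ε * a₀)) := by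
    filter_upwards [hf.2] with x hx
    have h1 := inv_stiffness_mem ha₀ hε hεa hx
    have h2 : 1 / a₁ ≤ 1 / (ε * a₀) := h1.1.trans h1.2
    simp only [hr]
    rw [div_eq_mul_one_div θ]
    constructor <;> nlinarith [hθ.1, hθ.2, h1.1, h1.2]
  have hm : AEStronglyMeasurable r (volume.restrict (Ioo 0 L)) :=
    ((aestronglyMeasurable_inv_stiffness hf).const_mul _).const_add _
  have hsi : Integrable (fun x => (stiffness a₀ a₁ ε (Θ t x))⁻¹) (volume.restrict (Ioo 0 L)) :=
    integrable_of_memLp_Ioo (memLp_of_mem_Icc (aestronglyMeasurable_inv_stiffness hf)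
      (hf.2.mono fun x hx => inv_stiffness_mem ha₀ hε hεa hx))
  have hR : ∫ x in Ioo 0 L, r x = compliance L a₀ a₁ ε (damageMass L ε (Θ t))
      + (1 / a₀ - ε / a₁) * (θ * (L / ε - damageMass L ε (Θ t))) := by
    simp only [hr]
    rw [integral_add (integrable_const _) (hsi.const_mul _), integral_const_mul,
      integral_inv_stiffness hL.le ha₀ hε hf]
    simp only [integral_const, measureReal_restrict_apply_univ, Real.volume_real_Ioo_of_le hL.le,
      sub_zero, smul_eq_mul, compliance]
    field_simp
    ring
  obtain ⟨v, hv, -, hve⟩ := exists_integral_inv_mul_grad_sq_eq hL (one_div_pos.2 ha₁) hm hb (w t)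
  have h1 := h.oneSided t ht v hv (fun _ => θ) (isFraction_const hθ)
  rw [integral_const_mul, integral_fraction hL.le hε hf] at h1
  have h2 : ∫ x in Ioo 0 L, mixture (ε * a₀) (stiffness a₀ a₁ ε (Θ t x)) θ * grad v x ^ 2
      = jump L (w t) ^ 2 / ∫ x in Ioo 0 L, r x := by
    rw [← hve]
    refine integral_congr_ae ?_
    filter_upwards [hf.2] with x hx
    rw [mixture_inv (by positivity) (stiffness_pos ha₀ ha₁ hε hεa hx)]
  rw [h2, hR] at h1
  refine h1.trans (le_of_eq ?_)
  field_simp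

/-- With θ = 0, one-sided minimality bounds the elastic energy by its minimum for the present
stiffness, and a minimizer has constant stress. -/
theorem stress_ae_eq (h : IsBrittleEvolution L T a₀ a₁ κ ε w u Θ) (hL : 0 < L) (ha₀ : 0 < a₀)
    (ha₁ : 0 < a₁) (hε : 0 < ε) (hεa : ε * a₀ < a₁) {t : ℝ} (ht : t ∈ Icc 0 T) :
    ∀ᵐ x ∂volume.restrict (Ioo 0 L), stress a₀ a₁ ε (u t) (Θ t) x
      = jump L (w t) / compliance L a₀ a₁ ε (damageMass L ε (Θ t)) := by
  have hf := h.fraction t ht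
  have h1 := h.elastic_le hL ha₀ ha₁ hε hεa ht (left_mem_Icc.2 zero_le_one)
  have h2 := inv_mul_grad_ae_eq_of_le (r := fun x => (stiffness a₀ a₁ ε (Θ t x))⁻¹) hL
    (one_div_pos.2 ha₁) (aestronglyMeasurable_inv_stiffness hf)
    (hf.2.mono fun x hx => inv_stiffness_mem ha₀ hε hεa hx) (h.dirichlet t ht) (by
      rw [integral_inv_stiffness hL.le ha₀ hε hf]
      simp only [inv_inv]
      simp only [zero_mul, mul_zero, add_zero] at h1
      linarith)
  rw [integral_inv_stiffness hL.le ha₀ hε hf] at h2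
  simpa only [inv_inv, stress] using h2

/-- The additive decomposition into elastic and plastic strain is already exact at positive ε. -/
theorem grad_ae_eq (h : IsBrittleEvolution L T a₀ a₁ κ ε w u Θ) (ha₀ : 0 < a₀)
    (ha₁ : 0 < a₁) (hε : 0 < ε) (hεa : ε * a₀ < a₁) {t : ℝ} (ht : t ∈ Icc 0 T) :
    ∀ᵐ x ∂volume.restrict (Ioo 0 L), grad (u t) x
      = stress a₀ a₁ ε (u t) (Θ t) x / a₁ * Θ t x
        + stress a₀ a₁ ε (u t) (Θ t) x / a₀ * ((1 - Θ t x) / ε) := by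
  filter_upwards [(h.fraction t ht).2] with x hx
  have hs := stiffness_pos ha₀ ha₁ hε hεa hx
  have e1 : grad (u t) x = stress a₀ a₁ ε (u t) (Θ t) x * (stiffness a₀ a₁ ε (Θ t x))⁻¹ := by
    rw [stress]
    field_simp
  conv_lhs => rw [e1, inv_stiffness]
  field_simp
  ring

theorem elastic_eq (h : IsBrittleEvolution L T a₀ a₁ κ ε w u Θ) (hL : 0 < L) (ha₀ : 0 < a₀)
    (ha₁ : 0 < a₁) (hε : 0 < ε) (hεa : ε * a₀ < a₁) {t : ℝ} (ht : t ∈ Icc 0 T) :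
    ∫ x in Ioo 0 L, stiffness a₀ a₁ ε (Θ t x) * grad (u t) x ^ 2
      = jump L (w t) ^ 2 / compliance L a₀ a₁ ε (damageMass L ε (Θ t)) := by
  have hae : ∀ᵐ x ∂volume.restrict (Ioo 0 L), stiffness a₀ a₁ ε (Θ t x) * grad (u t) x ^ 2
      = jump L (w t) / compliance L a₀ a₁ ε (damageMass L ε (Θ t)) * grad (u t) x := by
    filter_upwards [h.stress_ae_eq hL ha₀ ha₁ hε hεa ht] with x hx
    rw [← hx, stress]
    ring
  rw [integral_congr_ae hae, integral_const_mul, (h.dirichlet t ht).integral_grad hL.le]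
  ring

theorem totalEnergy_eq (h : IsBrittleEvolution L T a₀ a₁ κ ε w u Θ) (hL : 0 < L) (ha₀ : 0 < a₀)
    (ha₁ : 0 < a₁) (hε : 0 < ε) (hεa : ε * a₀ < a₁) {t : ℝ} (ht : t ∈ Icc 0 T) :
    totalEnergy L a₀ a₁ κ ε (grad (u t)) (Θ t)
      = jump L (w t) ^ 2 / (2 * compliance L a₀ a₁ ε (damageMass L ε (Θ t)))
        + κ * damageMass L ε (Θ t) := by
  rw [totalEnergy, h.elastic_eq hL ha₀ ha₁ hε hεa ht, damageMass, integral_div]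
  ring

theorem oneSided_scalar (h : IsBrittleEvolution L T a₀ a₁ κ ε w u Θ) (hL : 0 < L) (ha₀ : 0 < a₀)
    (ha₁ : 0 < a₁) (hε : 0 < ε) (hεa : ε * a₀ < a₁) {t : ℝ} (ht : t ∈ Icc 0 T) {N : ℝ}
    (hN : 0 ≤ N) (hNL : N ≤ L / ε - damageMass L ε (Θ t)) :
    jump L (w t) ^ 2 / (2 * compliance L a₀ a₁ ε (damageMass L ε (Θ t)))
      ≤ jump L (w t) ^ 2 / (2 * compliance L a₀ a₁ ε (damageMass L ε (Θ t) + N)) + κ * N := by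
  rcases hN.eq_or_lt with rfl | hN
  · simp
  have hP := hN.trans_le hNL
  -- The denominator is the integral of Θ / ε, the rescaled sound volume, so this constant fraction
  -- adds exactly the mass N of damage.
  have h1 := h.elastic_le hL ha₀ ha₁ hε hεa ht (θ := N / (L / ε - damageMass L ε (Θ t)))
    ⟨by positivity, (div_le_one hP).2 hNL⟩
  rw [div_mul_cancel₀ _ hP.ne', h.elastic_eq hL ha₀ ha₁ hε hεa ht] at h1
  have h2 : compliance L a₀ a₁ ε (damageMass L ε (Θ t)) + (1 / a₀ - ε / a₁) * N
      = compliance L a₀ a₁ ε (damageMass L ε (Θ t) + N) := by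
    rw [compliance, compliance]
    ring
  rw [h2] at h1
  calc _ = 1 / 2 * (jump L (w t) ^ 2 / compliance L a₀ a₁ ε (damageMass L ε (Θ t))) := by ring
    _ ≤ _ := h1
    _ = _ := by ring

theorem initial_scalar (h : IsBrittleEvolution L T a₀ a₁ κ ε w u Θ) (hT : 0 ≤ T) (hL : 0 < L)
    (ha₀ : 0 < a₀) (ha₁ : 0 < a₁) (hε : 0 < ε) (hεa : ε * a₀ < a₁) {N : ℝ}
    (hN : 0 ≤ N) (hNL : N ≤ L / ε) :
    jump L (w 0) ^ 2 / (2 * compliance L a₀ a₁ ε (damageMass L ε (Θ 0)))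
        + κ * damageMass L ε (Θ 0)
      ≤ jump L (w 0) ^ 2 / (2 * compliance L a₀ a₁ ε N) + κ * N := by
  have hPL : 0 < L / ε := by positivity
  set θ := N / (L / ε) with hθdef
  have hθ : θ ∈ Icc (0 : ℝ) 1 := ⟨by positivity, (div_le_one hPL).2 hNL⟩
  have hNθ : N = θ * (L / ε) := (div_mul_cancel₀ _ hPL.ne').symm
  have h2 : 1 / a₁ ≤ 1 / (ε * a₀) := one_div_le_one_div_of_le (by positivity) hεa.le
  set ρ := θ / (ε * a₀) + (1 - θ) * a₁⁻¹ with hρ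
  have hb : ∀ᵐ x ∂volume.restrict (Ioo 0 L), (fun _ : ℝ => ρ) x ∈ Icc (1 / a₁) (1 / (ε * a₀)) := by
    refine Eventually.of_forall fun x => ?_
    simp only [hρ]
    rw [div_eq_mul_one_div θ, ← one_div]
    constructor <;> nlinarith [hθ.1, hθ.2]
  have hR : ∫ _ in Ioo 0 L, ρ = compliance L a₀ a₁ ε N := by
    simp only [integral_const, measureReal_restrict_apply_univ, Real.volume_real_Ioo_of_le hL.le,
      sub_zero, smul_eq_mul, compliance, hρ]
    rw [hNθ]
    field_simp
    ring
  obtain ⟨v, hv, hvae, hve⟩ := exists_integral_inv_mul_grad_sq_eq hL (one_div_pos.2 ha₁)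
    aestronglyMeasurable_const hb (w 0)
  have h1 := h.initial v hv (fun _ => θ) (isFraction_const hθ)
  rw [h.totalEnergy_eq hL ha₀ ha₁ hε hεa (left_mem_Icc.2 hT)] at h1
  refine h1.trans (le_of_eq ?_)
  have hint : Integrable (fun x => ρ⁻¹ * grad v x ^ 2) (volume.restrict (Ioo 0 L)) :=
    (memLp_grad v).integrable_sq.const_mul _
  calc ∫ x in Ioo 0 L, (1 / 2 * mixture (ε * a₀) a₁ θ * grad v x ^ 2 + κ / ε * θ)
      = ∫ x in Ioo 0 L, (1 / 2 * (ρ⁻¹ * grad v x ^ 2) + κ / ε * θ) := by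
        rw [mixture_inv (by positivity) ha₁]
        congr 1 with x
        ring
    _ = 1 / 2 * (jump L (w 0) ^ 2 / compliance L a₀ a₁ ε N) + κ / ε * θ * L := by
        rw [integral_add (hint.const_mul _) (integrable_const _), integral_const_mul, hve, hR]
        simp only [integral_const, measureReal_restrict_apply_univ,
          Real.volume_real_Ioo_of_le hL.le, sub_zero, smul_eq_mul]
        ring
    _ = _ := by
        rw [hNθ]
        field_simp

/-- Since the stress is constant in space, the external power is the stress times the time
derivative of the jump. -/
theorem balance_scalar (h : IsBrittleEvolution L T a₀ a₁ κ ε w u Θ) (hL : 0 < L)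
    (ha₀ : 0 < a₀) (ha₁ : 0 < a₁) (hε : 0 < ε) (hεa : ε * a₀ < a₁)
    (hw : AbsolutelyContinuousOnInterval w 0 T) {t : ℝ} (ht : t ∈ Icc 0 T) :
    jump L (w t) ^ 2 / (2 * compliance L a₀ a₁ ε (damageMass L ε (Θ t)))
        + κ * damageMass L ε (Θ t)
      = jump L (w 0) ^ 2 / (2 * compliance L a₀ a₁ ε (damageMass L ε (Θ 0)))
        + κ * damageMass L ε (Θ 0)
        + ∫ s in (0 : ℝ)..t, jump L (w s) / compliance L a₀ a₁ ε (damageMass L ε (Θ s))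
          * deriv (fun τ => jump L (w τ)) s := by
  have hT : 0 ≤ T := ht.1.trans ht.2
  have h1 := h.energyBalance t ht
  rw [h.totalEnergy_eq hL ha₀ ha₁ hε hεa ht,
    h.totalEnergy_eq hL ha₀ ha₁ hε hεa (left_mem_Icc.2 hT)] at h1
  rw [h1]
  congr 1
  refine intervalIntegral.integral_congr_ae ?_
  filter_upwards [ae_deriv_jump hL.le hw] with s hs hst
  rw [uIoc_of_le ht.1] at hst
  have hsT : s ∈ Icc 0 T := ⟨hst.1.le, hst.2.trans ht.2⟩
  rw [← hs (by rwa [uIcc_of_le hT]), ← integral_const_mul]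
  refine integral_congr_ae ?_
  filter_upwards [h.stress_ae_eq hL ha₀ ha₁ hε hεa hsT] with x hx
  rw [← hx, stress]

theorem damageMass_mono (h : IsBrittleEvolution L T a₀ a₁ κ ε w u Θ) (hε : 0 < ε) :
    MonotoneOn (fun t => damageMass L ε (Θ t)) (Icc 0 T) := by
  intro s hs t ht hst
  refine integral_mono_ae (h.fraction s hs).integrable_damage (h.fraction t ht).integrable_damage ?_
  filter_upwards [h.mono s hs t ht hst] with x hx
  exact div_le_div_of_nonneg_right (by linarith [hx.2]) hε.le

end IsBrittleEvolution

end Fixed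

/-! ### Signed measures and their integrals -/

section Signed

open BoundedContinuousFunction

theorem isFiniteMeasure_variation (ν : SignedMeasure ℝ) : IsFiniteMeasure ν.variation := by
  rw [← SignedMeasure.totalVariation_eq_variation]
  infer_instance

theorem vectorIntegrable_of_bounded (ν : SignedMeasure ℝ) {φ : ℝ → ℝ} (hφ : Continuous φ) {C : ℝ}
    (hC : ∀ x, |φ x| ≤ C) : ν.Integrable φ := by
  have := isFiniteMeasure_variation ν
  exact Integrable.of_bound hφ.aestronglyMeasurable C (Eventually.of_forall hC)

theorem vectorIntegral_toSignedMeasure (m : Measure ℝ) [IsFiniteMeasure m] (φ : ℝ → ℝ) :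
    ∫ᵛ x, φ x ∂•m.toSignedMeasure = ∫ x, φ x ∂m := by
  have h : ContinuousLinearMap.lsmul ℝ ℝ = (ContinuousLinearMap.lsmul ℝ ℝ (E := ℝ)).flip := by
    ext
    simp
  rw [h]
  exact VectorMeasure.integral_toSignedMeasure

theorem integral_toSignedMeasure_sub (m n : Measure ℝ) [IsFiniteMeasure m] [IsFiniteMeasure n]
    {φ : ℝ → ℝ} (hφ : Continuous φ) {C : ℝ} (hC : ∀ x, |φ x| ≤ C) :
    ∫ᵛ x, φ x ∂•(m.toSignedMeasure - n.toSignedMeasure) = (∫ x, φ x ∂m) - ∫ x, φ x ∂n := by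
  rw [VectorMeasure.integral_sub_vectorMeasure (vectorIntegrable_of_bounded _ hφ hC)
    (vectorIntegrable_of_bounded _ hφ hC), vectorIntegral_toSignedMeasure,
    vectorIntegral_toSignedMeasure]

/-- A signed measure is nonnegative if its integrals of nonnegative bounded continuous functions
are. -/
theorem signedMeasure_nonneg_of_integral_nonneg {ν : SignedMeasure ℝ}
    (h : ∀ φ : ℝ → ℝ, Continuous φ → (∀ x, φ x ∈ Icc (0 : ℝ) 1) → 0 ≤ ∫ᵛ x, φ x ∂•ν) (E : Set ℝ) :
    0 ≤ ν E := by
  by_cases hE : MeasurableSet E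
  swap
  · rw [ν.not_measurable hE]
  set m := ν.toJordanDecomposition.posPart
  set n := ν.toJordanDecomposition.negPart
  have hν : ν = m.toSignedMeasure - n.toSignedMeasure :=
    (SignedMeasure.toSignedMeasure_toJordanDecomposition ν).symm
  -- Closed sets are reached by continuous cutoffs that decrease to their indicators. Inner
  -- regularity then extends the comparison of the Jordan parts to Borel sets.
  have hclosed : ∀ F, IsClosed F → n F ≤ m F := by
    intro F hF
    obtain ⟨δ, -, hδ, hδ0⟩ := exists_seq_strictAnti_tendsto (0 : ℝ)
    refine le_of_tendsto_of_tendsto' (tendsto_lintegral_thickenedIndicator_of_isClosed n hF hδ hδ0)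
      (tendsto_lintegral_thickenedIndicator_of_isClosed m hF hδ hδ0) fun k => ?_
    set φ : ℝ → ℝ := fun x => thickenedIndicator (hδ k) F x
    have hφc : Continuous φ :=
      NNReal.continuous_coe.comp (thickenedIndicator (hδ k) F).continuous
    have hφ : ∀ x, φ x ∈ Icc (0 : ℝ) 1 := fun x =>
      ⟨NNReal.coe_nonneg _, by exact_mod_cast thickenedIndicator_le_one (hδ k) F x⟩
    have hφ1 : ∀ x, |φ x| ≤ 1 := fun x => abs_le.2 ⟨by linarith [(hφ x).1], (hφ x).2⟩
    have h1 := h φ hφc hφ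
    rw [hν, integral_toSignedMeasure_sub _ _ hφc hφ1, sub_nonneg] at h1
    have h2 : ∀ (m : Measure ℝ) [IsFiniteMeasure m],
        ∫⁻ x, (thickenedIndicator (hδ k) F x : ℝ≥0∞) ∂m = ENNReal.ofReal (∫ x, φ x ∂m) := by
      intro m _
      rw [ofReal_integral_eq_lintegral_ofReal
        (Integrable.of_bound hφc.aestronglyMeasurable 1 (Eventually.of_forall hφ1))
        (Eventually.of_forall fun x => (hφ x).1)]
      refine lintegral_congr fun x => ?_
      simp [φ]
    rw [h2, h2]
    exact ENNReal.ofReal_le_ofReal h1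
  have hle : n E ≤ m E := by
    rw [hE.measure_eq_iSup_isClosed_of_ne_top (measure_ne_top n E)]
    exact iSup₂_le fun K hK => iSup_le fun hKc => (hclosed K hKc).trans (measure_mono hK)
  rw [hν, _root_.sub_apply, Measure.toSignedMeasure_apply_measurable hE,
    Measure.toSignedMeasure_apply_measurable hE, sub_nonneg]
  exact ENNReal.toReal_mono (measure_ne_top _ _) hle

theorem signedMeasure_le_of_integral_le {ν₁ ν₂ : SignedMeasure ℝ}
    (h : ∀ φ : ℝ → ℝ, Continuous φ → (∀ x, φ x ∈ Icc (0 : ℝ) 1) →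
      ∫ᵛ x, φ x ∂•ν₁ ≤ ∫ᵛ x, φ x ∂•ν₂) (E : Set ℝ) : ν₁ E ≤ ν₂ E := by
  have := signedMeasure_nonneg_of_integral_nonneg (ν := ν₂ - ν₁) (fun φ hφ hb => by
    have hb1 : ∀ x, |φ x| ≤ 1 := fun x => abs_le.2 ⟨by linarith [(hb x).1], (hb x).2⟩
    rw [VectorMeasure.integral_sub_vectorMeasure (vectorIntegrable_of_bounded _ hφ hb1)
      (vectorIntegrable_of_bounded _ hφ hb1), sub_nonneg]
    exact h φ hφ hb) E
  rwa [_root_.sub_apply, sub_nonneg] at this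

theorem signedMeasure_ext_of_integral {ν₁ ν₂ : SignedMeasure ℝ}
    (h : ∀ φ : ℝ → ℝ, Continuous φ → ∫ᵛ x, φ x ∂•ν₁ = ∫ᵛ x, φ x ∂•ν₂) : ν₁ = ν₂ := by
  ext E _
  exact le_antisymm (signedMeasure_le_of_integral_le (fun φ hφ _ => (h φ hφ).le) E)
    (signedMeasure_le_of_integral_le (fun φ hφ _ => (h φ hφ).ge) E)

theorem carriedBy_apply_univ {ν : SignedMeasure ℝ} {X : Set ℝ} (h : CarriedBy ν X)
    (hX : MeasurableSet X) : ν univ = ν X := by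
  conv_lhs => rw [← h]
  rw [VectorMeasure.restrict_apply _ hX MeasurableSet.univ, univ_inter]

theorem vectorIntegral_one (ν : SignedMeasure ℝ) : ∫ᵛ _, (1 : ℝ) ∂•ν = ν univ := by
  have := isFiniteMeasure_variation ν
  rw [VectorMeasure.integral_const]
  simp

/-- The finite measure underlying a nonnegative signed measure. -/
theorem exists_toSignedMeasure_eq {ν : SignedMeasure ℝ} (h : ∀ E, 0 ≤ ν E) :
    ∃ m : Measure ℝ, ∃ _ : IsFiniteMeasure m, m.toSignedMeasure = ν := by
  have h0 : 0 ≤[univ] ν := by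
    rw [VectorMeasure.restrict_univ, VectorMeasure.restrict_univ, VectorMeasure.le_iff]
    exact fun E _ => h E
  exact ⟨ν.toMeasureOfZeroLE univ MeasurableSet.univ h0, inferInstance,
    SignedMeasure.toMeasureOfZeroLE_toSignedMeasure ν h0⟩

theorem variation_smul_apply {ν : SignedMeasure ℝ} (h : ∀ E, 0 ≤ ν E) (c : ℝ) {X : Set ℝ}
    (hX : MeasurableSet X) : (c • ν).variation X = ENNReal.ofReal (|c| * ν X) := by
  obtain ⟨m, hm, rfl⟩ := exists_toSignedMeasure_eq h
  rw [VectorMeasure.variation_smul, Measure.variation_toSignedMeasure,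
    Measure.toSignedMeasure_apply_measurable hX, ENNReal.ofReal_mul (abs_nonneg c),
    ofReal_measureReal]
  rw [Measure.smul_apply, ← Real.norm_eq_abs, ofReal_norm]
  rfl

end Signed

/-! ### Passage to the limit -/

section Limit

variable {L T a₀ a₁ κ : ℝ} {w : ℝ → H1 univ} {ε : ℕ → ℝ} {uε : ℕ → ℝ → H1 (Ioo 0 L)}
  {Θε : ℕ → ℝ → ℝ → ℝ} {u e : ℝ → ℝ → ℝ} {p : ℝ → SignedMeasure ℝ} {σ : ℝ → ℝ}
  {μ : ℝ → SignedMeasure ℝ}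

/-- The compliance of the limit. -/
def limitCompliance (L a₀ a₁ : ℝ) (μ : ℝ → SignedMeasure ℝ) (t : ℝ) : ℝ :=
  L / a₁ + μ t (Icc 0 L) / a₀

namespace IsLimitEvolution

/-- Convergence holds in the measures on the closed interval, so the constant 1 is admissible and no
mass is lost at the ends. -/
theorem tendsto_damageMass (hlim : IsLimitEvolution L T a₀ a₁ ε uε Θε u e p σ μ) {t : ℝ}
    (ht : t ∈ Icc 0 T) :
    Tendsto (fun n => damageMass L (ε n) (Θε n t)) atTop (𝓝 (μ t (Icc 0 L))) := by
  have h := (hlim.damage t ht).2 (fun _ => 1) continuous_const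
  rw [vectorIntegral_one, carriedBy_apply_univ (hlim.damage t ht).1 measurableSet_Icc] at h
  simpa only [one_mul, damageMass] using h

theorem tendsto_coeff (hε₀ : Tendsto ε atTop (𝓝 0)) :
    Tendsto (fun n => 1 / a₀ - ε n / a₁) atTop (𝓝 (1 / a₀)) := by
  simpa using (hε₀.div_const a₁).const_sub (1 / a₀)

theorem tendsto_compliance (hε₀ : Tendsto ε atTop (𝓝 0)) {M : ℕ → ℝ} {M₀ : ℝ}
    (hM : Tendsto M atTop (𝓝 M₀)) :
    Tendsto (fun n => compliance L a₀ a₁ (ε n) (M n)) atTop (𝓝 (L / a₁ + M₀ / a₀)) := by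
  have := ((tendsto_coeff (a₀ := a₀) (a₁ := a₁) hε₀).mul hM).const_add (L / a₁)
  rwa [one_div_mul_eq_div] at this

theorem damage_nonneg (hε : ∀ n, 0 < ε n)
    (hev : ∀ n, IsBrittleEvolution L T a₀ a₁ κ (ε n) w (uε n) (Θε n))
    (hlim : IsLimitEvolution L T a₀ a₁ ε uε Θε u e p σ μ) {t : ℝ} (ht : t ∈ Icc 0 T) (E : Set ℝ) :
    0 ≤ μ t E := by
  refine signedMeasure_nonneg_of_integral_nonneg (fun φ hφ hb => ?_) E
  refine ge_of_tendsto' ((hlim.damage t ht).2 φ hφ) fun n => ?_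
  refine integral_nonneg_of_ae ?_
  filter_upwards [((hev n).fraction t ht).2] with x hx
  exact mul_nonneg (hb x).1 (div_nonneg (sub_nonneg.2 hx.2) (hε n).le)

theorem damage_mono (hε : ∀ n, 0 < ε n)
    (hev : ∀ n, IsBrittleEvolution L T a₀ a₁ κ (ε n) w (uε n) (Θε n))
    (hlim : IsLimitEvolution L T a₀ a₁ ε uε Θε u e p σ μ) {s t : ℝ} (hs : s ∈ Icc 0 T)
    (ht : t ∈ Icc 0 T) (hst : s ≤ t) (E : Set ℝ) : μ s E ≤ μ t E := by
  refine signedMeasure_le_of_integral_le (fun φ hφ hb => ?_) E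
  refine le_of_tendsto_of_tendsto' ((hlim.damage s hs).2 φ hφ) ((hlim.damage t ht).2 φ hφ)
    fun n => ?_
  have hi : ∀ τ ∈ Icc 0 T, Integrable (fun x => φ x * ((1 - Θε n τ x) / ε n))
      (volume.restrict (Ioo 0 L)) := fun τ hτ =>
    Integrable.bdd_mul (c := 1) ((hev n).fraction τ hτ).integrable_damage
      hφ.aestronglyMeasurable (Eventually.of_forall fun x => by
        rw [Real.norm_eq_abs]
        exact abs_le.2 ⟨by linarith [(hb x).1], (hb x).2⟩)
  refine integral_mono_ae (hi s hs) (hi t ht) ?_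
  filter_upwards [(hev n).mono s hs t ht hst] with x hx
  exact mul_le_mul_of_nonneg_left (div_le_div_of_nonneg_right (by linarith [hx.2]) (hε n).le)
    (hb x).1

theorem limitCompliance_pos (hL : 0 < L) (ha₀ : 0 < a₀) (ha₁ : 0 < a₁) (hε : ∀ n, 0 < ε n)
    (hev : ∀ n, IsBrittleEvolution L T a₀ a₁ κ (ε n) w (uε n) (Θε n))
    (hlim : IsLimitEvolution L T a₀ a₁ ε uε Θε u e p σ μ) {t : ℝ} (ht : t ∈ Icc 0 T) :
    0 < limitCompliance L a₀ a₁ μ t := by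
  have := hlim.damage_nonneg hε hev ht (Icc 0 L)
  rw [limitCompliance]
  positivity

theorem tendsto_stress (hL : 0 < L) (ha₀ : 0 < a₀) (ha₁ : 0 < a₁) (hε : ∀ n, 0 < ε n)
    (hε₀ : Tendsto ε atTop (𝓝 0))
    (hev : ∀ n, IsBrittleEvolution L T a₀ a₁ κ (ε n) w (uε n) (Θε n))
    (hlim : IsLimitEvolution L T a₀ a₁ ε uε Θε u e p σ μ) {t : ℝ} (ht : t ∈ Icc 0 T) :
    Tendsto (fun n => jump L (w t) / compliance L a₀ a₁ (ε n) (damageMass L (ε n) (Θε n t)))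
      atTop (𝓝 (jump L (w t) / limitCompliance L a₀ a₁ μ t)) :=
  tendsto_const_nhds.div (tendsto_compliance hε₀ (hlim.tendsto_damageMass ht))
    (hlim.limitCompliance_pos hL ha₀ ha₁ hε hev ht).ne'

/-- Each stress is almost everywhere a constant, so its L² distance to σ is √L times a distance
between real numbers. -/
theorem stress_eq (hL : 0 < L) (ha₀ : 0 < a₀) (ha₁ : 0 < a₁)
    (hε : ∀ n, 0 < ε n ∧ ε n * a₀ < a₁) (hε₀ : Tendsto ε atTop (𝓝 0))
    (hev : ∀ n, IsBrittleEvolution L T a₀ a₁ κ (ε n) w (uε n) (Θε n))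
    (hlim : IsLimitEvolution L T a₀ a₁ ε uε Θε u e p σ μ) {t : ℝ} (ht : t ∈ Icc 0 T) :
    σ t = jump L (w t) / limitCompliance L a₀ a₁ μ t := by
  have h1 := hlim.tendsto_stress hL ha₀ ha₁ (fun n => (hε n).1) hε₀ hev ht
  refine tendsto_nhds_unique ?_ h1
  set s := fun n => jump L (w t) / compliance L a₀ a₁ (ε n) (damageMass L (ε n) (Θε n t))
  have hne : (volume.restrict (Ioo 0 L)) univ ≠ 0 := by simp [hL]
  have h2 : ∀ n, eLpNorm (fun x => stress a₀ a₁ (ε n) (uε n t) (Θε n t) x - σ t) 2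
      (volume.restrict (Ioo 0 L)) = ENNReal.ofReal |s n - σ t| * ENNReal.ofReal L ^ (1 / 2 : ℝ) := by
    intro n
    have hae : (fun x => stress a₀ a₁ (ε n) (uε n t) (Θε n t) x - σ t)
        =ᵐ[volume.restrict (Ioo 0 L)] fun _ => s n - σ t := by
      filter_upwards [(hev n).stress_ae_eq hL ha₀ ha₁ (hε n).1 (hε n).2 ht] with x hx
      rw [hx]
    rw [eLpNorm_congr_ae hae, eLpNorm_const _ (by norm_num) (by
      intro h
      exact hne (by rw [h]; simp)), ← ofReal_norm, Real.norm_eq_abs]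
    simp
  have h3 := hlim.stress_limit t ht
  simp only [h2] at h3
  have hLpos : ENNReal.ofReal L ^ (1 / 2 : ℝ) ≠ 0 :=
    (ENNReal.rpow_pos (ENNReal.ofReal_pos.2 hL) ENNReal.ofReal_ne_top).ne'
  have hLtop : ENNReal.ofReal L ^ (1 / 2 : ℝ) ≠ ⊤ :=
    ENNReal.rpow_ne_top_of_nonneg (by norm_num) ENNReal.ofReal_ne_top
  have h4 : Tendsto (fun n => ENNReal.ofReal |s n - σ t|) atTop (𝓝 0) := by
    have := ENNReal.Tendsto.mul_const h3 (b := (ENNReal.ofReal L ^ (1 / 2 : ℝ))⁻¹)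
      (Or.inr (ENNReal.inv_ne_top.2 hLpos))
    rw [zero_mul] at this
    refine this.congr fun n => ?_
    rw [mul_assoc, ENNReal.mul_inv_cancel hLpos hLtop, mul_one]
  rw [tendsto_iff_dist_tendsto_zero]
  have h5 := (ENNReal.tendsto_toReal ENNReal.zero_ne_top).comp h4
  simpa [Function.comp_def, Real.dist_eq] using h5

/-- The compliance of the limit follows the scalar evolution law. -/
theorem isComplianceEvolution (hL : 0 < L) (hT : 0 < T) (ha₀ : 0 < a₀) (ha₁ : 0 < a₁)
    (hκ : 0 < κ) (hw : AbsolutelyContinuousOnInterval w 0 T)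
    (hε : ∀ n, 0 < ε n ∧ ε n * a₀ < a₁) (hε₀ : Tendsto ε atTop (𝓝 0))
    (hev : ∀ n, IsBrittleEvolution L T a₀ a₁ κ (ε n) w (uε n) (Θε n))
    (hlim : IsLimitEvolution L T a₀ a₁ ε uε Θε u e p σ μ) :
    IsComplianceEvolution T √(2 * κ * a₀) (L / a₁) (fun t => jump L (w t))
      (limitCompliance L a₀ a₁ μ) := by
  have hεpos := fun n => (hε n).1
  have hk : √(2 * κ * a₀) ^ 2 = 2 * κ * a₀ := Real.sq_sqrt (by positivity)
  have h0 : (0 : ℝ) ∈ Icc 0 T := left_mem_Icc.2 hT.le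
  have hM0 : ∀ t ∈ Icc 0 T, 0 ≤ μ t (Icc 0 L) := fun t ht => hlim.damage_nonneg hεpos hev ht _
  have hApos : ∀ t ∈ Icc 0 T, 0 < limitCompliance L a₀ a₁ μ t := fun t ht =>
    hlim.limitCompliance_pos hL ha₀ ha₁ hεpos hev ht
  -- The rescaled volume of the bar diverges, so any finite amount of extra damage is eventually
  -- admissible.
  have hLε : Tendsto (fun n => L / ε n) atTop atTop :=
    (tendsto_nhdsWithin_iff.2 ⟨hε₀, Eventually.of_forall hεpos⟩).inv_tendsto_nhdsGT_zero
      |>.const_mul_atTop hL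
  have hyield : ∀ t ∈ Icc 0 T, |jump L (w t)| ≤ √(2 * κ * a₀) * limitCompliance L a₀ a₁ μ t := by
    intro t ht
    have hA := hApos t ht
    have hM := hlim.tendsto_damageMass ht
    -- Adding damage N must not lower the energy; after division by N, letting N tend to 0 gives the
    -- yield inequality.
    have hstep : ∀ N, 0 < N → jump L (w t) ^ 2 ≤ 2 * κ * a₀ *
        (limitCompliance L a₀ a₁ μ t * (limitCompliance L a₀ a₁ μ t + N / a₀)) := by
      intro N hN
      have hA' : 0 < limitCompliance L a₀ a₁ μ t + N / a₀ := by positivity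
      have hlimN : Tendsto (fun n => compliance L a₀ a₁ (ε n) (damageMass L (ε n) (Θε n t) + N))
          atTop (𝓝 (limitCompliance L a₀ a₁ μ t + N / a₀)) := by
        have := tendsto_compliance (L := L) (a₀ := a₀) (a₁ := a₁) hε₀ (hM.add_const N)
        rwa [add_div, ← add_assoc] at this
      have h1 : jump L (w t) ^ 2 / (2 * limitCompliance L a₀ a₁ μ t)
          ≤ jump L (w t) ^ 2 / (2 * (limitCompliance L a₀ a₁ μ t + N / a₀)) + κ * N := by
        refine le_of_tendsto_of_tendsto
          (tendsto_const_nhds.div ((tendsto_compliance hε₀ hM).const_mul 2) (by positivity))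
          ((tendsto_const_nhds.div (hlimN.const_mul 2) (by positivity)).add_const _) ?_
        have hev1 : ∀ᶠ n in atTop, N ≤ L / ε n - damageMass L (ε n) (Θε n t) := by
          filter_upwards [hLε.eventually_ge_atTop (N + (μ t (Icc 0 L) + 1)),
            hM.eventually_lt_const (lt_add_one _)] with n h1 h2
          linarith
        filter_upwards [hev1] with n hn
        exact (hev n).oneSided_scalar hL ha₀ ha₁ (hε n).1 (hε n).2 ht hN.le hn
      have h2 : jump L (w t) ^ 2 / (2 * limitCompliance L a₀ a₁ μ t)
          - jump L (w t) ^ 2 / (2 * (limitCompliance L a₀ a₁ μ t + N / a₀))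
          = jump L (w t) ^ 2 / (2 * a₀ * (limitCompliance L a₀ a₁ μ t *
            (limitCompliance L a₀ a₁ μ t + N / a₀))) * N := by
        field_simp
        ring
      have h3 : jump L (w t) ^ 2 / (2 * a₀ * (limitCompliance L a₀ a₁ μ t *
          (limitCompliance L a₀ a₁ μ t + N / a₀))) ≤ κ :=
        le_of_mul_le_mul_right (by linarith) hN
      rw [div_le_iff₀ (by positivity)] at h3
      linarith
    have hsq : jump L (w t) ^ 2 ≤ 2 * κ * a₀ *
        (limitCompliance L a₀ a₁ μ t * (limitCompliance L a₀ a₁ μ t + 0 / a₀)) := by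
      refine ge_of_tendsto (f := fun N : ℝ => 2 * κ * a₀ *
        (limitCompliance L a₀ a₁ μ t * (limitCompliance L a₀ a₁ μ t + N / a₀)))
        (x := 𝓝[>] 0) ?_ (eventually_mem_nhdsWithin.mono hstep)
      exact (Continuous.tendsto (by fun_prop) 0).mono_left nhdsWithin_le_nhds
    rw [zero_div, add_zero, ← hk] at hsq
    exact abs_le_of_sq_le_sq (by nlinarith) (by positivity)
  have hmono : MonotoneOn (limitCompliance L a₀ a₁ μ) (Icc 0 T) := fun s hs t ht hst => by
    have := hlim.damage_mono hεpos hev hs ht hst (Icc 0 L)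
    rw [limitCompliance, limitCompliance]
    gcongr
  refine ⟨hT, by positivity, by positivity, absolutelyContinuous_jump hL.le hw, ?_, hmono, hyield,
    ?_, ?_⟩
  · intro t ht
    have := hM0 t ht
    rw [limitCompliance]
    exact le_add_of_nonneg_right (by positivity)
  · by_contra! hcon
    set M := μ 0 (Icc 0 L) with hMdef
    have hMpos : 0 < M := by
      refine lt_of_le_of_ne (hM0 0 h0) fun h => hcon.1 ?_
      rw [limitCompliance, ← hMdef, ← h, zero_div, add_zero]
    have hA := hApos 0 h0
    have hM := hlim.tendsto_damageMass h0
    -- Initially one may also compare with less damage, which gives the reverse inequality as N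
    -- increases to M. This needs M > 0, hence the alternative A 0 = ℓ.
    have hstep : ∀ N ∈ Ico 0 M, 2 * κ * a₀ *
        (limitCompliance L a₀ a₁ μ 0 * (L / a₁ + N / a₀)) ≤ jump L (w 0) ^ 2 := by
      intro N hN
      have hB : 0 < L / a₁ + N / a₀ := by
        have := hN.1
        positivity
      have h1 : jump L (w 0) ^ 2 / (2 * limitCompliance L a₀ a₁ μ 0) + κ * M
          ≤ jump L (w 0) ^ 2 / (2 * (L / a₁ + N / a₀)) + κ * N := by
        refine le_of_tendsto_of_tendsto
          ((tendsto_const_nhds.div ((tendsto_compliance hε₀ hM).const_mul 2)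
            (by rw [← hMdef]; rw [limitCompliance, ← hMdef] at hA; positivity)).add (hM.const_mul κ))
          ((tendsto_const_nhds.div ((tendsto_compliance hε₀ tendsto_const_nhds).const_mul 2)
            (by positivity)).add_const _) ?_
        filter_upwards [hLε.eventually_ge_atTop N] with n hn
        exact (hev n).initial_scalar hT.le hL ha₀ ha₁ (hε n).1 (hε n).2 hN.1 hn
      have h2 : jump L (w 0) ^ 2 / (2 * (L / a₁ + N / a₀))
          - jump L (w 0) ^ 2 / (2 * limitCompliance L a₀ a₁ μ 0)
          = jump L (w 0) ^ 2 / (2 * a₀ * (limitCompliance L a₀ a₁ μ 0 * (L / a₁ + N / a₀)))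
            * (M - N) := by
        have e1 : limitCompliance L a₀ a₁ μ 0 - (L / a₁ + N / a₀) = (M - N) / a₀ := by
          rw [limitCompliance]
          ring
        rw [div_sub_div _ _ (by positivity) (by positivity),
          show jump L (w 0) ^ 2 * (2 * limitCompliance L a₀ a₁ μ 0)
            - 2 * (L / a₁ + N / a₀) * jump L (w 0) ^ 2
            = 2 * jump L (w 0) ^ 2 * (limitCompliance L a₀ a₁ μ 0 - (L / a₁ + N / a₀)) by ring, e1]
        generalize L / a₁ + N / a₀ = B at *
        field_simp
      have h3 : κ ≤ jump L (w 0) ^ 2 /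
          (2 * a₀ * (limitCompliance L a₀ a₁ μ 0 * (L / a₁ + N / a₀))) :=
        le_of_mul_le_mul_right (by linarith) (sub_pos.2 hN.2)
      rw [le_div_iff₀ (by positivity)] at h3
      linarith
    have hne : (𝓝[Ico 0 M] M).NeBot := by
      rw [← mem_closure_iff_nhdsWithin_neBot, closure_Ico hMpos.ne]
      exact right_mem_Icc.2 hMpos.le
    have hsq : 2 * κ * a₀ * (limitCompliance L a₀ a₁ μ 0 * (L / a₁ + M / a₀))
        ≤ jump L (w 0) ^ 2 := by
      refine le_of_tendsto (f := fun N : ℝ => 2 * κ * a₀ *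
        (limitCompliance L a₀ a₁ μ 0 * (L / a₁ + N / a₀)))
        (x := 𝓝[Ico 0 M] M) ?_ (eventually_mem_nhdsWithin.mono hstep)
      exact (Continuous.tendsto (by fun_prop) M).mono_left nhdsWithin_le_nhds
    refine hcon.2 (le_antisymm (hyield 0 h0) ?_)
    rw [← abs_of_pos (show 0 < √(2 * κ * a₀) * limitCompliance L a₀ a₁ μ 0 by positivity),
      ← sq_le_sq, mul_pow, hk]
    refine le_trans (le_of_eq ?_) hsq
    rw [limitCompliance]
    ring
  · intro t ht
    have hE : ∀ τ ∈ Icc 0 T, Tendsto (fun n => jump L (w τ) ^ 2 /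
        (2 * compliance L a₀ a₁ (ε n) (damageMass L (ε n) (Θε n τ)))
          + κ * damageMass L (ε n) (Θε n τ)) atTop
        (𝓝 (jump L (w τ) ^ 2 / (2 * limitCompliance L a₀ a₁ μ τ) + κ * μ τ (Icc 0 L))) := by
      intro τ hτ
      have hA := hApos τ hτ
      exact (tendsto_const_nhds.div ((tendsto_compliance hε₀ (hlim.tendsto_damageMass hτ)).const_mul
        2) (by rw [limitCompliance] at hA; positivity)).add ((hlim.tendsto_damageMass hτ).const_mul κ)
    have hsub : uIoc 0 t ⊆ Icc 0 T := by
      rw [uIoc_of_le ht.1]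
      exact fun s hs => ⟨hs.1.le, hs.2.trans ht.2⟩
    have hJac := absolutelyContinuous_jump hL.le hw
    have hJcont : ContinuousOn (fun s => jump L (w s)) (Icc 0 T) := by
      simpa [uIcc_of_le hT.le] using hJac.continuousOn
    obtain ⟨C, hC⟩ := isCompact_Icc.exists_bound_of_continuousOn hJcont
    have hJi : IntervalIntegrable (deriv fun s => jump L (w s)) volume 0 t :=
      (hJac.mono (by
        rw [uIcc_of_le hT.le, uIcc_of_le ht.1]
        exact Icc_subset_Icc_right ht.2)).intervalIntegrable_deriv
    -- Dominated convergence: every compliance is at least L / a₁, so the power is bounded by a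
    -- constant times |J'|.
    have hpower : Tendsto (fun n => ∫ s in (0 : ℝ)..t,
        jump L (w s) / compliance L a₀ a₁ (ε n) (damageMass L (ε n) (Θε n s))
          * deriv (fun τ => jump L (w τ)) s) atTop
        (𝓝 (∫ s in (0 : ℝ)..t, jump L (w s) / limitCompliance L a₀ a₁ μ s
          * deriv (fun τ => jump L (w τ)) s)) := by
      refine intervalIntegral.tendsto_integral_filter_of_dominated_convergence
        (fun s => C / (L / a₁) * |deriv (fun τ => jump L (w τ)) s|) ?_ ?_ (hJi.abs.const_mul _) ?_
      · refine Eventually.of_forall fun n => ?_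
        have m1 : AEMeasurable (fun s => damageMass L (ε n) (Θε n s))
            (volume.restrict (uIoc 0 t)) :=
          (aemeasurable_restrict_of_monotoneOn measurableSet_Icc
            ((hev n).damageMass_mono (hεpos n))).mono_measure (Measure.restrict_mono hsub le_rfl)
        have m2 : AEMeasurable (fun s => jump L (w s)) (volume.restrict (uIoc 0 t)) :=
          (hJcont.mono hsub).aemeasurable measurableSet_uIoc
        have m3 : AEMeasurable (deriv fun s => jump L (w s)) (volume.restrict (uIoc 0 t)) :=
          (intervalIntegrable_iff.1 hJi).aestronglyMeasurable.aemeasurable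
        simp only [compliance]
        exact AEMeasurable.aestronglyMeasurable
          ((m2.div ((m1.const_mul _).const_add _)).mul m3)
      · refine Eventually.of_forall fun n => Eventually.of_forall fun s hs => ?_
        have hs' := hsub hs
        have hm := damageMass_nonneg (hεpos n) ((hev n).fraction s hs')
        have hb := coeff_pos ha₀ ha₁ (hε n).2
        have hcomp : L / a₁ ≤ compliance L a₀ a₁ (ε n) (damageMass L (ε n) (Θε n s)) := by
          rw [compliance]
          exact le_add_of_nonneg_right (by positivity)
        have hpos : 0 < L / a₁ := by positivity
        rw [norm_mul, norm_div, Real.norm_eq_abs (deriv _ s),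
          Real.norm_of_nonneg (hpos.le.trans hcomp)]
        refine mul_le_mul_of_nonneg_right ?_ (abs_nonneg _)
        exact div_le_div₀ ((norm_nonneg _).trans (hC s hs')) (hC s hs') hpos hcomp
      · refine Eventually.of_forall fun s hs => ?_
        exact (hlim.tendsto_stress hL ha₀ ha₁ hεpos hε₀ hev (hsub hs)).mul_const _
    have hbal := tendsto_nhds_unique (hE t ht) (((hE 0 h0).add hpower).congr fun n =>
      ((hev n).balance_scalar hL ha₀ ha₁ (hε n).1 (hε n).2 hw ht).symm)
    -- The damage energy and the term k² A / 2 differ by a constant, which cancels in the balance.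
    have hA : ∀ τ, √(2 * κ * a₀) ^ 2 / 2 * limitCompliance L a₀ a₁ μ τ
        = √(2 * κ * a₀) ^ 2 / 2 * (L / a₁) + κ * μ τ (Icc 0 L) := fun τ => by
      rw [hk, limitCompliance]
      field_simp
    rw [hA t, hA 0]
    linarith

/-- A product of a convergent scalar and a weakly-* convergent measure passes to the limit, because
the stress does not depend on x. -/
theorem plastic_eq (hL : 0 < L) (ha₀ : 0 < a₀) (ha₁ : 0 < a₁)
    (hε : ∀ n, 0 < ε n ∧ ε n * a₀ < a₁) (hε₀ : Tendsto ε atTop (𝓝 0))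
    (hev : ∀ n, IsBrittleEvolution L T a₀ a₁ κ (ε n) w (uε n) (Θε n))
    (hlim : IsLimitEvolution L T a₀ a₁ ε uε Θε u e p σ μ) {t : ℝ} (ht : t ∈ Icc 0 T) :
    p t = (σ t / a₀) • μ t := by
  refine signedMeasure_ext_of_integral fun φ hφ => ?_
  rw [VectorMeasure.integral_smul_vectorMeasure, smul_eq_mul]
  have h1 := hlim.tendsto_stress hL ha₀ ha₁ (fun n => (hε n).1) hε₀ hev ht
  rw [← hlim.stress_eq hL ha₀ ha₁ hε hε₀ hev ht] at h1
  refine tendsto_nhds_unique ((hlim.plastic t ht).2 φ hφ)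
    (((h1.div_const a₀).mul ((hlim.damage t ht).2 φ hφ)).congr fun n => ?_)
  rw [← integral_const_mul]
  refine integral_congr_ae ?_
  filter_upwards [(hev n).stress_ae_eq hL ha₀ ha₁ (hε n).1 (hε n).2 ht] with x hx
  rw [hx]
  ring

/-- Since Θ_ε is 1 minus ε times the damage density, whose integrals against continuous functions
converge, Θ_ε tends weakly to 1. -/
theorem elastic_ae_eq (hL : 0 < L) (ha₀ : 0 < a₀) (ha₁ : 0 < a₁)
    (hε : ∀ n, 0 < ε n ∧ ε n * a₀ < a₁) (hε₀ : Tendsto ε atTop (𝓝 0))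
    (hev : ∀ n, IsBrittleEvolution L T a₀ a₁ κ (ε n) w (uε n) (Θε n))
    (hlim : IsLimitEvolution L T a₀ a₁ ε uε Θε u e p σ μ) {t : ℝ} (ht : t ∈ Icc 0 T) :
    e t =ᵐ[volume.restrict (Ioo 0 L)] fun _ => σ t / a₁ := by
  have hem := (hlim.elastic t ht).1
  have hei : Integrable (e t) (volume.restrict (Ioo 0 L)) := integrable_of_memLp_Ioo hem
  have h1 := hlim.tendsto_stress hL ha₀ ha₁ (fun n => (hε n).1) hε₀ hev ht
  rw [← hlim.stress_eq hL ha₀ ha₁ hε hε₀ hev ht] at h1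
  have hkey : ∀ φ, IsTestFun (Ioo 0 L) φ →
      ∫ x in Ioo 0 L, φ x * e t x = σ t / a₁ * ∫ x in Ioo 0 L, φ x := by
    intro φ hφ
    have hφm := hφ.memLp (V := Ioo 0 L)
    have hφi : Integrable φ (volume.restrict (Ioo 0 L)) := integrable_of_memLp_Ioo hφm
    have h2 := (hε₀.mul ((hlim.damage t ht).2 φ hφ.1.continuous)).const_sub
      (∫ x in Ioo 0 L, φ x)
    rw [zero_mul, sub_zero] at h2
    refine tendsto_nhds_unique ((hlim.elastic t ht).2 φ hφm)
      (((h1.div_const a₁).mul h2).congr fun n => ?_)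
    have hf := (hev n).fraction t ht
    have hdm : MemLp (fun x => (1 - Θε n t x) / ε n) 2 (volume.restrict (Ioo 0 L)) :=
      ((memLp_const 1).sub (memLp_of_mem_Icc hf.1 hf.2)).mul_const (ε n)⁻¹
    have hmi : Integrable (fun x => φ x * ((1 - Θε n t x) / ε n)) (volume.restrict (Ioo 0 L)) :=
      hφm.integrable_mul hdm
    rw [← integral_const_mul, ← integral_sub hφi (hmi.const_mul _), ← integral_const_mul]
    refine integral_congr_ae ?_
    filter_upwards [(hev n).stress_ae_eq hL ha₀ ha₁ (hε n).1 (hε n).2 ht] with x hx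
    have := (hε n).1.ne'
    rw [hx]
    field_simp
    ring
  have hdiff : LocallyIntegrableOn (fun x => e t x - σ t / a₁) (Ioo 0 L) :=
    IntegrableOn.locallyIntegrableOn
      (hei.sub (integrable_const (μ := volume.restrict (Ioo 0 L)) (σ t / a₁)))
  have h3 := isOpen_Ioo.ae_eq_zero_of_integral_contDiff_smul_eq_zero (μ := volume) hdiff (by
    intro φ h1 h2 h3
    have hφ : IsTestFun (Ioo 0 L) φ := ⟨h1, h2, h3⟩
    have hφm := hφ.memLp (V := Ioo 0 L)
    have hφi : Integrable φ (volume.restrict (Ioo 0 L)) := integrable_of_memLp_Ioo hφm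
    have hφe : Integrable (fun x => φ x * e t x) (volume.restrict (Ioo 0 L)) :=
      hφm.integrable_mul hem
    have h4 : ∫ x, φ x • (e t x - σ t / a₁) = ∫ x in Ioo 0 L, (e t x - σ t / a₁) * φ x := by
      rw [setIntegral_mul_isTestFun _ hφ]
      congr 1 with x
      rw [smul_eq_mul, mul_comm]
    rw [h4]
    have h5 : ∫ x in Ioo 0 L, (e t x - σ t / a₁) * φ x
        = ∫ x in Ioo 0 L, (φ x * e t x - σ t / a₁ * φ x) := by
      congr 1 with x
      ring
    rw [h5, integral_sub hφe (hφi.const_mul _), integral_const_mul, hkey φ hφ, sub_self])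
  rw [EventuallyEq, ae_restrict_iff' measurableSet_Ioo]
  filter_upwards [h3] with x hx hxI using sub_eq_zero.1 (hx hxI)

end IsLimitEvolution

end Limit

/-! ### Functions whose derivative is a constant plus a multiple of a measure -/

section Spatial

variable {L : ℝ}

theorem isTrace_of_tendsto {v g : ℝ → ℝ} {x c : ℝ}
    (hv : v =ᵐ[volume.restrict (Ioo 0 L)] g) (hg : Tendsto g (𝓝[Ioo 0 L] x) (𝓝 c)) :
    IsTrace (Ioo 0 L) v x c := by
  rw [IsTrace, Metric.tendsto_nhdsWithin_nhds]
  intro δ hδ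
  rw [Metric.tendsto_nhdsWithin_nhds] at hg
  -- The ball has length 2r, so a pointwise bound δ / 4 gives a rescaled integral of at most δ / 2.
  obtain ⟨r₀, hr₀, hr⟩ := hg (δ / 4) (by positivity)
  refine ⟨r₀, hr₀, fun r hr1 hr2 => ?_⟩
  have hrpos : 0 < r := hr1
  have hrr : r < r₀ := by
    rw [Real.dist_eq, sub_zero, abs_of_pos hrpos] at hr2
    exact hr2
  set S := Ioo 0 L ∩ Metric.ball x r with hS
  have hSm : MeasurableSet S := measurableSet_Ioo.inter measurableSet_ball
  have hball : volume (Metric.ball x r) = ENNReal.ofReal (2 * r) := Real.volume_ball x r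
  have hSv : volume S ≤ ENNReal.ofReal (2 * r) :=
    (measure_mono inter_subset_right).trans hball.le
  have hb : ∀ᵐ y ∂volume.restrict S, ‖|v y - c|‖ ≤ δ / 4 := by
    filter_upwards [ae_restrict_of_ae_restrict_of_subset inter_subset_left hv,
      ae_restrict_mem hSm] with y hy hyS
    rw [hy, norm_abs_eq_norm]
    exact (hr hyS.1 (lt_of_lt_of_le hyS.2 hrr.le)).le
  have hle := norm_setIntegral_le_of_norm_le_const_ae (hSv.trans_lt ENNReal.ofReal_lt_top) hb
  have hreal : volume.real S ≤ 2 * r := by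
    rw [Measure.real]
    exact ENNReal.toReal_le_of_le_ofReal (by positivity) hSv
  rw [Real.dist_eq, sub_zero, abs_mul, abs_of_pos (inv_pos.2 hrpos), inv_mul_lt_iff₀ hrpos]
  calc ‖∫ y in S, |v y - c|‖ ≤ δ / 4 * volume.real S := hle
    _ ≤ δ / 4 * (2 * r) := by gcongr
    _ < r * δ := by nlinarith

/-- The limit from the right at 0 includes the atom there. At the other end, the limit from the left
excludes the atom at L. These two atoms are the gaps between the inner traces and the datum. -/
theorem tendsto_measureReal_Iio_right (m : Measure ℝ) [IsFiniteMeasure m] :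
    Tendsto (fun x => m.real (Iio x)) (𝓝[>] 0) (𝓝 (m.real (Iic 0))) := by
  have h := tendsto_measure_biInter_gt (μ := m) (s := fun r : ℝ => Iio r) (a := 0)
    (fun r _ => measurableSet_Iio.nullMeasurableSet) (fun i j _ hij => Iio_subset_Iio hij)
    ⟨1, one_pos, measure_ne_top m _⟩
  have he : ⋂ r > (0 : ℝ), Iio r = Iic 0 := by
    ext x
    simp only [mem_iInter, mem_Iio, mem_Iic]
    exact ⟨fun h => le_of_forall_gt fun r hr => h r hr, fun h r hr => h.trans_lt hr⟩
  rw [he] at h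
  exact (ENNReal.tendsto_toReal (measure_ne_top m _)).comp h

theorem tendsto_measureReal_Iio_left (m : Measure ℝ) [IsFiniteMeasure m] (L : ℝ) :
    Tendsto (fun x => m.real (Iio x)) (𝓝[<] L) (𝓝 (m.real (Iio L))) := by
  have h := tendsto_measure_biInter_gt (μ := m) (s := fun r : ℝ => Ici (L - r)) (a := 0)
    (fun r _ => measurableSet_Ici.nullMeasurableSet)
    (fun i j _ hij => Ici_subset_Ici.2 (by linarith)) ⟨1, one_pos, measure_ne_top m _⟩
  have he : ⋂ r > (0 : ℝ), Ici (L - r) = Ici L := by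
    ext x
    simp only [mem_iInter, mem_Ici]
    exact ⟨fun h => le_of_forall_pos_le_add fun r hr => by linarith [h r hr],
      fun h r hr => by linarith [show (0 : ℝ) < r from hr]⟩
  rw [he] at h
  have h1 : Tendsto (fun x => L - x) (𝓝[<] L) (𝓝[>] 0) := by
    refine tendsto_nhdsWithin_iff.2 ⟨?_, ?_⟩
    · exact (Continuous.tendsto' (by fun_prop) L 0 (sub_self L)).mono_left nhdsWithin_le_nhds
    · filter_upwards [self_mem_nhdsWithin] with x hx using sub_pos.2 (mem_Iio.1 hx)
  have h2 := ((ENNReal.tendsto_toReal (measure_ne_top m _)).comp h).comp h1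
  have h3 : ∀ x, m.real (Iio x) = m.real univ - m.real (Ici x) := fun x => by
    rw [← compl_Ici, measureReal_compl measurableSet_Ici]
  simp only [h3]
  refine Tendsto.const_sub _ (h2.congr fun x => ?_)
  simp [Measure.real]

/-- Integration by parts for a distribution function, by Fubini on the set y < x. -/
theorem integral_measureReal_Iio_mul_deriv (m : Measure ℝ) [IsFiniteMeasure m]
    (hm : ∀ᵐ y ∂m, y ∈ Icc 0 L) {ψ : ℝ → ℝ} (hψ : ContDiff ℝ 1 ψ) :
    ∫ x in Ioo 0 L, m.real (Iio x) * deriv ψ x = m.real univ * ψ L - ∫ y, ψ y ∂m := by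
  have hdc : Continuous (deriv ψ) := hψ.continuous_deriv le_rfl
  obtain ⟨C, hC⟩ := (isCompact_Icc (a := (0 : ℝ)) (b := L)).exists_bound_of_continuousOn
    hdc.continuousOn
  obtain ⟨D, hD⟩ := (isCompact_Icc (a := (0 : ℝ)) (b := L)).exists_bound_of_continuousOn
    hψ.continuous.continuousOn
  have hψm : Integrable ψ m := Integrable.of_bound hψ.continuous.aestronglyMeasurable D
    (hm.mono fun y hy => hD y hy)
  set F : ℝ → ℝ → ℝ := fun x y => (Iio x).indicator (fun _ => deriv ψ x) y with hF
  have hFm : Measurable (Function.uncurry F) := by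
    have : Function.uncurry F = {z : ℝ × ℝ | z.2 < z.1}.indicator fun z => deriv ψ z.1 := by
      ext ⟨x, y⟩
      simp [F, indicator]
    rw [this]
    exact (hdc.measurable.comp measurable_fst).indicator
      (measurableSet_lt measurable_snd measurable_fst)
  have hFi : Integrable (Function.uncurry F) ((volume.restrict (Ioo 0 L)).prod m) := by
    refine Integrable.of_bound hFm.aestronglyMeasurable C ?_
    filter_upwards [Measure.quasiMeasurePreserving_fst.ae
      (ae_restrict_mem (measurableSet_Ioo (a := (0 : ℝ)) (b := L)))] with z hz
    exact (norm_indicator_le_norm_self _ _).trans (hC z.1 (Ioo_subset_Icc_self hz))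
  have h1 : ∀ x, ∫ y, F x y ∂m = m.real (Iio x) * deriv ψ x := fun x => by
    rw [integral_indicator_const _ measurableSet_Iio, smul_eq_mul]
  have h2 : ∀ y ∈ Icc 0 L, ∫ x in Ioo 0 L, F x y = ψ L - ψ y := fun y hy => by
    have : ∀ x, F x y = (Ioi y).indicator (deriv ψ) x := fun x => by simp [F, indicator]
    simp only [this]
    rw [integral_indicator measurableSet_Ioi, Measure.restrict_restrict measurableSet_Ioi,
      show Ioi y ∩ Ioo 0 L = Ioo y L by
        ext x
        simp only [mem_inter_iff, mem_Ioi, mem_Ioo]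
        exact ⟨fun h => ⟨h.1, h.2.2⟩, fun h => ⟨h.1, hy.1.trans_lt h.1, h.2⟩⟩,
      ← integral_Ioc_eq_integral_Ioo, ← intervalIntegral.integral_of_le hy.2]
    exact intervalIntegral.integral_deriv_eq_sub
      (fun x _ => (hψ.differentiable one_ne_zero).differentiableAt) (hdc.intervalIntegrable _ _)
  have h3 := integral_integral_swap hFi
  simp only [h1] at h3
  rw [h3, integral_congr_ae (hm.mono fun y hy => h2 y hy), integral_sub (integrable_const _) hψm,
    integral_const, smul_eq_mul]

variable {v : ℝ → ℝ} {α b₀ b₁ c : ℝ} {m : Measure ℝ}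

/-- The distributional derivative of `v`, including the boundary terms, is `α` times the Lebesgue
measure plus `c` times the measure `m`. -/
def HasGradient (L : ℝ) (v : ℝ → ℝ) (b₀ b₁ α c : ℝ) (m : Measure ℝ) : Prop :=
  IntegrableOn v (Ioo 0 L) ∧ (∀ᵐ y ∂m, y ∈ Icc 0 L) ∧
    ∀ ψ : ℝ → ℝ, ContDiff ℝ 1 ψ → ∫ x in Ioo 0 L, v x * deriv ψ x
      = b₁ * ψ L - b₀ * ψ 0 - α * (∫ x in Ioo 0 L, ψ x) - c * ∫ x, ψ x ∂m

namespace HasGradient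

theorem total (hL : 0 ≤ L) (h : HasGradient L v b₀ b₁ α c m) :
    b₁ - b₀ = α * L + c * m.real univ := by
  have := h.2.2 (fun _ => 1) contDiff_const
  simp [hL] at this
  linarith

/-- The identity is tested with primitives of test functions. They need not vanish at L, so the
boundary terms are seen and no additive constant remains free. -/
theorem ae_eq (hL : 0 ≤ L) [IsFiniteMeasure m] (h : HasGradient L v b₀ b₁ α c m) :
    v =ᵐ[volume.restrict (Ioo 0 L)] fun x => b₀ + α * x + c * m.real (Iio x) := by
  set g : ℝ → ℝ := fun x => b₀ + α * x + c * m.real (Iio x) with hg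
  have hmono : Monotone fun x => m.real (Iio x) := fun x y hxy =>
    measureReal_mono (Iio_subset_Iio hxy)
  have hmi : IntegrableOn (fun x => m.real (Iio x)) (Ioo 0 L) :=
    ((hmono.monotoneOn _).integrableOn_isCompact isCompact_Icc).mono_set Ioo_subset_Icc_self
  have hlin : IntegrableOn (fun x => b₀ + α * x) (Ioo 0 L) :=
    ((by fun_prop : Continuous fun x => b₀ + α * x).integrableOn_Icc).mono_set Ioo_subset_Icc_self
  have hgi : IntegrableOn g (Ioo 0 L) := hlin.add (hmi.const_mul c)
  have hdiff : IntegrableOn (fun x => v x - g x) (Ioo 0 L) := h.1.sub hgi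
  have h3 := isOpen_Ioo.ae_eq_zero_of_integral_contDiff_smul_eq_zero (μ := volume)
    hdiff.locallyIntegrableOn (by
    intro χ h1 h2 h3
    have hχ : IsTestFun (Ioo 0 L) χ := ⟨h1, h2, h3⟩
    set ψ : ℝ → ℝ := fun x => ∫ y in (0 : ℝ)..x, χ y
    have hψd : ∀ x, HasDerivAt ψ (χ x) x := fun x =>
      intervalIntegral.integral_hasDerivAt_right (h1.continuous.intervalIntegrable _ _)
        (h1.continuous.stronglyMeasurableAtFilter _ _) h1.continuous.continuousAt
    have hderiv : deriv ψ = χ := funext fun x => (hψd x).deriv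
    have hψ : ContDiff ℝ 1 ψ := contDiff_one_iff_deriv.2
      ⟨fun x => (hψd x).differentiableAt, by rw [hderiv]; exact h1.continuous⟩
    obtain ⟨C, hC⟩ := h2.exists_bound_of_continuous h1.continuous
    have hb : ∀ {f : ℝ → ℝ}, IntegrableOn f (Ioo 0 L) →
        Integrable (fun x => f x * χ x) (volume.restrict (Ioo 0 L)) := fun hf =>
      hf.mul_bdd (c := C) h1.continuous.aestronglyMeasurable (Eventually.of_forall hC)
    have e1 := h.2.2 ψ hψ
    have e2 := integral_Ioo_mul_deriv hL (φ := fun x => b₀ + α * x)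
      (by fun_prop : ContDiff ℝ 1 fun x => b₀ + α * x) hψ
    have e3 := integral_measureReal_Iio_mul_deriv m h.2.1 hψ
    have e4 : deriv (fun x => b₀ + α * x) = fun _ => α := by
      ext x
      simp
    simp only [hderiv, e4, integral_const_mul] at e1 e2 e3
    have e5 := h.total hL
    have e6 : ∫ x, χ x • (v x - g x) = ∫ x in Ioo 0 L, (v x - g x) * χ x := by
      rw [setIntegral_mul_isTestFun _ hχ]
      congr 1 with x
      rw [smul_eq_mul, mul_comm]
    have e7 : ∫ x in Ioo 0 L, (v x - g x) * χ x = (∫ x in Ioo 0 L, v x * χ x)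
        - ((∫ x in Ioo 0 L, (b₀ + α * x) * χ x)
          + c * ∫ x in Ioo 0 L, m.real (Iio x) * χ x) := by
      rw [← integral_const_mul, ← integral_add (hb hlin) ((hb hmi).const_mul c), ← integral_sub
        (hb h.1) (show Integrable (fun x => (b₀ + α * x) * χ x + c * (m.real (Iio x) * χ x)) _ from
          (hb hlin).add ((hb hmi).const_mul c))]
      congr 1 with x
      simp only [hg]
      ring
    rw [e6, e7, e1, e2, e3]
    have e8 : b₁ = b₀ + α * L + c * m.real univ := by linarith
    rw [e8]
    ring)
  rw [EventuallyEq, ae_restrict_iff' measurableSet_Ioo]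
  filter_upwards [h3] with x hx hxI using sub_eq_zero.1 (hx hxI)

theorem measureReal_Iic_zero (h : HasGradient L v b₀ b₁ α c m) : m.real (Iic 0) = m.real {0} := by
  refine measureReal_congr ?_
  filter_upwards [h.2.1] with x hx
  exact propext ⟨fun h => le_antisymm h hx.1, fun h => le_of_eq h⟩

theorem measureReal_Ici (h : HasGradient L v b₀ b₁ α c m) : m.real (Ici L) = m.real {L} := by
  refine measureReal_congr ?_
  filter_upwards [h.2.1] with x hx
  exact propext ⟨fun h => le_antisymm hx.2 h, fun h => ge_of_eq h⟩

theorem isTrace_left (hL : 0 ≤ L) [IsFiniteMeasure m] (h : HasGradient L v b₀ b₁ α c m) :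
    IsTrace (Ioo 0 L) v 0 (b₀ + c * m.real {0}) := by
  refine isTrace_of_tendsto (h.ae_eq hL) ?_
  have h1 : Tendsto (fun x => b₀ + α * x) (𝓝[>] 0) (𝓝 b₀) :=
    (Continuous.tendsto' (by fun_prop) 0 b₀ (by simp)).mono_left nhdsWithin_le_nhds
  rw [← h.measureReal_Iic_zero]
  exact (h1.add ((tendsto_measureReal_Iio_right m).const_mul c)).mono_left
    (nhdsWithin_mono _ fun x hx => hx.1)

theorem isTrace_right (hL : 0 ≤ L) [IsFiniteMeasure m] (h : HasGradient L v b₀ b₁ α c m) :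
    IsTrace (Ioo 0 L) v L (b₁ - c * m.real {L}) := by
  refine isTrace_of_tendsto (h.ae_eq hL) ?_
  have h1 : Tendsto (fun x => b₀ + α * x) (𝓝[<] L) (𝓝 (b₀ + α * L)) :=
    (Continuous.tendsto (by fun_prop) L).mono_left nhdsWithin_le_nhds
  have h2 : b₁ - c * m.real {L} = b₀ + α * L + c * m.real (Iio L) := by
    rw [← compl_Ici, measureReal_compl measurableSet_Ici, h.measureReal_Ici]
    linarith [h.total hL]
  rw [h2]
  exact (h1.add ((tendsto_measureReal_Iio_left m L).const_mul c)).mono_left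
    (nhdsWithin_mono _ fun x hx => hx.2)

theorem hasDistribDeriv [IsFiniteMeasure m] (h : HasGradient L v b₀ b₁ α c m) {f : ℝ → ℝ}
    (hf : f =ᵐ[volume.restrict (Ioo 0 L)] fun _ => α) :
    HasDistribDeriv (Ioo 0 L) v ((volume.restrict (Ioo 0 L)).withDensityᵥ f
      + (c • m.toSignedMeasure).restrict (Ioo 0 L)) := by
  have hd : (volume.restrict (Ioo 0 L)).withDensityᵥ f
      = α • (volume.restrict (Ioo 0 L)).toSignedMeasure := by
    have hc : Integrable (fun _ : ℝ => α) (volume.restrict (Ioo 0 L)) := integrable_const α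
    ext E hE
    rw [WithDensityᵥEq.congr_ae hf, withDensityᵥ_apply hc hE, setIntegral_const, _root_.smul_apply,
      Measure.toSignedMeasure_apply_measurable hE, smul_eq_mul, smul_eq_mul, mul_comm]
  have hr : (c • m.toSignedMeasure).restrict (Ioo 0 L)
      = c • (m.restrict (Ioo 0 L)).toSignedMeasure := by
    rw [VectorMeasure.restrict_smul, 
      Measure.toSignedMeasure_restrict_eq_restrict_toSignedMeasure _ _ measurableSet_Ioo]
  have hcar : ∀ n : Measure ℝ, ∀ _ : IsFiniteMeasure (n.restrict (Ioo 0 L)),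
      (n.restrict (Ioo 0 L)).toSignedMeasure.restrict (Ioo 0 L)
        = (n.restrict (Ioo 0 L)).toSignedMeasure := by
    intro n _
    ext E hE
    rw [VectorMeasure.restrict_apply _ measurableSet_Ioo hE,
      Measure.toSignedMeasure_apply_measurable hE,
      Measure.toSignedMeasure_apply_measurable (hE.inter measurableSet_Ioo), measureReal_restrict_apply hE,
      measureReal_restrict_apply (hE.inter measurableSet_Ioo), inter_assoc, inter_self]
  rw [hd, hr]
  refine ⟨?_, fun φ hφ => ?_⟩
  · rw [CarriedBy, VectorMeasure.restrict_add, VectorMeasure.restrict_smul,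
      VectorMeasure.restrict_smul, hcar, hcar]
  · obtain ⟨C, hC⟩ := hφ.2.1.exists_bound_of_continuous hφ.1.continuous
    have hzero : ∀ x ∉ Ioo 0 L, φ x = 0 := fun x hx =>
      image_eq_zero_of_notMem_tsupport fun h => hx (hφ.2.2 h)
    rw [VectorMeasure.integral_add_vectorMeasure (vectorIntegrable_of_bounded _ hφ.1.continuous hC)
      (vectorIntegrable_of_bounded _ hφ.1.continuous hC), VectorMeasure.integral_smul_vectorMeasure,
      VectorMeasure.integral_smul_vectorMeasure, vectorIntegral_toSignedMeasure,
      vectorIntegral_toSignedMeasure, h.2.2 φ (hφ.1.of_le (by simp)), hzero 0 (by simp),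
      hzero L (by simp), setIntegral_eq_integral_of_forall_compl_eq_zero (μ := m) hzero, smul_eq_mul,
      smul_eq_mul]
    ring

theorem restrict_boundary (hL : 0 < L) [IsFiniteMeasure m] :
    (c • m.toSignedMeasure).restrict {0, L}
      = VectorMeasure.dirac L (b₁ - (b₁ - c * m.real {L}))
        - VectorMeasure.dirac 0 (b₀ - (b₀ + c * m.real {0})) := by
  have hval : ∀ x : ℝ, (c • m.toSignedMeasure) {x} = c * m.real {x} := fun x => by
    rw [_root_.smul_apply, Measure.toSignedMeasure_apply_measurable (measurableSet_singleton x),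
      smul_eq_mul]
  rw [insert_eq, VectorMeasure.restrict_union (by simpa using hL.ne)
    (measurableSet_singleton _) (measurableSet_singleton _), VectorMeasure.restrict_singleton,
    VectorMeasure.restrict_singleton, hval, hval, sub_sub_cancel, sub_add_cancel_left]
  ext E hE
  by_cases h0 : (0 : ℝ) ∈ E <;> by_cases h1 : L ∈ E <;> simp [hE, h0, h1, add_comm]

end HasGradient

end Spatial

/-! ### The limit and perfect plasticity -/

section Plasticity

variable {L T a₀ a₁ κ : ℝ} {w : ℝ → H1 univ} {ε : ℕ → ℝ} {uε : ℕ → ℝ → H1 (Ioo 0 L)}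
  {Θε : ℕ → ℝ → ℝ → ℝ} {u e : ℝ → ℝ → ℝ} {p : ℝ → SignedMeasure ℝ} {σ : ℝ → ℝ}
  {μ : ℝ → SignedMeasure ℝ}

theorem tendsto_integral_mul_of_tendsto_eLpNorm_one {m : Measure ℝ} {f : ℕ → ℝ → ℝ} {g ψ : ℝ → ℝ}
    (hf : ∀ n, Integrable (f n) m) (hg : Integrable g m) (hψ : AEStronglyMeasurable ψ m) {C : ℝ}
    (hC : ∀ᵐ x ∂m, ‖ψ x‖ ≤ C)
    (h : Tendsto (fun n => eLpNorm (fun x => f n x - g x) 1 m) atTop (𝓝 0)) :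
    Tendsto (fun n => ∫ x, f n x * ψ x ∂m) atTop (𝓝 (∫ x, g x * ψ x ∂m)) := by
  refine tendsto_integral_of_L1' _ (hg.mul_bdd hψ hC).aestronglyMeasurable
    (Eventually.of_forall fun n => (hf n).mul_bdd hψ hC) ?_
  have h0 := ENNReal.Tendsto.const_mul (a := ENNReal.ofReal C) h (Or.inr ENNReal.ofReal_ne_top)
  rw [mul_zero] at h0
  refine tendsto_of_tendsto_of_tendsto_of_le_of_le tendsto_const_nhds h0 (fun _ => zero_le)
    fun n => ?_
  refine eLpNorm_le_mul_eLpNorm_of_ae_le_mul ?_ 1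
  filter_upwards [hC] with x hx
  rw [Pi.sub_apply, ← sub_mul, norm_mul, mul_comm]
  exact mul_le_mul_of_nonneg_right hx (norm_nonneg _)

theorem carriedBy_apply_eq_zero {ν : SignedMeasure ℝ} {X E : Set ℝ} (h : CarriedBy ν X)
    (hX : MeasurableSet X) (hE : MeasurableSet E) (hd : Disjoint E X) : ν E = 0 := by
  conv_lhs => rw [← h]
  rw [VectorMeasure.restrict_apply _ hX hE, hd.inter_eq, VectorMeasure.empty]

namespace IsLimitEvolution

/-- The identity at scale ε is passed to the limit with test functions that may be nonzero at the
ends. Weak-* convergence in the closed interval keeps the damage that concentrates there, so b₀ and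
b₁ are values of w, not traces of u. -/
theorem exists_hasGradient (hL : 0 < L) (ha₀ : 0 < a₀) (ha₁ : 0 < a₁)
    (hε : ∀ n, 0 < ε n ∧ ε n * a₀ < a₁) (hε₀ : Tendsto ε atTop (𝓝 0))
    (hev : ∀ n, IsBrittleEvolution L T a₀ a₁ κ (ε n) w (uε n) (Θε n))
    (hlim : IsLimitEvolution L T a₀ a₁ ε uε Θε u e p σ μ) {t : ℝ} (ht : t ∈ Icc 0 T) :
    ∃ m : Measure ℝ, ∃ _ : IsFiniteMeasure m, m.toSignedMeasure = μ t ∧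
      HasGradient L (u t) (contRep (w t) 0) (contRep (w t) L) (σ t / a₁) (σ t / a₀) m := by
  obtain ⟨m, hm, hmμ⟩ := exists_toSignedMeasure_eq
    (hlim.damage_nonneg (fun n => (hε n).1) hev ht)
  have hu := hlim.displacement t ht
  refine ⟨m, hm, hmμ, hu.1, ?_, fun ψ hψ => ?_⟩
  · have h1 := carriedBy_apply_eq_zero (hlim.damage t ht).1 measurableSet_Icc
      measurableSet_Icc.compl disjoint_compl_left
    rw [← hmμ, Measure.toSignedMeasure_apply_measurable measurableSet_Icc.compl,
      measureReal_eq_zero_iff] at h1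
    exact h1
  · have hdc : Continuous (deriv ψ) := hψ.continuous_deriv le_rfl
    obtain ⟨C, hC⟩ := (isCompact_Icc (a := (0 : ℝ)) (b := L)).exists_bound_of_continuousOn
      hdc.continuousOn
    have hψm := continuous_memLp_Ioo hψ.continuous L
    have l1 := tendsto_integral_mul_of_tendsto_eLpNorm_one
      (fun n => integrable_of_memLp_Ioo (memLp_fn (uε n t))) hu.1 hdc.aestronglyMeasurable
      ((ae_restrict_mem measurableSet_Ioo).mono fun x hx => hC x (Ioo_subset_Icc_self hx)) hu.2.1
    have l2 := (((hlim.elastic t ht).2 ψ hψm).add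
      ((hlim.plastic t ht).2 ψ hψ.continuous)).const_sub
        (contRep (w t) L * ψ L - contRep (w t) 0 * ψ 0)
    have e1 : ∫ x in Ioo 0 L, ψ x * e t x = σ t / a₁ * ∫ x in Ioo 0 L, ψ x := by
      rw [← integral_const_mul]
      refine integral_congr_ae ?_
      filter_upwards [hlim.elastic_ae_eq hL ha₀ ha₁ hε hε₀ hev ht] with x hx
      rw [hx, mul_comm]
    have e2 : ∫ᵛ x, ψ x ∂•(p t) = σ t / a₀ * ∫ x, ψ x ∂m := by
      rw [hlim.plastic_eq hL ha₀ ha₁ hε hε₀ hev ht, VectorMeasure.integral_smul_vectorMeasure,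
        smul_eq_mul, ← hmμ, vectorIntegral_toSignedMeasure]
    rw [e1, e2, ← sub_sub] at l2
    refine tendsto_nhds_unique l1 (l2.congr fun n => ?_)
    rw [SameBoundaryValues.integral_mul_deriv hL.le ((hev n).dirichlet t ht) hψ]
    congr 1
    have hf := (hev n).fraction t ht
    have hst := (hev n).stress_ae_eq hL ha₀ ha₁ (hε n).1 (hε n).2 ht
    set s := jump L (w t) / compliance L a₀ a₁ (ε n) (damageMass L (ε n) (Θε n t))
    have hΘm : MemLp (Θε n t) 2 (volume.restrict (Ioo 0 L)) := memLp_of_mem_Icc hf.1 hf.2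
    have hdm : MemLp (fun x => (1 - Θε n t x) / ε n) 2 (volume.restrict (Ioo 0 L)) :=
      ((memLp_const 1).sub hΘm).mul_const (ε n)⁻¹
    rw [← integral_add]
    · refine integral_congr_ae ?_
      filter_upwards [(hev n).grad_ae_eq ha₀ ha₁ (hε n).1 (hε n).2 ht] with x hx
      rw [hx]
      ring
    · refine ((hψm.integrable_mul hΘm).const_mul (s / a₁)).congr ?_
      filter_upwards [hst] with x hx
      rw [hx, Pi.mul_apply]
      ring
    · refine ((hψm.integrable_mul hdm).const_mul (s / a₀)).congr ?_
      filter_upwards [hst] with x hx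
      rw [hx, Pi.mul_apply]
      ring

theorem elastic_energy (hL : 0 < L) (ha₀ : 0 < a₀) (ha₁ : 0 < a₁)
    (hε : ∀ n, 0 < ε n ∧ ε n * a₀ < a₁) (hε₀ : Tendsto ε atTop (𝓝 0))
    (hev : ∀ n, IsBrittleEvolution L T a₀ a₁ κ (ε n) w (uε n) (Θε n))
    (hlim : IsLimitEvolution L T a₀ a₁ ε uε Θε u e p σ μ) {t : ℝ} (ht : t ∈ Icc 0 T) :
    ∫ x in Ioo 0 L, a₁ * e t x ^ 2 = σ t ^ 2 * (L / a₁) := by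
  have : ∫ x in Ioo 0 L, a₁ * e t x ^ 2 = ∫ x in Ioo 0 L, a₁ * (σ t / a₁) ^ 2 := by
    refine integral_congr_ae ?_
    filter_upwards [hlim.elastic_ae_eq hL ha₀ ha₁ hε hε₀ hev ht] with x hx
    rw [hx]
  rw [this, setIntegral_const, Real.volume_real_Ioo_of_le hL.le, smul_eq_mul]
  field_simp
  ring

theorem power_ae_eq (hL : 0 < L) (ha₀ : 0 < a₀) (ha₁ : 0 < a₁)
    (hw : AbsolutelyContinuousOnInterval w 0 T)
    (hε : ∀ n, 0 < ε n ∧ ε n * a₀ < a₁) (hε₀ : Tendsto ε atTop (𝓝 0))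
    (hev : ∀ n, IsBrittleEvolution L T a₀ a₁ κ (ε n) w (uε n) (Θε n))
    (hlim : IsLimitEvolution L T a₀ a₁ ε uε Θε u e p σ μ) {t : ℝ} (ht : t ∈ Icc 0 T) :
    ∀ᵐ s, s ∈ uIoc 0 t → ∫ x in Ioo 0 L, a₁ * e s x * grad (timeDeriv w s) x
      = jump L (w s) / limitCompliance L a₀ a₁ μ s * deriv (fun s => jump L (w s)) s := by
  filter_upwards [ae_deriv_jump hL.le hw] with s hs hst
  rw [uIoc_of_le ht.1] at hst
  have hsT : s ∈ Icc 0 T := ⟨hst.1.le, hst.2.trans ht.2⟩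
  rw [← hs (by rwa [uIcc_of_le (ht.1.trans ht.2)]), ← hlim.stress_eq hL ha₀ ha₁ hε hε₀ hev hsT,
    ← integral_const_mul]
  refine integral_congr_ae ?_
  filter_upwards [hlim.elastic_ae_eq hL ha₀ ha₁ hε hε₀ hev hsT] with x hx
  rw [hx, mul_div_cancel₀ _ ha₁.ne']

end IsLimitEvolution

/-! ### The variation in time -/

theorem timeVariation_mono (L : ℝ) (q : ℝ → SignedMeasure ℝ) {r s t : ℝ} (hst : s ≤ t) :
    timeVariation L q r s ≤ timeVariation L q r t := by
  refine iSup_le fun n => iSup₂_le fun ρ hρ => ?_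
  set ρ' : ℕ → ℝ := fun i => if i ≤ n then ρ i else t
  have hmono : Monotone ρ' := by
    intro i j hij
    by_cases hj : j ≤ n
    · simpa [ρ', hj, hij.trans hj] using hρ.1 hij
    · by_cases hi : i ≤ n
      · simp only [ρ', hi, hj, if_true, if_false]
        exact (hρ.1 hi).trans (hρ.2.2.le.trans hst)
      · simp [ρ', hi, hj]
  refine le_trans ?_ (le_iSup_of_le (n + 1) (le_iSup₂_of_le ρ'
    ⟨hmono, by simpa [ρ'] using hρ.2.1, by simp [ρ']⟩ le_rfl))
  rw [Finset.sum_range_succ]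
  refine le_add_right (Finset.sum_le_sum fun i hi => le_of_eq ?_)
  have hi' := Finset.mem_range.1 hi
  simp [ρ', hi'.le, Nat.succ_le_of_lt hi']

/-- The increments telescope, so every partition gives the same sum, and the one-step partition
attains the supremum. -/
theorem timeVariation_eq_of_increments {L : ℝ} {q : ℝ → SignedMeasure ℝ} {D : ℝ → ℝ} {s t : ℝ}
    (hst : s ≤ t) (hD : MonotoneOn D (Icc s t))
    (h : ∀ x ∈ Icc s t, ∀ y ∈ Icc s t, x ≤ y →
      (q y - q x).variation (Icc 0 L) = ENNReal.ofReal (D y - D x)) :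
    timeVariation L q s t = ENNReal.ofReal (D t - D s) := by
  refine le_antisymm (iSup_le fun n => iSup₂_le fun ρ hρ => ?_) ?_
  · obtain ⟨hm, h0, hn⟩ := hρ
    have hmem : ∀ i ≤ n, ρ i ∈ Icc s t := fun i hi =>
      ⟨h0 ▸ hm (Nat.zero_le i), hn ▸ hm hi⟩
    have hle : ∀ k ≤ n, ∑ i ∈ Finset.range k, (q (ρ (i + 1)) - q (ρ i)).variation (Icc 0 L)
        = ENNReal.ofReal (D (ρ k) - D (ρ 0)) := by
      intro k
      induction k with
      | zero => simp
      | succ k ih =>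
        intro hk
        have h1 := hmem k (by lia)
        have h2 := hmem (k + 1) hk
        have h3 := hmem 0 (by lia)
        rw [Finset.sum_range_succ, ih (by lia), h _ h1 _ h2 (hm (by lia)), ← ENNReal.ofReal_add
          (sub_nonneg.2 (hD h3 h1 (hm (by lia)))) (sub_nonneg.2 (hD h1 h2 (hm (by lia))))]
        congr 1
        ring
    rw [hle n le_rfl, h0, hn]
  · rw [← h s (left_mem_Icc.2 hst) t (right_mem_Icc.2 hst) hst]
    refine le_iSup_of_le 1 (le_iSup₂_of_le (fun i => if i = 0 then s else t)
      ⟨?_, by simp, by simp⟩ (by simp))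
    refine monotone_nat_of_le_succ fun i => ?_
    by_cases hi : i = 0 <;> simp [hi, hst]

end Plasticity

/-! ### Perfect plasticity and saturation of the stress -/

section Equivalence

variable {L T a₀ a₁ κ : ℝ} {w : ℝ → H1 univ} {ε : ℕ → ℝ} {uε : ℕ → ℝ → H1 (Ioo 0 L)}
  {Θε : ℕ → ℝ → ℝ → ℝ} {u e : ℝ → ℝ → ℝ} {p : ℝ → SignedMeasure ℝ} {σ : ℝ → ℝ}
  {μ : ℝ → SignedMeasure ℝ}

theorem limitCompliance_eq_iff (ha₀ : 0 < a₀) {t : ℝ} :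
    limitCompliance L a₀ a₁ μ t = L / a₁ ↔ μ t (Icc 0 L) = 0 := by
  rw [limitCompliance, add_eq_left, div_eq_zero_iff, or_iff_left ha₀.ne']

namespace IsLimitEvolution

theorem damage_eq_zero (hε : ∀ n, 0 < ε n)
    (hev : ∀ n, IsBrittleEvolution L T a₀ a₁ κ (ε n) w (uε n) (Θε n))
    (hlim : IsLimitEvolution L T a₀ a₁ ε uε Θε u e p σ μ) {t : ℝ} (ht : t ∈ Icc 0 T)
    (h0 : μ t (Icc 0 L) = 0) : μ t = 0 := by
  obtain ⟨m, hm, hmμ⟩ := exists_toSignedMeasure_eq (hlim.damage_nonneg hε hev ht)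
  rw [← carriedBy_apply_univ (hlim.damage t ht).1 measurableSet_Icc, ← hmμ,
    Measure.toSignedMeasure_apply_measurable MeasurableSet.univ, measureReal_eq_zero_iff,
    Measure.measure_univ_eq_zero] at h0
  subst h0
  rw [← hmμ, Measure.toSignedMeasure_zero]

theorem abs_stress_eq_iff (hL : 0 < L) (ha₀ : 0 < a₀) (ha₁ : 0 < a₁)
    (hε : ∀ n, 0 < ε n ∧ ε n * a₀ < a₁) (hε₀ : Tendsto ε atTop (𝓝 0))
    (hev : ∀ n, IsBrittleEvolution L T a₀ a₁ κ (ε n) w (uε n) (Θε n))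
    (hlim : IsLimitEvolution L T a₀ a₁ ε uε Θε u e p σ μ) {t : ℝ} (ht : t ∈ Icc 0 T) {k : ℝ} :
    |σ t| = k ↔ |jump L (w t)| = k * limitCompliance L a₀ a₁ μ t := by
  have hA := hlim.limitCompliance_pos hL ha₀ ha₁ (fun n => (hε n).1) hev ht
  rw [hlim.stress_eq hL ha₀ ha₁ hε hε₀ hev ht, abs_div, abs_of_pos hA, div_eq_iff hA.ne']

/-- Either there is no damage at r and p r = 0, or the stress is the same at both times and factors
out of a difference of ordered measures. In both cases the variation is a mass. -/
theorem variation_plastic_sub (hL : 0 < L) (hT : 0 < T) (ha₀ : 0 < a₀) (ha₁ : 0 < a₁)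
    (hκ : 0 < κ) (hw : AbsolutelyContinuousOnInterval w 0 T)
    (hε : ∀ n, 0 < ε n ∧ ε n * a₀ < a₁) (hε₀ : Tendsto ε atTop (𝓝 0))
    (hev : ∀ n, IsBrittleEvolution L T a₀ a₁ κ (ε n) w (uε n) (Θε n))
    (hlim : IsLimitEvolution L T a₀ a₁ ε uε Θε u e p σ μ)
    (hsat : ∀ t ∈ Icc 0 T, limitCompliance L a₀ a₁ μ t = L / a₁ ∨
      |jump L (w t)| = √(2 * κ * a₀) * limitCompliance L a₀ a₁ μ t)
    {r s : ℝ} (hr : r ∈ Icc 0 T) (hs : s ∈ Icc 0 T) (hrs : r ≤ s) :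
    (p s - p r).variation (Icc 0 L) = ENNReal.ofReal
      (√(2 * κ * a₀) / a₀ * μ s (Icc 0 L) - √(2 * κ * a₀) / a₀ * μ r (Icc 0 L)) := by
  have hεpos := fun n => (hε n).1
  have hsc := hlim.isComplianceEvolution hL hT ha₀ ha₁ hκ hw hε hε₀ hev
  have hσ : ∀ t ∈ Icc 0 T, μ t (Icc 0 L) ≠ 0 → |σ t| = √(2 * κ * a₀) := fun t ht hM =>
    (hlim.abs_stress_eq_iff hL ha₀ ha₁ hε hε₀ hev ht).2
      ((hsat t ht).resolve_left fun h => hM ((limitCompliance_eq_iff ha₀).1 h))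
  rw [hlim.plastic_eq hL ha₀ ha₁ hε hε₀ hev hr, hlim.plastic_eq hL ha₀ ha₁ hε hε₀ hev hs]
  by_cases hM : μ r (Icc 0 L) = 0
  · rw [hlim.damage_eq_zero hεpos hev hr hM, smul_zero, sub_zero,
      variation_smul_apply (hlim.damage_nonneg hεpos hev hs) _ measurableSet_Icc, abs_div,
      abs_of_pos ha₀, _root_.zero_apply, mul_zero, sub_zero]
    by_cases hM' : μ s (Icc 0 L) = 0
    · rw [hM', mul_zero, mul_zero]
    · rw [hσ s hs hM']
  · have hM' : μ s (Icc 0 L) ≠ 0 := fun h => hM (le_antisymm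
      ((hlim.damage_mono hεpos hev hr hs hrs _).trans h.le) (hlim.damage_nonneg hεpos hev hr _))
    have h1 := hsc.stress_eq_of_saturated hsat hr hs hrs
      fun h => hM ((limitCompliance_eq_iff ha₀).1 h)
    rw [← hlim.stress_eq hL ha₀ ha₁ hε hε₀ hev hr, ← hlim.stress_eq hL ha₀ ha₁ hε hε₀ hev hs] at h1
    have h2 : (σ s / a₀) • μ s - (σ s / a₀) • μ r = (σ s / a₀) • (μ s - μ r) := by
      ext E _
      simp only [_root_.sub_apply, _root_.smul_apply, smul_eq_mul, mul_sub]
    rw [h1, h2, variation_smul_apply (fun E => sub_nonneg.2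
      (hlim.damage_mono hεpos hev hr hs hrs E)) _ measurableSet_Icc, abs_div, abs_of_pos ha₀,
      hσ s hs hM', _root_.sub_apply, mul_sub]

theorem timeVariation_plastic (hL : 0 < L) (hT : 0 < T) (ha₀ : 0 < a₀) (ha₁ : 0 < a₁)
    (hκ : 0 < κ) (hw : AbsolutelyContinuousOnInterval w 0 T)
    (hε : ∀ n, 0 < ε n ∧ ε n * a₀ < a₁) (hε₀ : Tendsto ε atTop (𝓝 0))
    (hev : ∀ n, IsBrittleEvolution L T a₀ a₁ κ (ε n) w (uε n) (Θε n))
    (hlim : IsLimitEvolution L T a₀ a₁ ε uε Θε u e p σ μ)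
    (hsat : ∀ t ∈ Icc 0 T, limitCompliance L a₀ a₁ μ t = L / a₁ ∨
      |jump L (w t)| = √(2 * κ * a₀) * limitCompliance L a₀ a₁ μ t)
    {t : ℝ} (ht : t ∈ Icc 0 T) :
    timeVariation L p 0 t = ENNReal.ofReal
      (√(2 * κ * a₀) / a₀ * μ t (Icc 0 L) - √(2 * κ * a₀) / a₀ * μ 0 (Icc 0 L)) := by
  have hsub : Icc 0 t ⊆ Icc 0 T := Icc_subset_Icc_right ht.2
  refine timeVariation_eq_of_increments (D := fun t => √(2 * κ * a₀) / a₀ * μ t (Icc 0 L)) ht.1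
    (fun r hr s hs hrs => ?_) fun r hr s hs hrs =>
      hlim.variation_plastic_sub hL hT ha₀ ha₁ hκ hw hε hε₀ hev hsat (hsub hr) (hsub hs) hrs
  exact mul_le_mul_of_nonneg_left
    (hlim.damage_mono (fun n => (hε n).1) hev (hsub hr) (hsub hs) hrs _) (by positivity)

theorem isPerfectPlasticEvolution (hL : 0 < L) (hT : 0 < T) (ha₀ : 0 < a₀) (ha₁ : 0 < a₁)
    (hκ : 0 < κ) (hw : AbsolutelyContinuousOnInterval w 0 T)
    (hε : ∀ n, 0 < ε n ∧ ε n * a₀ < a₁) (hε₀ : Tendsto ε atTop (𝓝 0))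
    (hev : ∀ n, IsBrittleEvolution L T a₀ a₁ κ (ε n) w (uε n) (Θε n))
    (hlim : IsLimitEvolution L T a₀ a₁ ε uε Θε u e p σ μ)
    (hsat : ∀ t ∈ Icc 0 T, limitCompliance L a₀ a₁ μ t = L / a₁ ∨
      |jump L (w t)| = √(2 * κ * a₀) * limitCompliance L a₀ a₁ μ t) :
    IsPerfectPlasticEvolution L T a₀ a₁ κ w u e p := by
  have hεpos := fun n => (hε n).1
  have h0 : (0 : ℝ) ∈ Icc 0 T := left_mem_Icc.2 hT.le
  have hTT : T ∈ Icc 0 T := right_mem_Icc.2 hT.le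
  have hsc := hlim.isComplianceEvolution hL hT ha₀ ha₁ hκ hw hε hε₀ hev
  have hstress : ∀ t ∈ Icc 0 T, σ t = jump L (w t) / limitCompliance L a₀ a₁ μ t :=
    fun t ht => hlim.stress_eq hL ha₀ ha₁ hε hε₀ hev ht
  have helastic : ∀ t ∈ Icc 0 T, ∀ᵐ x ∂volume.restrict (Ioo 0 L), a₁ * e t x = σ t := by
    intro t ht
    filter_upwards [hlim.elastic_ae_eq hL ha₀ ha₁ hε hε₀ hev ht] with x hx
    rw [hx, mul_div_cancel₀ _ ha₁.ne']
  have hadd : ∀ t ∈ Icc 0 T, HasDistribDeriv (Ioo 0 L) (u t)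
      ((volume.restrict (Ioo 0 L)).withDensityᵥ (e t) + (p t).restrict (Ioo 0 L)) := by
    intro t ht
    obtain ⟨m, hm, hmμ, hgrad⟩ := hlim.exists_hasGradient hL ha₀ ha₁ hε hε₀ hev ht
    rw [hlim.plastic_eq hL ha₀ ha₁ hε hε₀ hev ht, ← hmμ]
    exact hgrad.hasDistribDeriv (hlim.elastic_ae_eq hL ha₀ ha₁ hε hε₀ hev ht)
  refine ⟨fun t ht => ⟨(hlim.displacement t ht).1, _, hadd t ht⟩, fun t ht => (hlim.elastic t ht).1,
    fun t ht => (hlim.plastic t ht).1, hadd, ?_, ?_, ?_, ?_, ?_, ?_⟩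
  · intro t ht
    obtain ⟨m, hm, hmμ, hgrad⟩ := hlim.exists_hasGradient hL ha₀ ha₁ hε hε₀ hev ht
    refine ⟨_, _, hgrad.isTrace_left hL.le, hgrad.isTrace_right hL.le, ?_⟩
    rw [hlim.plastic_eq hL ha₀ ha₁ hε hε₀ hev ht, ← hmμ]
    exact HasGradient.restrict_boundary hL
  · intro t ht v g hvg
    have h1 : ∫ x in Ioo 0 L, a₁ * e t x * g x = ∫ x in Ioo 0 L, σ t * g x :=
      integral_congr_ae ((helastic t ht).mono fun x hx => by simp only [hx])
    rw [h1, integral_const_mul, hvg.integral_eq_zero hL.le, mul_zero]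
  · intro t ht
    filter_upwards [helastic t ht] with x hx
    rw [hx, hstress t ht]
    exact abs_le.1 (hsc.abs_stress_le ht)
  · rw [hlim.timeVariation_plastic hL hT ha₀ ha₁ hκ hw hε hε₀ hev hsat hTT]
    exact ENNReal.ofReal_ne_top
  · refine (hsc.intervalIntegrable_power h0 hTT).congr_ae ?_
    rw [EventuallyEq, ae_restrict_iff' measurableSet_uIoc]
    exact (hlim.power_ae_eq hL ha₀ ha₁ hw hε hε₀ hev hTT).mono fun s hs h => (hs h).symm
  · intro t ht
    have hk : √(2 * κ * a₀) ^ 2 = 2 * κ * a₀ := Real.sq_sqrt (by positivity)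
    have hE : ∀ t ∈ Icc 0 T, jump L (w t) ^ 2 / (2 * limitCompliance L a₀ a₁ μ t)
        + √(2 * κ * a₀) ^ 2 / 2 * limitCompliance L a₀ a₁ μ t
        = 1 / 2 * (σ t ^ 2 * (L / a₁)) + √(2 * κ * a₀) ^ 2 / 2 * (L / a₁)
          + √(2 * κ * a₀) * (√(2 * κ * a₀) / a₀ * μ t (Icc 0 L)) := by
      intro t ht
      have hA := hsc.compliance_pos ht
      have h1 : jump L (w t) ^ 2 / (2 * limitCompliance L a₀ a₁ μ t)
          = 1 / 2 * (σ t ^ 2 * limitCompliance L a₀ a₁ μ t) := by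
        rw [hstress t ht]
        field_simp
      -- Saturation is needed only where there is damage: otherwise both sides vanish. It makes half
      -- of the dissipation appear inside J² / (2A); the other half is the damage energy.
      have h2 : σ t ^ 2 * μ t (Icc 0 L) = √(2 * κ * a₀) ^ 2 * μ t (Icc 0 L) := by
        rcases hsat t ht with h | h
        · rw [(limitCompliance_eq_iff ha₀).1 h, mul_zero, mul_zero]
        · rw [← sq_abs (σ t), (hlim.abs_stress_eq_iff hL ha₀ ha₁ hε hε₀ hev ht).2 h]
      have h3 : σ t ^ 2 * (μ t (Icc 0 L) / a₀) = √(2 * κ * a₀) ^ 2 * (μ t (Icc 0 L) / a₀) := by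
        rw [← mul_div_assoc, h2, mul_div_assoc]
      rw [h1, limitCompliance, mul_add, h3]
      ring
    have hV : (timeVariation L p 0 t).toReal
        = √(2 * κ * a₀) / a₀ * μ t (Icc 0 L) - √(2 * κ * a₀) / a₀ * μ 0 (Icc 0 L) := by
      rw [hlim.timeVariation_plastic hL hT ha₀ ha₁ hκ hw hε hε₀ hev hsat ht, ENNReal.toReal_ofReal]
      rw [← mul_sub]
      exact mul_nonneg (by positivity) (sub_nonneg.2 (hlim.damage_mono hεpos hev h0 ht ht.1 _))
    rw [hlim.elastic_energy hL ha₀ ha₁ hε hε₀ hev ht, hlim.elastic_energy hL ha₀ ha₁ hε hε₀ hev h0,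
      intervalIntegral.integral_congr_ae (hlim.power_ae_eq hL ha₀ ha₁ hw hε hε₀ hev ht), hV]
    have hbal := hsc.balance t ht
    rw [hE t ht, hE 0 h0] at hbal
    linarith

/-- The brittle and plastic balances have the same power. Between an unsaturated damaged time t and
the earlier saturated time s of equal compliance, the stress drops in modulus, and the difference of
the balances would require negative dissipation. -/
theorem saturated_of_isPerfectPlasticEvolution (hL : 0 < L) (hT : 0 < T) (ha₀ : 0 < a₀)
    (ha₁ : 0 < a₁) (hκ : 0 < κ) (hw : AbsolutelyContinuousOnInterval w 0 T)
    (hε : ∀ n, 0 < ε n ∧ ε n * a₀ < a₁) (hε₀ : Tendsto ε atTop (𝓝 0))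
    (hev : ∀ n, IsBrittleEvolution L T a₀ a₁ κ (ε n) w (uε n) (Θε n))
    (hlim : IsLimitEvolution L T a₀ a₁ ε uε Θε u e p σ μ)
    (hp : IsPerfectPlasticEvolution L T a₀ a₁ κ w u e p) {t : ℝ} (ht : t ∈ Icc 0 T) :
    limitCompliance L a₀ a₁ μ t = L / a₁ ∨
      |jump L (w t)| = √(2 * κ * a₀) * limitCompliance L a₀ a₁ μ t := by
  have hsc := hlim.isComplianceEvolution hL hT ha₀ ha₁ hκ hw hε hε₀ hev
  by_contra! hcon
  have hlt : L / a₁ < limitCompliance L a₀ a₁ μ t := (hsc.le_compliance t ht).lt_of_ne' hcon.1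
  obtain ⟨s, hs, hAs, hJs⟩ := hsc.exists_saturated ht hlt
  have hsT : s ∈ Icc 0 T := ⟨hs.1, hs.2.trans ht.2⟩
  have hAt := hsc.compliance_pos ht
  have hσs : σ s ^ 2 = √(2 * κ * a₀) ^ 2 := by
    rw [← sq_abs, (hlim.abs_stress_eq_iff hL ha₀ ha₁ hε hε₀ hev hsT).2 hJs]
  have hσt : σ t ^ 2 < √(2 * κ * a₀) ^ 2 := by
    rw [← sq_abs]
    refine pow_lt_pow_left₀ (lt_of_le_of_ne ?_ fun h => hcon.2
      ((hlim.abs_stress_eq_iff hL ha₀ ha₁ hε hε₀ hev ht).1 h)) (abs_nonneg _) two_ne_zero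
    rw [hlim.stress_eq hL ha₀ ha₁ hε hε₀ hev ht]
    exact hsc.abs_stress_le ht
  have hV : (timeVariation L p 0 s).toReal ≤ (timeVariation L p 0 t).toReal :=
    ENNReal.toReal_mono (ne_top_of_le_ne_top hp.boundedVariation (timeVariation_mono L p ht.2))
      (timeVariation_mono L p hs.2)
  have hJ : ∀ τ ∈ Icc 0 T, jump L (w τ) ^ 2 / (2 * limitCompliance L a₀ a₁ μ τ)
      = 1 / 2 * (σ τ ^ 2 * limitCompliance L a₀ a₁ μ τ) := by
    intro τ hτ
    have := hsc.compliance_pos hτ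
    rw [hlim.stress_eq hL ha₀ ha₁ hε hε₀ hev hτ]
    field_simp
  have hb1 := hsc.balance s hsT
  have hb2 := hsc.balance t ht
  have he1 := hp.energyBalance s hsT
  have he2 := hp.energyBalance t ht
  rw [hJ s hsT, hAs] at hb1
  rw [hJ t ht] at hb2
  rw [hlim.elastic_energy hL ha₀ ha₁ hε hε₀ hev hsT,
    intervalIntegral.integral_congr_ae (hlim.power_ae_eq hL ha₀ ha₁ hw hε hε₀ hev hsT)] at he1
  rw [hlim.elastic_energy hL ha₀ ha₁ hε hε₀ hev ht,
    intervalIntegral.integral_congr_ae (hlim.power_ae_eq hL ha₀ ha₁ hw hε hε₀ hev ht)] at he2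
  -- The brittle elastic energy is σ² A / 2 and the plastic one σ² (L / a₁) / 2. Since A s = A t,
  -- the term k² A / 2 drops out and this gap equals the dissipation.
  have h1 : (σ t ^ 2 - σ s ^ 2) * (limitCompliance L a₀ a₁ μ t - L / a₁)
      = 2 * (√(2 * κ * a₀) * ((timeVariation L p 0 t).toReal
        - (timeVariation L p 0 s).toReal)) := by
    linarith
  have h2 : (σ t ^ 2 - σ s ^ 2) * (limitCompliance L a₀ a₁ μ t - L / a₁) < 0 :=
    mul_neg_of_neg_of_pos (by linarith) (sub_pos.2 hlt)
  have h3 : 0 ≤ √(2 * κ * a₀) * ((timeVariation L p 0 t).toReal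
      - (timeVariation L p 0 s).toReal) := mul_nonneg (Real.sqrt_nonneg _) (sub_nonneg.2 hV)
  linarith

end IsLimitEvolution

end Equivalence

end BrittleDamage

end

theorem theorem1p2
    (L T a₀ a₁ κ : ℝ) (hL : 0 < L) (hT : 0 < T) (ha₀ : 0 < a₀) (ha₁ : 0 < a₁) (hκ : 0 < κ)
    -- the boundary datum `w ∈ AC([0,T]; H¹(ℝ))`
    (w : ℝ → H1 univ) (hw : AbsolutelyContinuousOnInterval w 0 T)
    -- brittle damage evolutions along a sequence of scales that tends to zero
    (ε : ℕ → ℝ) (hε : ∀ n, 0 < ε n ∧ ε n * a₀ < a₁) (hε₀ : Tendsto ε atTop (𝓝 0))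
    (uε : ℕ → ℝ → H1 (Ioo 0 L)) (Θε : ℕ → ℝ → ℝ → ℝ)
    (hev : ∀ n, IsBrittleEvolution L T a₀ a₁ κ (ε n) w (uε n) (Θε n))
    -- their limit
    (u e : ℝ → ℝ → ℝ) (p : ℝ → SignedMeasure ℝ) (σ : ℝ → ℝ) (μ : ℝ → SignedMeasure ℝ)
    (hlim : IsLimitEvolution L T a₀ a₁ ε uε Θε u e p σ μ) :
    (IsPerfectPlasticEvolution L T a₀ a₁ κ w u e p ↔
      ∀ s t : ℝ, 0 ≤ s → s < t → t ≤ T → |jump L (w t)| < |jump L (w s)| →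
        |jump L (w t)| ≤ √(2 * κ * a₀) * (L / a₁)) ∧
    (IsPerfectPlasticEvolution L T a₀ a₁ κ w u e p ↔
      (μ T (Icc 0 L) ≠ 0 → ∀ t ∈ Icc (onset L T μ) T, |σ t| = √(2 * κ * a₀))) := by
  have hsc := hlim.isComplianceEvolution hL hT ha₀ ha₁ hκ hw hε hε₀ hev
  have hiff : IsPerfectPlasticEvolution L T a₀ a₁ κ w u e p ↔
      ∀ t ∈ Icc 0 T, limitCompliance L a₀ a₁ μ t = L / a₁ ∨
        |jump L (w t)| = √(2 * κ * a₀) * limitCompliance L a₀ a₁ μ t :=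
    ⟨fun hp _ => hlim.saturated_of_isPerfectPlasticEvolution hL hT ha₀ ha₁ hκ hw hε hε₀ hev hp,
      hlim.isPerfectPlasticEvolution hL hT ha₀ ha₁ hκ hw hε hε₀ hev⟩
  refine ⟨hiff.trans hsc.saturated_iff_datum, hiff.trans (hsc.saturated_iff_onset.trans ?_)⟩
  have honset : sSup {t | t ∈ Icc 0 T ∧ limitCompliance L a₀ a₁ μ t = L / a₁} = onset L T μ := by
    simp only [limitCompliance_eq_iff ha₀, onset]
  have h0 : 0 ≤ onset L T μ := Real.sSup_nonneg fun t ht => ht.1.1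
  rw [honset, Ne, limitCompliance_eq_iff ha₀]
  exact forall_congr' fun _ => forall₂_congr fun t ht =>
    (hlim.abs_stress_eq_iff hL ha₀ ha₁ hε hε₀ hev ⟨h0.trans ht.1, ht.2⟩).symm
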